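/- Let $2\le k\le n$ be integers, let all indices $i$ of $x_i,y_i,p_i,q_i$ be taken modulo $n$, and put $r=[k/2]-1$, $r'=k-2-r$. For $k\ge 3$ let $L_i(\lambda)$ be the $k\times k$ matrix whose only nonzero entries are $x_i$ and $x_i+y_i$ in positions $(1,k-1)$ and $(1,k)$, $\lambda$ in position $(2,1)$, $1$ in positions $(a,a-1)$ for $3\le a\le k$, and $1$ in position $(k,k)$; for $k=2$ let $L_i(\lambda)=\begin{pmatrix}\lambda x_i& x_i+y_i\\ \lambda&1\end{pmatrix}$. Let $M_{k,n}(\lambda)=L_1(\lambda)\cdots L_n(\lambda)$, and let $I_{ij}(x,y)$ be the coefficient of $z^i\lambda^j$ in $\det(M_{k,n}(\lambda)-z)$, for all $i,j\ge 0$. Let $\pi:(x,y)\mapsto(p,q)$ be given by $p_i=y_i/x_i$, $q_i=x_{i+r+1}/y_{i+r}$; its image lies in the hypersurface $S=\{\prod_i p_iq_i=1\}\subset\mathbf R^{2n}$. Let $\overline T_k$ be the rational map of $S$ given by $$q_i^*=\frac1{p_i},\quad p_i^*=q_i\frac{(1+p_{i-r-1})(1+p_{i+r+1})p_{i-r}p_{i+r}}{(1+p_{i-r})(1+p_{i+r})}\qquad(k\text{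 even}),$$ $$q_i^*=\frac1{p_{i-1}},\quad p_i^*=q_i\frac{(1+p_{i-r-2})(1+p_{i+r+1})p_{i-r-1}p_{i+r}}{(1+p_{i-r-1})(1+p_{i+r})}\qquad(k\text{ odd}).$$ Let $\mathcal Q_{k,n}$ be the quiver with vertices $p_1,\dots,p_n,q_1,\dots,q_n$ and, for every $i$, the arrows $p_i\to q_{i+r'+1}$, $p_i\to q_{i-r-1}$, $q_{i+r'}\to p_i$, $q_{i-r}\to p_i$ (counted with multiplicity), and let $(a_{uv})$ be its skew-adjacency matrix. Equip the $(p,q)$-space with the Poisson bracket $\{u,v\}=a_{uv}\,uv$, where $u,v$ run over the coordinates $p_i,q_i$; the function $\prod_i p_iq_i$ is a Casimir function, so the bracket restricts to $S$. Then: (i) Every rational function $f$ of the $I_{ij}$ with real coefficients that is homogeneous of degree zero in the variables $(x,y)$ depends only on $(p,q)$: there is a rational function $g$ on $S$ with $f=g\circ\pi$. Moreover $g$ is preserved by $\overline T_k$: the composition $g\circ\overline T_k$ is defined on a dense subset of $S$ and equals $g$ wherever both are defined. (ii) The functions $g$ on $S$ obtained in this way form a complete involutive family of integrals of $\overline T_k$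 on $S$: any two of them Poisson-commute on $S$, and among them there are $\dim S-\frac12\operatorname{rank}\{\cdot,\cdot\}|_S$ functions whose differentials along $S$ are linearly independent at every point of a dense open subset of $S$. -/

import Mathlib

/-!
Higher pentagram maps in the `(x, y)`- and `(p, q)`-coordinates.  All indices `i` are cyclic,
i.e. elements of `ZMod n`.  The discrete parameters are `k` (the span) and `n`.
-/

noncomputable section

namespace HigherPentagram

/-- The `2n` coordinate labels: `Sum.inl i` labels `x_i` (on the `(x, y)`-space) or `p_i`
(on the `(p, q)`-space), and `Sum.inr i` labels `y_i` or `q_i`. -/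
abbrev Var (n : ℕ) : Type := ZMod n ⊕ ZMod n

/-- `r = [k/2] - 1`. -/
def r (k : ℕ) : ℕ := k / 2 - 1

/-- `r'`, determined by `r + r' = k - 2`. -/
def r' (k : ℕ) : ℕ := k - 2 - r k

/-! ### The integrals `I_{ij}` -/

/-- The polynomial ring `ℝ[x, y]`. -/
abbrev PolyXY (n : ℕ) : Type := MvPolynomial (Var n) ℝ

/-- The field `ℝ(x, y)` of rational functions of `(x, y)`. -/
abbrev FieldXY (n : ℕ) : Type := FractionRing (PolyXY n)

/-- The coordinate function `x_i`. -/
def xVar {n : ℕ} (i : ZMod n) : PolyXY n := MvPolynomial.X (Sum.inl i)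

/-- The coordinate function `y_i`. -/
def yVar {n : ℕ} (i : ZMod n) : PolyXY n := MvPolynomial.X (Sum.inr i)

/-- The `k × k` matrix `L_i(λ)` (rows and columns numbered from `0` to `k - 1`); the spectral
parameter `λ` is the polynomial variable `Polynomial.X`.  For `k = 2` it is
`[[λ x_i, x_i + y_i], [λ, 1]]`.  For `k ≥ 3` the nonzero entries are `x_i` and `x_i + y_i`, the
last two entries of the top row, `λ` in position `(1, 0)`, `1` in the positions `(a, a - 1)` with
`a ≥ 2`, and `1` in the lower right corner. -/
def laxFactor {n : ℕ} (k : ℕ) (i : ZMod n) :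
    Matrix (Fin k) (Fin k) (Polynomial (PolyXY n)) :=
  Matrix.of fun a b =>
    if k = 2 then
      if (a : ℕ) = 0 then
        if (b : ℕ) = 0 then Polynomial.X * Polynomial.C (xVar i)
        else Polynomial.C (xVar i + yVar i)
      else
        if (b : ℕ) = 0 then Polynomial.X else 1
    else
      if (a : ℕ) = 0 then
        if (b : ℕ) + 2 = k then Polynomial.C (xVar i)
        else if (b : ℕ) + 1 = k then Polynomial.C (xVar i + yVar i)
        else 0
      else if (a : ℕ) = 1 then
        if (b : ℕ) = 0 then Polynomial.X else 0
      else
        if (b : ℕ) + 1 = a ∨ ((a : ℕ) + 1 = k ∧ (b : ℕ) + 1 = k) then 1 else 0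

/-- The monodromy matrix `M_{k,n}(λ) = L_1(λ) L_2(λ) ⋯ L_n(λ)`. -/
def monodromy (n k : ℕ) : Matrix (Fin k) (Fin k) (Polynomial (PolyXY n)) :=
  ((List.range n).map fun m => laxFactor k ((m + 1 : ℕ) : ZMod n)).prod

/-- `I_{ij}(x, y)`, the coefficient of `z ^ i λ ^ j` in `det (M_{k,n}(λ) - z)`. -/
def I (n k i j : ℕ) : PolyXY n :=
  (((monodromy n k).map Polynomial.C -
    (Polynomial.X : Polynomial (Polynomial (PolyXY n))) • 1).det.coeff i).coeff j

/-- `f ∈ ℝ(x, y)` is a rational function (with real coefficients) of the `I_{ij}`. -/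
def IsRationalInI (n k : ℕ) (f : FieldXY n) : Prop :=
  f ∈ IntermediateField.adjoin ℝ
    (Set.range fun ij : ℕ × ℕ => algebraMap (PolyXY n) (FieldXY n) (I n k ij.1 ij.2))

/-- `f ∈ ℝ(x, y)` is homogeneous of degree zero in `(x, y)`: it is a quotient of two homogeneous
polynomials of the same degree. -/
def IsHomogeneousDegreeZero {n : ℕ} (f : FieldXY n) : Prop :=
  ∃ (d : ℕ) (u v : PolyXY n), u.IsHomogeneous d ∧ v.IsHomogeneous d ∧ v ≠ 0 ∧
    f = algebraMap (PolyXY n) (FieldXY n) u / algebraMap (PolyXY n) (FieldXY n) v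

/-! ### The `(p, q)`-space -/

/-- Points of the `(p, q)`-space `ℝ^{2n}`. -/
abbrev SpacePQ (n : ℕ) : Type := Var n → ℝ

/-- The function `∏ p_i q_i`. -/
def prodPQ {n : ℕ} [NeZero n] (s : SpacePQ n) : ℝ := ∏ i : ZMod n, s (Sum.inl i) * s (Sum.inr i)

/-- The level set `∏ p_i q_i = 1`. -/
def levelSet (n : ℕ) [NeZero n] : Set (SpacePQ n) := {s | prodPQ s = 1}

/-- The tangent space at `s` of the level set of `∏ p_i q_i` through `s`. -/
def tangentSpace {n : ℕ} [NeZero n] (s : SpacePQ n) : Submodule ℝ (SpacePQ n) :=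
  LinearMap.ker (fderiv ℝ (prodPQ (n := n)) s).toLinearMap

/-- A rational function on the level set `∏ p_i q_i = 1`, represented as a quotient of two
polynomials in `(p, q)` whose denominator is nonzero on a dense part of the level set. -/
structure RatFun (n : ℕ) [NeZero n] where
  num : MvPolynomial (Var n) ℝ
  den : MvPolynomial (Var n) ℝ
  dense_dom : levelSet n ⊆ closure {s | s ∈ levelSet n ∧ MvPolynomial.eval s den ≠ 0}

/-- `g` is regular at the point `s`. -/
def RatFun.RegularAt {n : ℕ} [NeZero n] (g : RatFun n) (s : SpacePQ n) : Prop :=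
  MvPolynomial.eval s g.den ≠ 0

/-- The value of `g` at `s` (meaningful where `g` is regular). -/
def RatFun.value {n : ℕ} [NeZero n] (g : RatFun n) (s : SpacePQ n) : ℝ :=
  MvPolynomial.eval s g.num / MvPolynomial.eval s g.den

/-- The components of the projection `π : (x, y) ↦ (p, q)`, as rational functions of `(x, y)`:
`p_i = y_i / x_i` and `q_i = x_{i+r+1} / y_{i+r}`. -/
def proj (n k : ℕ) : Var n → FieldXY n
  | Sum.inl i => algebraMap (PolyXY n) (FieldXY n) (yVar i) /
      algebraMap (PolyXY n) (FieldXY n) (xVar i)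
  | Sum.inr i => algebraMap (PolyXY n) (FieldXY n) (xVar (i + (r k : ZMod n) + 1)) /
      algebraMap (PolyXY n) (FieldXY n) (yVar (i + (r k : ZMod n)))

/-- The pull-back `g ∘ π` of `g` to the `(x, y)`-space.  (The image of `π` lies in the level set,
and the denominator of `g ∘ π` is not zero because `g` is defined on a dense part of it.) -/
def RatFun.pullback {n : ℕ} [NeZero n] (k : ℕ) (g : RatFun n) : FieldXY n :=
  MvPolynomial.aeval (proj n k) g.num / MvPolynomial.aeval (proj n k) g.den

/-- The functions on the level set to which the rational functions of the `I_{ij}` that are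
homogeneous of degree zero in `(x, y)` descend. -/
def reducedFamily (n k : ℕ) [NeZero n] : Set (RatFun n) :=
  {g | ∃ f : FieldXY n, IsRationalInI n k f ∧ IsHomogeneousDegreeZero f ∧ f = g.pullback k}

/-! ### The map `T̄_k` and its integrals -/

/-- The map `T̄_k` (meaningful where no `p_i` is `0` or `-1`). -/
def Tbar {n : ℕ} (k : ℕ) (s : SpacePQ n) : SpacePQ n :=
  let p : ZMod n → ℝ := fun i => s (Sum.inl i)
  let q : ZMod n → ℝ := fun i => s (Sum.inr i)
  let ρ : ZMod n := (r k : ZMod n)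
  if Even k then
    Sum.elim
      (fun i => q i * ((1 + p (i - ρ - 1)) * (1 + p (i + ρ + 1)) * p (i - ρ) * p (i + ρ)) /
        ((1 + p (i - ρ)) * (1 + p (i + ρ))))
      (fun i => 1 / p i)
  else
    Sum.elim
      (fun i => q i * ((1 + p (i - ρ - 2)) * (1 + p (i + ρ + 1)) * p (i - ρ - 1) * p (i + ρ)) /
        ((1 + p (i - ρ - 1)) * (1 + p (i + ρ))))
      (fun i => 1 / p (i - 1))

/-- The domain of `T̄_k` in the level set `∏ p_i q_i = 1` (where the `p_i` are nonzero). -/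
def TbarDomain (n : ℕ) [NeZero n] : Set (SpacePQ n) :=
  {s | s ∈ levelSet n ∧ ∀ i : ZMod n, 1 + s (Sum.inl i) ≠ 0}

/-- `g` is an integral of (is preserved by) the restriction of `T̄_k` to the level set: the
composition of `g` with `T̄_k` is defined on a dense part of the level set, and it equals `g`
wherever both are defined. -/
def IsIntegral {n : ℕ} [NeZero n] (k : ℕ) (g : RatFun n) : Prop :=
  levelSet n ⊆ closure {s | s ∈ TbarDomain n ∧ g.RegularAt s ∧ g.RegularAt (Tbar k s)} ∧
  ∀ s ∈ TbarDomain n, g.RegularAt s → g.RegularAt (Tbar k s) → g.value (Tbar k s) = g.value s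

/-! ### The Poisson structure -/

/-- The number of arrows between two vertices of the quiver `Q_{k,n}`, the vertices being labelled
by the variables `p_i`, `q_i`.  The arrows are `p_i → q_{i+r'+1}`, `p_i → q_{i-r-1}`,
`q_{i+r'} → p_i` and `q_{i-r} → p_i`. -/
def arrows (n k : ℕ) : Var n → Var n → ℕ
  | Sum.inl i, Sum.inr j =>
      (if j = i + (r' k : ZMod n) + 1 then 1 else 0) + (if j = i - (r k : ZMod n) - 1 then 1 else 0)
  | Sum.inr j, Sum.inl i =>
      (if j = i + (r' k : ZMod n) then 1 else 0) + (if j = i - (r k : ZMod n) then 1 else 0)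
  | Sum.inl _, Sum.inl _ => 0
  | Sum.inr _, Sum.inr _ => 0

/-- The matrix of the Poisson structure `{v_a, v_b} = a_{ab} v_a v_b` at the point `s`, where
`(a_{ab})` is the skew-adjacency matrix of the quiver. -/
def poissonMatrix {n : ℕ} (k : ℕ) (s : SpacePQ n) : Matrix (Var n) (Var n) ℝ :=
  Matrix.of fun a b => ((arrows n k a b : ℝ) - (arrows n k b a : ℝ)) * s a * s b

/-- The Poisson bracket of two functions on the `(p, q)`-space, at the point `s`. -/
def poissonBracket {n : ℕ} [NeZero n] (k : ℕ) (F G : SpacePQ n → ℝ) (s : SpacePQ n) : ℝ :=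
  ∑ a : Var n, ∑ b : Var n, poissonMatrix k s a b *
    fderiv ℝ F s (Pi.single a 1) * fderiv ℝ G s (Pi.single b 1)

/-- The functions of the family Poisson-commute on the level set.  (As `∏ p_i q_i` is a Casimir
function, the bracket on the level set is computed by the bracket of the `(p, q)`-space.) -/
def IsInvolutive {n : ℕ} [NeZero n] (k : ℕ) (𝓕 : Set (RatFun n)) : Prop :=
  ∀ g ∈ 𝓕, ∀ h ∈ 𝓕, ∀ s ∈ levelSet n, g.RegularAt s → h.RegularAt s →
    poissonBracket k g.value h.value s = 0

/-- The family contains `N = dim - rank / 2` functions that are independent (have linearly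
independent differentials along the level set) on a dense open part of the level set; here `dim`
is the dimension of the level set and `rank` the rank of the Poisson structure on it. -/
def IsComplete {n : ℕ} [NeZero n] (k : ℕ) (𝓕 : Set (RatFun n)) : Prop :=
  ∃ (N : ℕ) (g : Fin N → RatFun n) (U : Set (SpacePQ n)),
    (∀ m, g m ∈ 𝓕) ∧ IsOpen U ∧ levelSet n ⊆ closure (levelSet n ∩ U) ∧
    ∀ s ∈ levelSet n ∩ U, (∀ m, (g m).RegularAt s) ∧
      LinearIndependent ℝ (fun m =>
        (fderiv ℝ (g m).value s).toLinearMap.domRestrict (tangentSpace s)) ∧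
      2 * N + (poissonMatrix k s).rank = 2 * Module.finrank ℝ (tangentSpace s)

end HigherPentagram

end

noncomputable section

namespace HigherPentagram

open Matrix Filter Topology

set_option linter.unusedSectionVars false

/-! ### The quasi-periodic shift -/

section Shift

variable {R : Type*} [CommRing R] {n : ℕ} [NeZero n]

/-! Put m = k - 1, let T be the cyclic shift with T^n = ζ, and let X, Y be the diagonal matrices of
x, y. The entries of the partial products L_1 ⋯ L_t are governed by the scalar recurrence w_i =
w_{i-1} + λ (x_i w_{i-m} + y_{i-1} w_{i-m-1}). Hence det(M - z) is (-z)^k times the determinant of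
the n × n operator K = 1 - T - λ (X + T Y) T^m at ζ = 1/z (`det_one_sub_laxProd`,
`specDet_eq_diffMatrix`), and everything about the I_ij is read off det K. For instance, λ enters
only through λx and λy, so I_ij is homogeneous of degree j. On the torus the fibres of π are the
scaling orbits, and π has a polynomial section over S (`sec_projF`, `projF_sec`), so homogeneous
functions of degree zero descend to S.

Invariance: the map T̄_k lifts through π to an explicit map `pent` (`Tbar_projF`). With H = X + Y
and P = 1 - T one has P H⁻¹ (X + Y T) = (X + T Y) H⁻¹ P. This exchange relation factors the
transformed operator through the old one, and det(1 - AB) = det(1 - BA) shows that det K does not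
change (`det_diffMatrix_refactorization`).

Involution: let G = K⁻¹. The logarithmic derivatives of det K are, up to a common factor, λ x_i (T^m
G)_{ii} and λ y_i (T^{m+1} G)_{i+1,i+1}. Through π the quiver bracket becomes, up to sign, a sum
over windows of m consecutive indices (`gradBracket_pullGrad`). For two spectral pairs (λ, ζ), (λ',
ζ') the equations K G = G K = 1 make a quadratic expression in the two Green's functions independent
of the diagonal number d, while passing from d to d + n multiplies it by ζ'/ζ. So it vanishes when ζ
≠ ζ' (`IsGreen.telescope_eq`), and a summation by parts turns this into the vanishing of the window
bracket (`windowBracket_eq_zero`).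

Completeness: at a point with y = -x one has K = (1 - T)(1 - λ X T^m). Expanding the resolvent in λ
and separating values of ζ shows that, for suitable x, the gradients of the I_ij span at least n +
gcd(n, m) dimensions (`le_finrank_span_grad_specialPoint`). Passing to the quotients I_ij / h^j with
h of degree one loses at most one dimension (`exists_independent_quotGrad`). The kernel of the
quiver matrix consists of functions of the class modulo gcd(n, m), separately in p and in q, so the
Poisson rank is 2n - 2 gcd(n, m) (`rank_quiverMatrix`). As dim S = 2n - 1, the required number of
functions is exactly n + gcd(n, m) - 1. -/

/-- The quasi-periodic shift `(T w)_i = w_{i-1}` with `w_0 = ζ w_n`. -/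
def shift (n : ℕ) (ζ : R) : Matrix (ZMod n) (ZMod n) R :=
  Matrix.of fun i j => if j + 1 = i then (if i = 1 then ζ else 1) else 0

theorem shift_mul_apply (ζ : R) (X : Matrix (ZMod n) (ZMod n) R) (i j : ZMod n) :
    (shift n ζ * X) i j = (if i = 1 then ζ else 1) * X (i - 1) j := by
  rw [Matrix.mul_apply, Finset.sum_eq_single (i - 1)]
  · simp [shift]
  · intro b _ hb
    have : b + 1 ≠ i := fun h => hb (by rw [← h]; ring)
    simp [shift, this]
  · simp

theorem mul_shift_apply (ζ : R) (X : Matrix (ZMod n) (ZMod n) R) (i j : ZMod n) :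
    (X * shift n ζ) i j = X i (j + 1) * (if j + 1 = 1 then ζ else 1) := by
  rw [Matrix.mul_apply, Finset.sum_eq_single (j + 1)]
  · simp [shift]
  · intro b _ hb
    simp [shift, Ne.symm hb]
  · simp

/-- On a diagonal entry both sides wrap around at the same index, so the factor ζ is the same and no
condition on ζ is needed. -/
theorem mul_shift_diag (ζ : R) (X : Matrix (ZMod n) (ZMod n) R) (i : ZMod n) :
    (X * shift n ζ) i i = (shift n ζ * X) (i + 1) (i + 1) := by
  rw [mul_shift_apply, shift_mul_apply, add_sub_cancel_right, mul_comm]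

theorem shift_mul_diagonal (ζ : R) (a : ZMod n → R) :
    shift n ζ * diagonal a = diagonal (fun i => a (i - 1)) * shift n ζ := by
  ext i j
  rw [Matrix.mul_diagonal, Matrix.diagonal_mul, mul_comm]
  by_cases h : j + 1 = i
  · rw [← h, add_sub_cancel_right]
  · simp [shift, h]

theorem shift_pow_mul_diagonal (ζ : R) (l : ℕ) (a : ZMod n → R) :
    shift n ζ ^ l * diagonal a = diagonal (fun i => a (i - l)) * shift n ζ ^ l := by
  induction l generalizing a with
  | zero => simp
  | succ l ih =>
    rw [pow_succ, mul_assoc, shift_mul_diagonal, ← mul_assoc, ih, mul_assoc, ← pow_succ]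
    congr 2
    funext i
    push_cast
    congr 1
    ring

theorem mul_shift_pow_diag (ζ : R) (l : ℕ) (X : Matrix (ZMod n) (ZMod n) R) (i : ZMod n) :
    (X * shift n ζ ^ l) i i = (shift n ζ ^ l * X) (i + l) (i + l) := by
  induction l generalizing X i with
  | zero => simp
  | succ l ih =>
    rw [pow_succ', ← mul_assoc, ih, ← mul_assoc, mul_shift_diag, mul_assoc (shift n ζ)]
    push_cast
    rw [add_assoc]

/-- The position `t + 1` of the time `t`. -/
def timeEquiv (n : ℕ) [NeZero n] : Fin n ≃ ZMod n :=
  Equiv.ofBijective (fun t => ((t + 1 : ℕ) : ZMod n)) (by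
    rw [Fintype.bijective_iff_injective_and_card]
    refine ⟨fun a b h => ?_, by simp [ZMod.card]⟩
    simp only [Nat.cast_add, Nat.cast_one, add_left_inj] at h
    rw [ZMod.natCast_eq_natCast_iff'] at h
    rw [Nat.mod_eq_of_lt a.2, Nat.mod_eq_of_lt b.2] at h
    exact Fin.ext h)

theorem timeEquiv_apply (t : Fin n) : timeEquiv n t = ((t + 1 : ℕ) : ZMod n) := rfl

theorem timeEquiv_eq_one (t : Fin n) : timeEquiv n t = 1 ↔ (t : ℕ) = 0 := by
  have h0 : timeEquiv n (0 : Fin n) = 1 := by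
    rw [timeEquiv_apply, Fin.val_zero, zero_add, Nat.cast_one]
  rw [← h0, (timeEquiv n).injective.eq_iff, Fin.ext_iff, Fin.val_zero]

/-- In linear time 0, …, n - 1 the power T^l splits into an unwrapped subdiagonal and a wrapped one
carrying ζ. The bound l ≤ n excludes a second wrap, that is, ζ². -/
theorem shift_pow_timeEquiv (ζ : R) (l : ℕ) (hl : l ≤ n) (t s : Fin n) :
    (shift n ζ ^ l) (timeEquiv n t) (timeEquiv n s) =
      (if (s : ℕ) + l = t then 1 else 0) + ζ * (if (s : ℕ) + l = t + n then 1 else 0) := by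
  induction l generalizing t with
  | zero =>
    have h : ¬ ((s : ℕ) = t + n) := by omega
    simp only [pow_zero, Matrix.one_apply, (timeEquiv n).injective.eq_iff, Fin.ext_iff, add_zero, h]
    simp [eq_comm]
  | succ l ih =>
    rw [pow_succ', shift_mul_apply]
    simp only [timeEquiv_eq_one]
    by_cases ht : (t : ℕ) = 0
    · have h1 : timeEquiv n t - 1 = timeEquiv n ⟨n - 1, by have := t.2; omega⟩ := by
        have h2 : n - 1 + 1 = n := by have := t.2; omega
        simp [timeEquiv_apply, ht, h2]
      rw [h1, ih (by omega)]
      have h3 : ¬ ((s : ℕ) + l = n - 1 + n) := by omega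
      have h4 : ((s : ℕ) + l = n - 1) ↔ ((s : ℕ) + (l + 1) = t + n) := by omega
      simp [ht, h3, h4]
    · have h1 : timeEquiv n t - 1 = timeEquiv n ⟨t - 1, by have := t.2; omega⟩ := by
        have h2 : (t : ℕ) - 1 + 1 = t := by omega
        simp only [timeEquiv_apply, h2]
        push_cast; ring
      rw [h1, ih (by omega)]
      have h4 : ((s : ℕ) + l = t - 1) ↔ ((s : ℕ) + (l + 1) = t) := by omega
      have h5 : ((s : ℕ) + l = t - 1 + n) ↔ ((s : ℕ) + (l + 1) = t + n) := by omega
      simp [ht, h4, h5]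

theorem shift_pow_self (ζ : R) : shift n ζ ^ n = ζ • (1 : Matrix (ZMod n) (ZMod n) R) := by
  ext i j
  obtain ⟨t, rfl⟩ := (timeEquiv n).surjective i
  obtain ⟨s, rfl⟩ := (timeEquiv n).surjective j
  rw [shift_pow_timeEquiv ζ n le_rfl]
  have h : ¬ ((s : ℕ) + n = t) := by omega
  simp [h, Matrix.one_apply, (timeEquiv n).injective.eq_iff, Fin.ext_iff, eq_comm]

/-- The Kasteleyn-type matrix `1 - T - λ (X + T Y) T ^ m` of the difference equation
`w_i = w_{i-1} + λ (x_i w_{i-m} + y_{i-1} w_{i-m-1})`. -/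
def diffMatrix (m : ℕ) (x y : ZMod n → R) (lam ζ : R) : Matrix (ZMod n) (ZMod n) R :=
  1 - shift n ζ - lam • ((diagonal x + shift n ζ * diagonal y) * shift n ζ ^ m)

end Shift

/-! ### The spectral duality -/

section Duality

variable {R : Type*} [CommRing R] {n : ℕ} [NeZero n]

/-- The matrix `L_i(λ)` with entries in an arbitrary ring. -/
def lax (k : ℕ) (x y lam : R) : Matrix (Fin k) (Fin k) R :=
  Matrix.of fun a b =>
    if k = 2 then
      if (a : ℕ) = 0 then
        if (b : ℕ) = 0 then lam * x else x + y
      else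
        if (b : ℕ) = 0 then lam else 1
    else
      if (a : ℕ) = 0 then
        if (b : ℕ) + 2 = k then x
        else if (b : ℕ) + 1 = k then x + y
        else 0
      else if (a : ℕ) = 1 then
        if (b : ℕ) = 0 then lam else 0
      else
        if (b : ℕ) + 1 = a ∨ ((a : ℕ) + 1 = k ∧ (b : ℕ) + 1 = k) then 1 else 0

/-- The partial products `L_1 ⋯ L_t`. -/
def laxProd (k : ℕ) (x y : ZMod n → R) (lam : R) (t : ℕ) : Matrix (Fin k) (Fin k) R :=
  ((List.range t).map fun m =>
    lax k (x ((m + 1 : ℕ) : ZMod n)) (y ((m + 1 : ℕ) : ZMod n)) lam).prod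

theorem laxProd_succ (k : ℕ) (x y : ZMod n → R) (lam : R) (t : ℕ) :
    laxProd k x y lam (t + 1) = laxProd k x y lam t *
      lax k (x ((t + 1 : ℕ) : ZMod n)) (y ((t + 1 : ℕ) : ZMod n)) lam := by
  simp [laxProd, List.range_succ]

theorem vecMul_lax_last {k : ℕ} (hk : 2 ≤ k) (x y lam : R) (v : Fin k → R) :
    (v ᵥ* lax k x y lam) ⟨k - 1, by omega⟩ =
      v ⟨k - 1, by omega⟩ + (x + y) * v ⟨0, by omega⟩ := by
  rw [Matrix.vecMul, dotProduct]
  have hne : (⟨0, by omega⟩ : Fin k) ≠ ⟨k - 1, by omega⟩ := by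
    simp only [ne_eq, Fin.mk.injEq]; omega
  rw [Finset.sum_eq_add_of_mem ⟨0, by omega⟩ ⟨k - 1, by omega⟩ (Finset.mem_univ _)
    (Finset.mem_univ _) hne]
  · simp only [lax, Matrix.of_apply]
    split_ifs <;> first | omega | ring1
  · intro c _ hc
    have h1 : (c : ℕ) ≠ 0 := fun h => hc.1 (Fin.ext h)
    have h2 : (c : ℕ) ≠ k - 1 := fun h => hc.2 (Fin.ext h)
    simp only [lax, Matrix.of_apply]
    split_ifs <;> first | omega | ring1

/-- Acting on row vectors, the matrix L_i moves entries one place to the left, with λ paid on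
entering column 0; new information enters only in the last two columns. This delay line is what
replaces the k × k product by one scalar sequence. The special form of L_i for k = 2 is covered by b
= 0 = k - 2. -/
theorem vecMul_lax_lower {k : ℕ} (hk : 2 ≤ k) (x y lam : R) (v : Fin k → R) (b : ℕ)
    (hb : b + 2 ≤ k) :
    (v ᵥ* lax k x y lam) ⟨b, by omega⟩ = (if b = 0 then lam else 1) *
      (if b + 2 = k then v ⟨k - 1, by omega⟩ + x * v ⟨0, by omega⟩ else v ⟨b + 1, by omega⟩) := by
  rw [Matrix.vecMul, dotProduct]
  have hne : (⟨0, by omega⟩ : Fin k) ≠ ⟨b + 1, by omega⟩ := by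
    simp only [ne_eq, Fin.mk.injEq]; omega
  rw [Finset.sum_eq_add_of_mem ⟨0, by omega⟩ ⟨b + 1, by omega⟩ (Finset.mem_univ _)
    (Finset.mem_univ _) hne]
  · have h0 : b + 2 = k → (⟨k - 1, by omega⟩ : Fin k) = ⟨b + 1, by omega⟩ := by
      intro h; simp only [Fin.mk.injEq]; omega
    simp only [lax, Matrix.of_apply]
    split_ifs <;>
      first | omega | contradiction | (exfalso; tauto) | (rw [h0 (by omega)]; ring1) | ring1
  · intro c _ hc
    have h1 : (c : ℕ) ≠ 0 := fun h => hc.1 (Fin.ext h)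
    have h2 : (c : ℕ) ≠ b + 1 := fun h => hc.2 (Fin.ext h)
    simp only [lax, Matrix.of_apply]
    split_ifs <;> first | omega | ring1

/-- The solution `w_{t+1}` of the difference equation generated by the row `a`. -/
def solution (k : ℕ) (hk : 2 ≤ k) (x y : ZMod n → R) (lam : R) (a : Fin k) (t : ℕ) : R :=
  laxProd k x y lam t a ⟨k - 1, by omega⟩ +
    x ((t + 1 : ℕ) : ZMod n) * laxProd k x y lam t a ⟨0, by omega⟩

theorem laxProd_last_succ (k : ℕ) (hk : 2 ≤ k) (x y : ZMod n → R) (lam : R) (a : Fin k) (t : ℕ) :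
    laxProd k x y lam (t + 1) a ⟨k - 1, by omega⟩ = solution k hk x y lam a t +
      y ((t + 1 : ℕ) : ZMod n) * laxProd k x y lam t a ⟨0, by omega⟩ := by
  rw [laxProd_succ]
  have := vecMul_lax_last hk (x ((t + 1 : ℕ) : ZMod n)) (y ((t + 1 : ℕ) : ZMod n)) lam
    (laxProd k x y lam t a)
  rw [Matrix.mul_apply_eq_vecMul, this, solution]
  ring

/-- An entry in column b is traced back to the right along the delay line. It either comes from
column k - 2, where a value of `solution` was fed in, or time runs out and it is an entry of the
initial identity matrix. -/
theorem laxProd_lower (k : ℕ) (hk : 2 ≤ k) (x y : ZMod n → R) (lam : R) (a : Fin k) (t b : ℕ)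
    (hb : b + 2 ≤ k) :
    laxProd k x y lam t a ⟨b, by omega⟩ =
      if t + b + 2 ≤ k then
        (if t = 0 then 1 else if b = 0 then lam else 1) * (if (a : ℕ) = t + b then 1 else 0)
      else (if b = 0 then lam else 1) * solution k hk x y lam a (t + b + 1 - k) := by
  induction t generalizing b with
  | zero => simp [laxProd, hb, Matrix.one_apply, Fin.ext_iff]
  | succ t ih =>
    rw [laxProd_succ, Matrix.mul_apply_eq_vecMul, vecMul_lax_lower hk _ _ _ _ _ hb]
    by_cases h : b + 2 = k
    · rw [if_pos h, if_neg (show ¬ t + 1 + b + 2 ≤ k by omega)]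
      rw [show t + 1 + b + 1 - k = t by omega]
      rfl
    · rw [if_neg h, ih (b + 1) (by omega)]
      by_cases h2 : t + 1 + b + 2 ≤ k
      · rw [if_pos (show t + (b + 1) + 2 ≤ k by omega), if_pos h2]
        simp only [Nat.add_eq_zero_iff, one_ne_zero, and_false, if_false]
        rw [ite_self, one_mul, show t + (b + 1) = t + 1 + b by omega]
      · rw [if_neg (show ¬ t + (b + 1) + 2 ≤ k by omega), if_neg h2]
        simp only [Nat.add_eq_zero_iff, one_ne_zero, and_false, if_false, one_mul]
        rw [show t + (b + 1) + 1 - k = t + 1 + b + 1 - k by omega]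

/-- The difference equation for w_{t+1}, with zero in place of w at nonpositive times; the last
bracket supplies what the initial row contributes at those times. -/
theorem solution_recurrence (k : ℕ) (hk : 2 ≤ k) (x y : ZMod n → R) (lam : R) (a : Fin k) (t : ℕ) :
    solution k hk x y lam a t =
      (if 1 ≤ t then solution k hk x y lam a (t - 1) else 0) +
      (if k ≤ t + 1 then
        lam * x ((t + 1 : ℕ) : ZMod n) * solution k hk x y lam a (t + 1 - k) else 0) +
      (if k ≤ t then lam * y (t : ZMod n) * solution k hk x y lam a (t - k) else 0) +
      ((if (a : ℕ) = t ∧ (a : ℕ) + 1 < k then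
          x ((t + 1 : ℕ) : ZMod n) * (if (a : ℕ) = 0 then 1 else lam) else 0) +
        (if (a : ℕ) + 1 = t ∧ (a : ℕ) + 1 < k then
          y (t : ZMod n) * (if (a : ℕ) = 0 then 1 else lam) else 0) +
        (if t = 0 ∧ (a : ℕ) + 1 = k then 1 else 0)) := by
  have ha := a.2
  conv_lhs => rw [solution]
  rw [laxProd_lower k hk x y lam a t 0 (by omega)]
  rcases t with _ | t
  · have h1 : laxProd k x y lam 0 a ⟨k - 1, by omega⟩ = if (a : ℕ) + 1 = k then 1 else 0 := by
      simp only [laxProd, List.range_zero, List.map_nil, List.prod_nil, Matrix.one_apply,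
        Fin.ext_iff]
      exact if_congr (by omega) rfl rfl
    rw [h1]
    have h2 : ¬ k ≤ 1 := by omega
    have h3 : ¬ k = 0 := by omega
    by_cases h0 : (a : ℕ) = 0
    · have h4 : 1 < k := by omega
      simp [h0, h2, h3, hk, h4, add_comm]
    · simp [h0, h2, h3, hk]
  · rw [laxProd_last_succ k hk, laxProd_lower k hk x y lam a t 0 (by omega)]
    simp only [add_zero, if_true, Nat.add_sub_cancel, Nat.add_eq_zero_iff, one_ne_zero, and_false,
      if_false, le_add_iff_nonneg_left, zero_le, false_and, add_left_inj]
    split_ifs <;> first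
      | (exfalso; omega)
      | ring1

/-- The strictly lower triangular part of the difference equation. -/
def lowerPart (n k : ℕ) (x y : ℕ → R) (lam : R) : Matrix (Fin n) (Fin n) R :=
  Matrix.of fun t s => (if (s : ℕ) + 1 = t then 1 else 0) +
    (if (s : ℕ) + (k - 1) = t then lam * x (t + 1) else 0) +
    (if (s : ℕ) + k = t then lam * y t else 0)

/-- The coefficients with which the initial row enters the difference equation. -/
def inputPart (n k : ℕ) (x y : ℕ → R) (lam : R) : Matrix (Fin n) (Fin k) R :=
  Matrix.of fun t a =>
    (if (a : ℕ) = t ∧ (a : ℕ) + 1 < k then x (t + 1) * (if (a : ℕ) = 0 then 1 else lam) else 0) +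
    (if (a : ℕ) + 1 = t ∧ (a : ℕ) + 1 < k then y t * (if (a : ℕ) = 0 then 1 else lam) else 0) +
    (if (t : ℕ) = 0 ∧ (a : ℕ) + 1 = k then 1 else 0)

/-- The expression of the final row in terms of the solution. -/
def outputPart (n k : ℕ) (y : ℕ → R) (lam : R) : Matrix (Fin k) (Fin n) R :=
  Matrix.of fun b s =>
    if (b : ℕ) + 1 = k then
      (if (s : ℕ) + 1 = n then 1 else 0) + (if (s : ℕ) + k = n then lam * y n else 0)
    else (if (s : ℕ) + k = n + 1 + b then (if (b : ℕ) = 0 then lam else 1) else 0)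

theorem det_one_sub_lowerPart (k : ℕ) (hk : 2 ≤ k) (x y : ℕ → R) (lam : R) :
    (1 - lowerPart n k x y lam).det = 1 := by
  rw [Matrix.det_of_isLowerTriangular]
  · refine Finset.prod_eq_one fun i _ => ?_
    have h1 : ¬ (k - 1 = 0) := by omega
    have h2 : ¬ (k = 0) := by omega
    simp [lowerPart, h1, h2]
  · intro i j hij
    have hij' : (i : ℕ) < j := hij
    have h0 : i ≠ j := fun h => by simp [h] at hij'
    have h1 : ¬ ((j : ℕ) + (k - 1) = i) := by omega
    have h2 : ¬ ((j : ℕ) + k = i) := by omega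
    have h3 : ¬ ((j : ℕ) + 1 = i) := by omega
    simp [lowerPart, h0, h1, h2, h3]

theorem sum_fin_ite_add_eq (n : ℕ) (f : ℕ → R) (c t : ℕ) (ht : t < n) (u : R) :
    ∑ s : Fin n, (if (s : ℕ) + c = t then u else 0) * f s = if c ≤ t then u * f (t - c) else 0 := by
  split_ifs with h
  · rw [Finset.sum_eq_single ⟨t - c, by omega⟩]
    · have : t - c + c = t := by omega
      simp [this]
    · intro b _ hb
      rw [if_neg, zero_mul]
      intro hh
      exact hb (Fin.ext (by simp only; omega))
    · simp
  · refine Finset.sum_eq_zero fun s _ => ?_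
    rw [if_neg (by omega), zero_mul]

theorem sum_fin_ite_add_eq_of_le (n : ℕ) (f : ℕ → R) (c t : ℕ) (hct : c ≤ t) (ht : t < n + c)
    (u : R) :
    ∑ s : Fin n, (if (s : ℕ) + c = t then u else 0) * f s = u * f (t - c) := by
  rw [Finset.sum_eq_single ⟨t - c, by omega⟩]
  · have : t - c + c = t := by omega
    simp [this]
  · intro b _ hb
    rw [if_neg, zero_mul]
    intro hh
    exact hb (Fin.ext (by simp only; omega))
  · simp

theorem one_sub_lowerPart_mul_solution (k : ℕ) (hk : 2 ≤ k) (x y : ZMod n → R) (lam : R) :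
    (1 - lowerPart n k (fun i => x i) (fun i => y i) lam) *
      (Matrix.of fun (t : Fin n) a => solution k hk x y lam a t) =
    inputPart n k (fun i => x i) (fun i => y i) lam := by
  ext t a
  rw [Matrix.sub_mul, Matrix.one_mul, Matrix.sub_apply, Matrix.mul_apply]
  simp only [lowerPart, Matrix.of_apply, add_mul, Finset.sum_add_distrib]
  rw [sum_fin_ite_add_eq n (fun t => solution k hk x y lam a t) _ _ t.2,
    sum_fin_ite_add_eq n (fun t => solution k hk x y lam a t) _ _ t.2,
    sum_fin_ite_add_eq n (fun t => solution k hk x y lam a t) _ _ t.2,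
    solution_recurrence k hk, inputPart, Matrix.of_apply]
  have h1 : (k ≤ (t : ℕ) + 1) ↔ (k - 1 ≤ (t : ℕ)) := by omega
  have h2 : (t : ℕ) + 1 - k = t - (k - 1) := by omega
  simp only [h1, h2, one_mul]
  ring

theorem outputPart_mul_solution (k : ℕ) (hk : 2 ≤ k) (hkn : k ≤ n) (x y : ZMod n → R) (lam : R) :
    outputPart n k (fun i => y i) lam *
      (Matrix.of fun (t : Fin n) a => solution k hk x y lam a t) =
    (laxProd k x y lam n)ᵀ := by
  ext b a
  have hb := b.2
  rw [Matrix.mul_apply, Matrix.transpose_apply]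
  simp only [outputPart, Matrix.of_apply]
  by_cases h : (b : ℕ) + 1 = k
  · simp only [h, if_true, add_mul, Finset.sum_add_distrib]
    rw [sum_fin_ite_add_eq_of_le n (fun t => solution k hk x y lam a t) _ _ (by omega) (by omega),
      sum_fin_ite_add_eq_of_le n (fun t => solution k hk x y lam a t) _ _ hkn (by omega)]
    have hb' : b = ⟨k - 1, by omega⟩ := Fin.ext (by simp only; omega)
    obtain ⟨N, hN⟩ : ∃ N, n = N + 1 := ⟨n - 1, by omega⟩
    have h1 : laxProd k x y lam n a ⟨k - 1, by omega⟩ = solution k hk x y lam a (n - 1) +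
        y ((n : ℕ) : ZMod n) * laxProd k x y lam (n - 1) a ⟨0, by omega⟩ := by
      have := laxProd_last_succ k hk x y lam a (n - 1)
      rwa [show n - 1 + 1 = n by omega] at this
    rw [hb', h1, laxProd_lower k hk x y lam a (n - 1) 0 (by omega), if_neg (by omega), if_pos rfl,
      show n - 1 + 0 + 1 - k = n - k by omega]
    ring
  · simp only [h, if_false]
    rw [sum_fin_ite_add_eq_of_le n (fun t => solution k hk x y lam a t) _ _ (by omega) (by omega)]
    have := laxProd_lower k hk x y lam a n b (by omega)
    rw [if_neg (by omega), show n + (b : ℕ) + 1 - k = n + 1 + b - k by omega] at this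
    exact this.symm

/-- Feeding the final row back in as initial row is the same as reading w cyclically, so this
product is the part of the difference operator that crosses the end of the period. The value y 0 in
the first equation is the y n of the last step. -/
theorem inputPart_mul_outputPart (k : ℕ) (hk : 2 ≤ k) (x y : ℕ → R)
    (hy : y n = y 0) (lam : R) (t s : Fin n) :
    (inputPart n k x y lam * outputPart n k y lam) t s =
      (if (s : ℕ) + 1 = t + n then 1 else 0) +
      (if (s : ℕ) + (k - 1) = t + n then lam * x (t + 1) else 0) +
      (if (s : ℕ) + k = t + n then lam * y t else 0) := by
  have ht := t.2
  have hs := s.2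
  rw [Matrix.mul_apply]
  simp only [inputPart, outputPart, Matrix.of_apply, add_mul, Finset.sum_add_distrib]
  have e1 : ∑ a : Fin k, (if (a : ℕ) = t ∧ (a : ℕ) + 1 < k then
      x (t + 1) * (if (a : ℕ) = 0 then 1 else lam) else 0) *
      (if (a : ℕ) + 1 = k then
        (if (s : ℕ) + 1 = n then 1 else 0) + (if (s : ℕ) + k = n then lam * y n else 0)
        else (if (s : ℕ) + k = n + 1 + a then (if (a : ℕ) = 0 then lam else 1) else 0)) =
      if (s : ℕ) + (k - 1) = t + n then lam * x (t + 1) else 0 := by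
    by_cases h : (t : ℕ) + 1 < k
    · rw [Finset.sum_eq_single ⟨t, by omega⟩]
      · simp only [h, true_and, if_true]
        split_ifs <;> first | (exfalso; omega) | ring1
      · intro b _ hb
        rw [if_neg, zero_mul]
        exact fun hh => hb (Fin.ext hh.1)
      · simp
    · rw [if_neg (show ¬ (s : ℕ) + (k - 1) = t + n by omega)]
      refine Finset.sum_eq_zero fun a _ => ?_
      rw [if_neg (by omega), zero_mul]
  have e2 : ∑ a : Fin k, (if (a : ℕ) + 1 = t ∧ (a : ℕ) + 1 < k then
      y t * (if (a : ℕ) = 0 then 1 else lam) else 0) *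
      (if (a : ℕ) + 1 = k then
        (if (s : ℕ) + 1 = n then 1 else 0) + (if (s : ℕ) + k = n then lam * y n else 0)
        else (if (s : ℕ) + k = n + 1 + a then (if (a : ℕ) = 0 then lam else 1) else 0)) =
      if (t : ℕ) ≠ 0 ∧ (s : ℕ) + k = t + n then lam * y t else 0 := by
    by_cases h : (t : ℕ) < k ∧ (t : ℕ) ≠ 0
    · rw [Finset.sum_eq_single ⟨t - 1, by omega⟩]
      · simp only [show (t : ℕ) - 1 + 1 = t by omega, h.1, h.2, true_and, and_true, if_true, ne_eq,
          not_false_eq_true]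
        split_ifs <;> first | (exfalso; omega) | ring1
      · intro b _ hb
        rw [if_neg, zero_mul]
        exact fun hh => hb (Fin.ext (by simp only; omega))
      · simp
    · rw [if_neg (show ¬ ((t : ℕ) ≠ 0 ∧ (s : ℕ) + k = t + n) by omega)]
      refine Finset.sum_eq_zero fun a _ => ?_
      rw [if_neg (by omega), zero_mul]
  have e3 : ∑ a : Fin k, (if (t : ℕ) = 0 ∧ (a : ℕ) + 1 = k then (1 : R) else 0) *
      (if (a : ℕ) + 1 = k then
        (if (s : ℕ) + 1 = n then 1 else 0) + (if (s : ℕ) + k = n then lam * y n else 0)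
        else (if (s : ℕ) + k = n + 1 + a then (if (a : ℕ) = 0 then lam else 1) else 0)) =
      if (t : ℕ) = 0 then
        (if (s : ℕ) + 1 = n then 1 else 0) + (if (s : ℕ) + k = n then lam * y n else 0) else 0 := by
    rw [Finset.sum_eq_single ⟨k - 1, by omega⟩]
    · simp only [show k - 1 + 1 = k by omega, and_true, if_true]
      split_ifs <;> ring1
    · intro b _ hb
      rw [if_neg, zero_mul]
      exact fun hh => hb (Fin.ext (by simp only; omega))
    · simp
  rw [e1, e2, e3, hy]
  by_cases h0 : (t : ℕ) = 0
  · simp only [h0]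
    split_ifs <;> first | (exfalso; omega) | ring1
  · simp only [h0]
    split_ifs <;> first | (exfalso; omega) | ring1

/-- Spectral duality between the `k × k` monodromy matrix and the `n × n` difference operator. -/
theorem det_one_sub_laxProd (k : ℕ) (hk : 2 ≤ k) (hkn : k ≤ n) (x y : ZMod n → R) (lam ζ : R) :
    (1 - ζ • laxProd k x y lam n).det = (diffMatrix (k - 1) x y lam ζ).det := by
  -- Write A, B, C for the lower, input and output parts. In linear time K = (1 - A) - ζ B C, where
  -- 1 - A has determinant 1; the wrapped entries are exactly those that carry ζ.
  have key : (diffMatrix (k - 1) x y lam ζ).submatrix (timeEquiv n) (timeEquiv n) =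
      (1 - lowerPart n k (fun i => x i) (fun i => y i) lam) -
        ζ • (inputPart n k (fun i => x i) (fun i => y i) lam *
          outputPart n k (fun i => y i) lam) := by
    ext t s
    have hk1 : k - 1 + 1 = k := by omega
    have h1 := shift_pow_timeEquiv ζ 1 (by omega) t s
    have h2 := shift_pow_timeEquiv ζ (k - 1) (by omega) t s
    have h3 := shift_pow_timeEquiv ζ k (by omega) t s
    rw [pow_one] at h1
    rw [Matrix.submatrix_apply, diffMatrix, shift_mul_diagonal, add_mul, mul_assoc, ← pow_succ',
      hk1, Matrix.sub_apply, Matrix.sub_apply, Matrix.smul_apply, Matrix.add_apply,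
      Matrix.diagonal_mul, Matrix.diagonal_mul, h1, h2, h3, Matrix.sub_apply, Matrix.sub_apply,
      Matrix.smul_apply, inputPart_mul_outputPart k hk _ _ (by simp) lam t s]
    have h4 : timeEquiv n t - 1 = ((t : ℕ) : ZMod n) := by
      rw [timeEquiv_apply]; push_cast; ring
    have h5 : (1 : Matrix (ZMod n) (ZMod n) R) (timeEquiv n t) (timeEquiv n s) =
        (1 : Matrix (Fin n) (Fin n) R) t s := by
      simp only [Matrix.one_apply]
      exact if_congr (timeEquiv n).injective.eq_iff rfl rfl
    have h6 : ∀ (p : Prop) [Decidable p] (c : R),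
        (if p then c else 0) = c * (if p then 1 else 0) := by
      intro p _ c
      rw [mul_boole]
    rw [h4, h5]
    simp only [lowerPart, Matrix.of_apply, smul_eq_mul, timeEquiv_apply, h6 _ (lam * x _),
      h6 _ (lam * y _)]
    ring
  -- With (1 - A) W = B one gets K = (1 - A)(1 - ζ W C), and det(1 - ζ W C) = det(1 - ζ C W), where
  -- C W is the transposed monodromy matrix.
  rw [← Matrix.det_submatrix_equiv_self (timeEquiv n), key,
    ← one_sub_lowerPart_mul_solution k hk, Matrix.mul_assoc, ← Matrix.mul_smul]
  nth_rewrite 1 [← mul_one (1 - lowerPart n k (fun i => x i) (fun i => y i) lam)]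
  rw [← mul_sub, Matrix.det_mul, det_one_sub_lowerPart k hk, one_mul, ← Matrix.mul_smul,
    Matrix.det_one_sub_mul_comm, Matrix.smul_mul, outputPart_mul_solution k hk hkn,
    ← Matrix.det_transpose]
  simp

end Duality

/-! ### Invertibility of T and of 1 - T. -/

section Inverse

variable {F : Type*} [Field F] {n : ℕ} [NeZero n]

/-- The geometric series stops because T^n = ζ. -/
theorem one_sub_shift_mul_sum (ζ : F) (hζ : ζ ≠ 1) :
    (1 - shift n ζ) * ((1 - ζ)⁻¹ • ∑ l ∈ Finset.range n, shift n ζ ^ l) = 1 := by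
  have h1 : (1 - ζ) ≠ 0 := sub_ne_zero.mpr (Ne.symm hζ)
  rw [mul_smul_comm, mul_neg_geom_sum, shift_pow_self]
  ext i j
  simp only [Matrix.smul_apply, Matrix.sub_apply, Matrix.one_apply, smul_eq_mul]
  split_ifs
  · field_simp
  · simp

theorem isUnit_det_one_sub_shift (ζ : F) (hζ : ζ ≠ 1) : IsUnit (1 - shift n ζ).det :=
  Matrix.isUnit_det_of_right_inverse (one_sub_shift_mul_sum ζ hζ)

theorem shift_mul_shift_pow (ζ : F) (hζ : ζ ≠ 0) :
    shift n ζ * (ζ⁻¹ • shift n ζ ^ (n - 1)) = 1 := by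
  have hn : n - 1 + 1 = n := Nat.succ_pred_eq_of_pos (NeZero.pos n)
  rw [mul_smul_comm, ← pow_succ', hn, shift_pow_self, smul_smul, inv_mul_cancel₀ hζ, one_smul]

theorem isUnit_det_shift (ζ : F) (hζ : ζ ≠ 0) : IsUnit (shift n ζ).det :=
  Matrix.isUnit_det_of_right_inverse (shift_mul_shift_pow ζ hζ)

end Inverse

/-! ### Invariance of the spectral determinant under the pentagram map -/

section Refactorization

variable {F : Type*} [Field F] {n : ℕ} [NeZero n]

/-- A refactorization: up to conjugation by H = X + Y and the factors P = 1 - T and T, the old and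
the new operator are 1 - AB and 1 - BA with A = P⁻¹ λ (X + T Y), B = T^m. The hypothesis ζ ≠ 1 makes
P invertible, and ζ ≠ 0 allows det T to be cancelled. -/
theorem det_diffMatrix_refactorization (m : ℕ) (x y : ZMod n → F) (lam ζ : F) (h0 : ζ ≠ 0)
    (h1 : ζ ≠ 1) (hxy : ∀ i, x i + y i ≠ 0) :
    (diffMatrix m
      (fun i : ZMod n => x (i - m - 1) * (x (i - 1) + y (i - 1)) / (x (i - m - 1) + y (i - m - 1)))
      (fun i : ZMod n => y (i - m) * (x i + y i) / (x (i - m) + y (i - m))) lam ζ).det =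
    (diffMatrix m x y lam ζ).det := by
  set T := shift n ζ with hT
  set h : ZMod n → F := fun i => x i + y i with hh
  set P := 1 - T with hP
  set H := diagonal h
  set Hi := diagonal (fun i => (h i)⁻¹)
  set X := diagonal x
  set Y := diagonal y
  have hPu : IsUnit P.det := isUnit_det_one_sub_shift ζ h1
  have hTu : T.det ≠ 0 := (isUnit_det_shift ζ h0).ne_zero
  have hHHi : H * Hi = 1 := by
    rw [Matrix.diagonal_mul_diagonal, ← Matrix.diagonal_one]
    congr 1; funext i; exact mul_inv_cancel₀ (hxy i)
  have hHiH : Hi * H = 1 := by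
    rw [Matrix.diagonal_mul_diagonal, ← Matrix.diagonal_one]
    congr 1; funext i; exact inv_mul_cancel₀ (hxy i)
  have hYHi : Y * Hi = Hi * Y := by
    rw [Matrix.diagonal_mul_diagonal, Matrix.diagonal_mul_diagonal]
    congr 1; funext i; exact mul_comm _ _
  have hXY : X + Y = H := by rw [Matrix.diagonal_add]
  -- The exchange relation: both sides equal P - P H⁻¹ Y P, since the diagonal matrices Y and H⁻¹
  -- commute.
  have hB : P * Hi * (X + Y * T) = (X + T * Y) * Hi * P := by
    have e1 : X + Y * T = H - Y * P := by rw [← hXY, hP]; noncomm_ring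
    have e2 : X + T * Y = H - P * Y := by rw [← hXY, hP]; noncomm_ring
    rw [e1, e2]
    clear_value P
    rw [mul_sub, sub_mul, sub_mul, mul_assoc P Hi H, hHiH, hHHi, mul_assoc P Y Hi, hYHi]
    noncomm_ring
  have hPT : P * T = T * P := by rw [hP]; noncomm_ring
  set Xh := diagonal fun i => x (i - m - 1) * h (i - 1) / h (i - m - 1)
  set Yh := diagonal fun i => y (i - m) * h i / h (i - m)
  have hX : Xh * T ^ m * T = T * H * T ^ m * Hi * X := by
    rw [mul_assoc (T * H * T ^ m), Matrix.diagonal_mul_diagonal, mul_assoc (T * H),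
      shift_pow_mul_diagonal, ← mul_assoc (T * H), mul_assoc T, Matrix.diagonal_mul_diagonal,
      shift_mul_diagonal, mul_assoc, ← pow_succ, mul_assoc, ← pow_succ']
    congr 1
    refine congrArg diagonal (funext fun i => ?_)
    rw [show i - 1 - (m : ZMod n) = i - m - 1 by ring]
    ring
  have hY : Yh * T ^ m = H * T ^ m * Hi * Y := by
    rw [mul_assoc (H * T ^ m), Matrix.diagonal_mul_diagonal, mul_assoc H,
      shift_pow_mul_diagonal, ← mul_assoc H, Matrix.diagonal_mul_diagonal]
    congr 1
    refine congrArg diagonal (funext fun i => ?_)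
    ring
  -- The transformed coefficients are precisely those for which conjugating T^m by H reproduces the
  -- two-term operator in the order X + Y T, to which the exchange relation applies.
  have hQ : (Xh + T * Yh) * T ^ m * T = T * (H * T ^ m * Hi * (X + Y * T)) := by
    rw [add_mul, add_mul, hX, mul_assoc T Yh, hY]
    noncomm_ring
  have key : (1 - T - lam • ((Xh + T * Yh) * T ^ m)) * T =
      T * ((1 - H * (T ^ m * P⁻¹ * (lam • (X + T * Y))) * Hi) * P) := by
    have e : Hi * (X + Y * T) = P⁻¹ * ((X + T * Y) * Hi * P) := by
      rw [← hB, ← mul_assoc, ← mul_assoc, Matrix.nonsing_inv_mul _ hPu, one_mul]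
    rw [sub_mul, smul_mul_assoc, hQ, mul_assoc (H * T ^ m), e, ← hP, hPT]
    clear_value P
    rw [sub_mul, mul_sub, one_mul]
    congr 1
    simp only [mul_smul_comm, smul_mul_assoc, mul_assoc]
  have key2 : 1 - T - lam • ((X + T * Y) * T ^ m) =
      P * (1 - (P⁻¹ * (lam • (X + T * Y))) * T ^ m) := by
    rw [mul_sub, mul_one, ← mul_assoc, ← mul_assoc, Matrix.mul_nonsing_inv _ hPu, one_mul,
      smul_mul_assoc]
  have hconj : (1 - H * (T ^ m * P⁻¹ * (lam • (X + T * Y))) * Hi).det =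
      (1 - T ^ m * (P⁻¹ * (lam • (X + T * Y)))).det := by
    rw [mul_assoc H, Matrix.det_one_sub_mul_comm, mul_assoc, hHiH, mul_one, mul_assoc]
  have := congrArg Matrix.det key
  rw [Matrix.det_mul, Matrix.det_mul, Matrix.det_mul, hconj, Matrix.det_one_sub_mul_comm,
    mul_comm T.det] at this
  have := mul_right_cancel₀ hTu this
  rw [diffMatrix, diffMatrix, ← hT]
  change (1 - T - lam • ((Xh + T * Yh) * T ^ m)).det = (1 - T - lam • ((X + T * Y) * T ^ m)).det
  rw [this, key2, Matrix.det_mul, mul_comm]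

/-- Renumbering the coefficients is conjugation by T^c. This absorbs the cyclic shift between `pent`
and the refactorization formula. -/
theorem det_diffMatrix_comp_add (m c : ℕ) (x y : ZMod n → F) (lam ζ : F) (h0 : ζ ≠ 0) :
    (diffMatrix m (fun i : ZMod n => x (i + c)) (fun i : ZMod n => y (i + c)) lam ζ).det =
      (diffMatrix m x y lam ζ).det := by
  set T := shift n ζ with hT
  have hTu : (T ^ c).det ≠ 0 := by
    rw [Matrix.det_pow]; exact pow_ne_zero _ (isUnit_det_shift ζ h0).ne_zero
  have hx : ∀ z : ZMod n → F, T ^ c * diagonal (fun i => z (i + c)) = diagonal z * T ^ c := by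
    intro z
    rw [shift_pow_mul_diagonal]
    simp only [sub_add_cancel, hT]
  have hc : T ^ c * T = T * T ^ c := by rw [← pow_succ, ← pow_succ']
  have hcm : T ^ m * T ^ c = T ^ c * T ^ m := by rw [← pow_add, ← pow_add, add_comm]
  have key : T ^ c * diffMatrix m (fun i : ZMod n => x (i + c)) (fun i : ZMod n => y (i + c)) lam ζ =
      diffMatrix m x y lam ζ * T ^ c := by
    rw [diffMatrix, diffMatrix, ← hT, mul_sub, sub_mul, mul_sub, sub_mul, hc, mul_one, one_mul,
      mul_smul_comm, smul_mul_assoc, mul_assoc _ (T ^ m) (T ^ c), hcm, ← mul_assoc, ← mul_assoc,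
      mul_add, add_mul, hx, ← mul_assoc, hc, mul_assoc T (T ^ c), hx]
    simp only [add_mul, mul_assoc]
  have := congrArg Matrix.det key
  rw [Matrix.det_mul, Matrix.det_mul, mul_comm] at this
  exact mul_right_cancel₀ hTu this

end Refactorization

/-! ### Involution: the local identity for Green's functions -/

section Green

variable {F : Type*} [Field F] {n : ℕ} [NeZero n]

theorem sum_add_right {M : Type*} [AddCommMonoid M] (f : ZMod n → M) (c : ZMod n) :
    ∑ i, f (i + c) = ∑ i, f i :=
  Equiv.sum_comp (Equiv.addRight c) f

/-- Diagonals of the product `Z G` for the two-term operator `Z = a T ^ m + b T ^ (m + 1)`. -/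
def opLeft (m : ℕ) (a b : ZMod n → F) (g : ℤ → ZMod n → F) (d : ℤ) (i : ZMod n) : F :=
  a (i - d) * g (d + m) i + b (i - d) * g (d + m + 1) i

/-- Diagonals of the product `G Z` for the two-term operator `Z = a T ^ m + b T ^ (m + 1)`. -/
def opRight (m : ℕ) (a b : ZMod n → F) (g : ℤ → ZMod n → F) (d : ℤ) (i : ZMod n) : F :=
  a (i + m) * g (d + m) (i + m) + b (i + m + 1) * g (d + m + 1) (i + m + 1)

/-- The telescoping potential of the quadratic bracket of a two-term operator. -/
def telescope (m : ℕ) (a b : ZMod n → F) (g g' : ℤ → ZMod n → F) (d : ℤ) : F :=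
  ∑ i, a (i + d) * b i * g (m - d) i * g' (m + 1 + d) (i + d) -
    ∑ i, b (i + d + 1) * a i * g (m - d) i * g' (m + 1 + d) (i + d + 1)

/-- After cyclic shifts of the summation index the aa and bb terms on the left and on the right
cancel. The four mixed sums are the two sums of the potential at d and, with opposite sign, its two
sums at d - 1. -/
theorem sum_opLeft_sub_sum_opRight (m : ℕ) (a b : ZMod n → F) (g g' : ℤ → ZMod n → F) (d : ℤ) :
    ∑ i, opLeft m a b g (-d) i * opLeft m a b g' d (i + d) -
      ∑ i, opRight m a b g (-d) i * opRight m a b g' d (i + d) =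
    telescope m a b g g' d - telescope m a b g g' (d - 1) := by
  have r1 : ∑ i : ZMod n, a (i + m) * g (-d + m) (i + m) * (a (i + d + m) * g' (d + m) (i + d + m)) =
      ∑ i : ZMod n, a (i + d) * g (-d + m) i * (a i * g' (d + m) (i + d)) := by
    rw [← sum_add_right (fun i : ZMod n => a (i + d) * g (-d + m) i * (a i * g' (d + m) (i + d))) (m : ZMod n)]
    refine Finset.sum_congr rfl fun i _ => ?_
    rw [show i + (m : ZMod n) + d = i + d + m by ring]
    ring
  have r2 : ∑ i : ZMod n, b (i + m + 1) * g (-d + m + 1) (i + m + 1) *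
        (b (i + d + m + 1) * g' (d + m + 1) (i + d + m + 1)) =
      ∑ i : ZMod n, b (i + d) * g (-d + m + 1) i * (b i * g' (d + m + 1) (i + d)) := by
    rw [← sum_add_right (fun i : ZMod n => b (i + d) * g (-d + m + 1) i * (b i * g' (d + m + 1) (i + d)))
      (m + 1 : ZMod n)]
    refine Finset.sum_congr rfl fun i _ => ?_
    rw [show i + ((m : ZMod n) + 1) + d = i + d + m + 1 by ring, ← add_assoc i]
    ring
  have r3 : ∑ i : ZMod n, a (i + m) * g (-d + m) (i + m) *
        (b (i + d + m + 1) * g' (d + m + 1) (i + d + m + 1)) =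
      ∑ i : ZMod n, b (i + d + 1) * a i * g (-d + m) i * g' (d + m + 1) (i + d + 1) := by
    rw [← sum_add_right (fun i : ZMod n => b (i + d + 1) * a i * g (-d + m) i * g' (d + m + 1) (i + d + 1))
      (m : ZMod n)]
    refine Finset.sum_congr rfl fun i _ => ?_
    rw [show i + (m : ZMod n) + d + 1 = i + d + m + 1 by ring]
    ring
  have r4 : ∑ i : ZMod n, b (i + m + 1) * g (-d + m + 1) (i + m + 1) *
        (a (i + d + m) * g' (d + m) (i + d + m)) =
      ∑ i : ZMod n, a (i + d - 1) * b i * g (-d + m + 1) i * g' (d + m) (i + d - 1) := by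
    rw [← sum_add_right (fun i : ZMod n => a (i + d - 1) * b i * g (-d + m + 1) i * g' (d + m) (i + d - 1))
      (m + 1 : ZMod n)]
    refine Finset.sum_congr rfl fun i _ => ?_
    rw [show i + ((m : ZMod n) + 1) + d - 1 = i + d + m by ring, ← add_assoc i]
    ring
  have hl : ∑ i, opLeft m a b g (-d) i * opLeft m a b g' d (i + d) =
      ∑ i : ZMod n, a (i + d) * g (-d + m) i * (a i * g' (d + m) (i + d)) +
      ∑ i : ZMod n, b (i + d) * g (-d + m + 1) i * (b i * g' (d + m + 1) (i + d)) +
      ∑ i : ZMod n, a (i + d) * b i * g (-d + m) i * g' (d + m + 1) (i + d) +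
      ∑ i : ZMod n, b (i + d) * a i * g (-d + m + 1) i * g' (d + m) (i + d) := by
    simp only [← Finset.sum_add_distrib]
    refine Finset.sum_congr rfl fun i _ => ?_
    simp only [opLeft, Int.cast_neg, sub_neg_eq_add, add_sub_cancel_right]
    ring
  have hr : ∑ i, opRight m a b g (-d) i * opRight m a b g' d (i + d) =
      ∑ i : ZMod n, a (i + m) * g (-d + m) (i + m) * (a (i + d + m) * g' (d + m) (i + d + m)) +
      ∑ i : ZMod n, b (i + m + 1) * g (-d + m + 1) (i + m + 1) *
        (b (i + d + m + 1) * g' (d + m + 1) (i + d + m + 1)) +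
      ∑ i : ZMod n, a (i + m) * g (-d + m) (i + m) *
        (b (i + d + m + 1) * g' (d + m + 1) (i + d + m + 1)) +
      ∑ i : ZMod n, b (i + m + 1) * g (-d + m + 1) (i + m + 1) *
        (a (i + d + m) * g' (d + m) (i + d + m)) := by
    simp only [← Finset.sum_add_distrib]
    refine Finset.sum_congr rfl fun i _ => ?_
    simp only [opRight]
    ring
  rw [hl, hr, r1, r2, r3, r4, telescope, telescope]
  have i1 : (m : ℤ) - (d - 1) = -d + m + 1 := by ring
  have i2 : (m : ℤ) + 1 + (d - 1) = d + m := by ring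
  have i3 : (m : ℤ) - d = -d + m := by ring
  have i4 : (m : ℤ) + 1 + d = d + m + 1 := by ring
  have i5 : ∀ i : ZMod n, i + ((d : ZMod n) - 1) = i + d - 1 := fun i => by ring
  have i6 : ∀ i : ZMod n, i + (d : ZMod n) - 1 + 1 = i + d := fun i => by ring
  simp only [Int.cast_sub, Int.cast_one, i1, i2, i3, i4, i5, i6]
  ring

/-- The diagonals `g_d(i) = (T ^ d G)_{ii}` of a Green's function `G = K⁻¹` of the difference
operator. -/
structure IsGreen (m : ℕ) (x y : ZMod n → F) (lam ζ : F) (g : ℤ → ZMod n → F) : Prop where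
  left : ∃ ε : ℤ → F, ∀ d i,
    opLeft 0 1 (-1) g d i - opLeft m (fun i => lam * x i) (fun i => lam * y (i - 1)) g d i = ε d ∧
    opRight 0 1 (-1) g d i - opRight m (fun i => lam * x i) (fun i => lam * y (i - 1)) g d i = ε d
  period : ∀ d i, g (d + n) i = ζ * g d i
  normal : ∀ i, opLeft 0 1 (-1) g 0 i -
    opLeft m (fun i => lam * x i) (fun i => lam * y (i - 1)) g 0 i = 1

/-- Increasing d by n lowers the diagonal of g by n and raises that of g' by n. -/
theorem telescope_period (m : ℕ) (a b : ZMod n → F) (g g' : ℤ → ZMod n → F) (ζ ζ' : F)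
    (h : ∀ d i, g (d + n) i = ζ * g d i) (h' : ∀ d i, g' (d + n) i = ζ' * g' d i) :
    ζ * telescope m a b g g' n = ζ' * telescope m a b g g' 0 := by
  have e1 : ∀ i, g ((m : ℤ) - 0) i = ζ * g (m - n) i := fun i => by
    rw [← h]; congr 1; ring
  have e2 : ∀ i, g' ((m : ℤ) + 1 + n) i = ζ' * g' (m + 1 + 0) i := fun i => by
    rw [h', add_zero]
  simp only [telescope, mul_sub, Finset.mul_sum, e1, e2, Int.cast_natCast, CharP.cast_eq_zero,
    Int.cast_zero, add_zero]
  congr 1 <;> refine Finset.sum_congr rfl fun i _ => by ring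

/-- Let Q and P be the potentials of the operators λ(X + T Y)T^m and 1 - T. On each diagonal these
operators differ on G only by a constant ε, the same for left and right multiplication, so the
increments of Q and P in d agree and Q - P is constant. The quasi-periods give ζ (Q - P)(n) = ζ' (Q
- P)(0), whence (ζ - ζ')(Q - P) = 0. -/
theorem IsGreen.telescope_eq {m : ℕ} {x y : ZMod n → F} {lam ζ lam' ζ' : F}
    {g g' : ℤ → ZMod n → F} (h : IsGreen m x y lam ζ g) (h' : IsGreen m x y lam' ζ' g')
    (hζ : ζ ≠ ζ') :
    lam * lam' * telescope m x (fun i => y (i - 1)) g g' 0 = telescope 0 1 (-1) g g' 0 := by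
  obtain ⟨ε, hε⟩ := h.left
  obtain ⟨ε', hε'⟩ := h'.left
  set Q : ℤ → F := fun d => lam * lam' * telescope m x (fun i => y (i - 1)) g g' d with hQ
  set P : ℤ → F := fun d => telescope 0 1 (-1) g g' d with hP
  -- `opLeft 0 1 (-1)` and `opRight 0 1 (-1)` give the diagonals for 1 - T. Equality of the traces
  -- removes the terms linear in ε and ε'.
  have hsum : ∀ (g : ℤ → ZMod n → F) d, ∑ i, opLeft 0 1 (-1) g d i = ∑ i, opRight 0 1 (-1) g d i := by
    intro g d
    simp only [opLeft, opRight, Finset.sum_add_distrib, Nat.cast_zero, add_zero, Pi.one_apply,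
      Pi.neg_apply]
    congr 1
    exact (sum_add_right (fun i : ZMod n => -1 * g (d + 1) i) 1).symm
  have hstep : ∀ d, Q d - Q (d - 1) = P d - P (d - 1) := by
    intro d
    have s1 := sum_opLeft_sub_sum_opRight 0 (1 : ZMod n → F) (-1) g g' d
    have s2 := sum_opLeft_sub_sum_opRight m x (fun i => y (i - 1)) g g' d
    have l1 : ∀ i, lam * opLeft m x (fun i => y (i - 1)) g (-d) i =
        opLeft 0 1 (-1) g (-d) i - ε (-d) := fun i => by
      rw [← (hε (-d) i).1]; simp only [opLeft]; ring
    have l2 : ∀ i, lam' * opLeft m x (fun i => y (i - 1)) g' d i =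
        opLeft 0 1 (-1) g' d i - ε' d := fun i => by
      rw [← (hε' d i).1]; simp only [opLeft]; ring
    have l3 : ∀ i, lam * opRight m x (fun i => y (i - 1)) g (-d) i =
        opRight 0 1 (-1) g (-d) i - ε (-d) := fun i => by
      rw [← (hε (-d) i).2]; simp only [opRight]; ring
    have l4 : ∀ i, lam' * opRight m x (fun i => y (i - 1)) g' d i =
        opRight 0 1 (-1) g' d i - ε' d := fun i => by
      rw [← (hε' d i).2]; simp only [opRight]; ring
    have e1 : lam * lam' * ∑ i, opLeft m x (fun i => y (i - 1)) g (-d) i *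
          opLeft m x (fun i => y (i - 1)) g' d (i + d) =
        ∑ i, (opLeft 0 1 (-1) g (-d) i - ε (-d)) * (opLeft 0 1 (-1) g' d (i + d) - ε' d) := by
      rw [Finset.mul_sum]
      refine Finset.sum_congr rfl fun i _ => ?_
      rw [← l1, ← l2]; ring
    have e2 : lam * lam' * ∑ i, opRight m x (fun i => y (i - 1)) g (-d) i *
          opRight m x (fun i => y (i - 1)) g' d (i + d) =
        ∑ i, (opRight 0 1 (-1) g (-d) i - ε (-d)) * (opRight 0 1 (-1) g' d (i + d) - ε' d) := by
      rw [Finset.mul_sum]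
      refine Finset.sum_congr rfl fun i _ => ?_
      rw [← l3, ← l4]; ring
    have e3 : ∀ (u v : ZMod n → F) (p q : F),
        ∑ i, (u i - p) * (v (i + d) - q) =
          ∑ i, u i * v (i + d) - q * ∑ i, u i - p * ∑ i, v i + ∑ _i : ZMod n, p * q := by
      intro u v p q
      rw [← sum_add_right v (d : ZMod n), Finset.mul_sum, Finset.mul_sum, ← Finset.sum_sub_distrib,
        ← Finset.sum_sub_distrib, ← Finset.sum_add_distrib]
      refine Finset.sum_congr rfl fun i _ => by ring
    rw [hQ, hP]
    simp only
    rw [← mul_sub, ← s1, ← s2, mul_sub, e1, e2, e3, e3, hsum, hsum]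
    ring
  have hconst : ∀ N : ℕ, Q N - P N = Q 0 - P 0 := by
    intro N
    induction N with
    | zero => simp
    | succ N ih =>
      have := hstep (N + 1 : ℕ)
      rw [show ((N + 1 : ℕ) : ℤ) - 1 = N by push_cast; ring] at this
      linear_combination ih + this
  have p1 := telescope_period m x (fun i => y (i - 1)) g g' ζ ζ' h.period h'.period
  have p2 := telescope_period 0 1 (-1) g g' ζ ζ' h.period h'.period
  have hc := hconst n
  have hfin : (ζ - ζ') * (Q 0 - P 0) = 0 := by
    simp only [hQ, hP] at hc ⊢
    linear_combination lam * lam' * p1 - p2 - ζ * hc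
  rcases mul_eq_zero.mp hfin with h | h
  · exact absurd (sub_eq_zero.mp h) hζ
  · exact sub_eq_zero.mp h

/-- The window form of the quiver bracket in the `(x, y)`-coordinates. -/
def windowBracket (m : ℕ) (α β α' β' : ZMod n → F) : F :=
  ∑ l ∈ Finset.range m, ∑ j : ZMod n,
    ((α (j + 1) + β j) * (α' (j + l + 1) + β' (j + l + 1)) -
      (α' (j + 1) + β' j) * (α (j + l + 1) + β (j + l + 1)))

theorem eq_of_forall_add_one (f : ZMod n → F) (h : ∀ i, f (i + 1) = f i) (i : ZMod n) :
    f i = f 0 := by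
  have : ∀ N : ℕ, f N = f 0 := by
    intro N
    induction N with
    | zero => simp
    | succ N ih => rw [Nat.cast_succ, h, ih]
  rw [← ZMod.natCast_zmod_val i]
  exact this _

/-- Here γ, δ stand for the diagonals 0 and 1 of G, and α, β for the x- and y-parts of its diagonals
m and m + 1. Then h1, h2 are the main diagonals of K G = 1 and G K = 1, and h3 is the potential
identity at d = 0. Comparing h1 with h2 expresses γ - α, up to a constant, by a sum over a window of
length m. Inserted into h3, this makes the window bracket appear, and the constant drops out because
the primed sums have equal totals. -/
theorem windowBracket_eq_zero (m : ℕ) (α β γ δ α' β' γ' δ' : ZMod n → F)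
    (h1 : ∀ i, γ i - δ i = 1 + α i + β (i - 1)) (h2 : ∀ i, γ i - δ (i + 1) = 1 + α (i + m) + β (i + m))
    (h1' : ∀ i, γ' i - δ' i = 1 + α' i + β' (i - 1))
    (h2' : ∀ i, γ' i - δ' (i + 1) = 1 + α' (i + m) + β' (i + m))
    (h3 : ∑ i, γ i * (δ' (i + 1) - δ' i) = ∑ i, α i * (β' (i - 1) - β' i)) :
    windowBracket m α β α' β' = 0 := by
  set s : ZMod n → F := fun j => α (j + 1) + β j with hs
  set σ : ZMod n → F := fun j => α j + β j with hσ
  set s' : ZMod n → F := fun j => α' (j + 1) + β' j with hs'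
  set σ' : ZMod n → F := fun j => α' j + β' j with hσ'
  set V : ZMod n → F := fun i => ∑ l ∈ Finset.range m, σ (i + l) with hV
  set U : ZMod n → F := fun i => ∑ l ∈ Finset.range m, s (i + l) with hU
  have hVstep : ∀ i, V (i + 1) - V i = σ (i + m) - σ i := by
    intro i
    rw [hV]
    simp only [← Finset.sum_sub_distrib]
    have := Finset.sum_range_sub (fun l : ℕ => σ (i + l)) m
    simp only [Nat.cast_zero, add_zero] at this
    rw [← this]
    refine Finset.sum_congr rfl fun l _ => ?_
    rw [Nat.cast_succ, add_assoc, add_comm (1 : ZMod n)]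
  have hUV : ∀ i, α (i + m) - α i = U i - V i := by
    intro i
    rw [hU, hV]
    simp only [← Finset.sum_sub_distrib]
    have := Finset.sum_range_sub (fun l : ℕ => α (i + l)) m
    simp only [Nat.cast_zero, add_zero] at this
    rw [← this]
    refine Finset.sum_congr rfl fun l _ => ?_
    rw [Nat.cast_succ, hs, hσ, ← add_assoc]
    ring
  -- Subtracting h2 at i from h1 at i + 1 eliminates δ and leaves the increment of γ, which is a
  -- first difference of α - V.
  have hc : ∀ i, γ i - α i + V i = γ 0 - α 0 + V 0 := by
    intro i
    refine eq_of_forall_add_one (fun i => γ i - α i + V i) (fun i => ?_) i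
    have a1 := h1 (i + 1)
    rw [add_sub_cancel_right] at a1
    have a2 := h2 i
    have a3 := hVstep i
    simp only [hσ] at a3
    linear_combination a1 - a2 + a3
  set c := γ 0 - α 0 + V 0
  have hsum : ∑ i, s' (i - 1) = ∑ i, σ' (i + m) := by
    rw [sum_add_right σ' (m : ZMod n)]
    simp only [hs', hσ', sub_add_cancel, Finset.sum_add_distrib]
    congr 1
    simp only [sub_eq_add_neg]
    exact sum_add_right β' (-1)
  have hA : ∑ i, (c - V i) * s' (i - 1) + ∑ i, (U i - c) * σ' (i + m) = 0 := by
    have e0 : ∑ i, α i * σ' i = ∑ i : ZMod n, α (i + m) * σ' (i + m) :=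
      (sum_add_right (fun i => α i * σ' i) (m : ZMod n)).symm
    have e1 : ∑ i, γ i * (δ' (i + 1) - δ' i) = ∑ i : ZMod n, γ i * (s' (i - 1) - σ' (i + m)) := by
      refine Finset.sum_congr rfl fun i _ => ?_
      have a1 := h1' i
      have a2 := h2' i
      simp only [hs', hσ', sub_add_cancel]
      linear_combination γ i * (a1 - a2)
    have e2 : ∑ i, α i * (β' (i - 1) - β' i) = ∑ i : ZMod n, α i * s' (i - 1) - ∑ i, α i * σ' i := by
      rw [← Finset.sum_sub_distrib]
      refine Finset.sum_congr rfl fun i _ => ?_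
      simp only [hs', hσ', sub_add_cancel]
      ring
    rw [e1, e2, e0] at h3
    rw [← sub_eq_zero] at h3
    rw [← h3, ← Finset.sum_sub_distrib, ← Finset.sum_sub_distrib, ← Finset.sum_add_distrib]
    refine Finset.sum_congr rfl fun i _ => ?_
    have a1 := hc i
    have a2 := hUV i
    linear_combination (-s' (i - 1) + σ' (i + m)) * a1 - σ' (i + m) * a2
  have hUs : ∑ i : ZMod n, U i * σ' (i + m) =
      ∑ l ∈ Finset.range m, ∑ j : ZMod n, s j * σ' (j + l + 1) := by
    rw [← Finset.sum_range_reflect]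
    simp only [hU, Finset.sum_mul]
    rw [Finset.sum_comm]
    refine Finset.sum_congr rfl fun l hl => ?_
    rw [← sum_add_right (fun j : ZMod n => s j * σ' (j + ((m - 1 - l : ℕ) : ZMod n) + 1)) (l : ZMod n)]
    refine Finset.sum_congr rfl fun i _ => ?_
    have : (m : ZMod n) = l + ((m - 1 - l : ℕ) : ZMod n) + 1 := by
      have := Finset.mem_range.mp hl
      rw [← Nat.cast_add, ← Nat.cast_succ]
      congr 1; omega
    rw [show i + (l : ZMod n) + ((m - 1 - l : ℕ) : ZMod n) + 1 = i + m by rw [this]; ring]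
  have hVs : ∑ i : ZMod n, V i * s' (i - 1) =
      ∑ l ∈ Finset.range m, ∑ j : ZMod n, s' j * σ (j + l + 1) := by
    simp only [hV, Finset.sum_mul]
    rw [Finset.sum_comm]
    refine Finset.sum_congr rfl fun l _ => ?_
    rw [← sum_add_right (fun i : ZMod n => σ (i + l) * s' (i - 1)) 1]
    refine Finset.sum_congr rfl fun i _ => ?_
    rw [add_sub_cancel_right, mul_comm, show i + 1 + (l : ZMod n) = i + l + 1 by ring]
  simp only [sub_mul, Finset.sum_sub_distrib, ← Finset.mul_sum, hsum] at hA
  rw [windowBracket]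
  simp only [Finset.sum_sub_distrib]
  change ∑ l ∈ Finset.range m, ∑ j : ZMod n, s j * σ' (j + l + 1) -
    ∑ l ∈ Finset.range m, ∑ j : ZMod n, s' j * σ (j + l + 1) = 0
  rw [← hUs, ← hVs]
  linear_combination hA

theorem IsGreen.windowBracket_eq_zero {m : ℕ} {x y : ZMod n → F} {lam ζ lam' ζ' : F}
    {g g' : ℤ → ZMod n → F} (h : IsGreen m x y lam ζ g) (h' : IsGreen m x y lam' ζ' g')
    (hζ : ζ ≠ ζ') :
    windowBracket m (fun i => lam * x i * g m i) (fun i => lam * y i * g (m + 1) (i + 1))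
      (fun i => lam' * x i * g' m i) (fun i => lam' * y i * g' (m + 1) (i + 1)) = 0 := by
  have hrow : ∀ {lam ζ : F} {g : ℤ → ZMod n → F}, IsGreen m x y lam ζ g → ∀ i,
      g 0 i - g 1 i = 1 + lam * x i * g m i + lam * y (i - 1) * g (m + 1) (i - 1 + 1) := by
    intro lam ζ g h i
    have := h.normal i
    simp only [opLeft, Pi.one_apply, Pi.neg_apply, Nat.cast_zero, add_zero, zero_add, Int.cast_zero,
      sub_zero] at this
    rw [sub_add_cancel]
    linear_combination this
  have hcol : ∀ {lam ζ : F} {g : ℤ → ZMod n → F}, IsGreen m x y lam ζ g → ∀ i : ZMod n,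
      g 0 i - g 1 (i + 1) = 1 + lam * x (i + m) * g m (i + m) +
        lam * y (i + m) * g (m + 1) (i + m + 1) := by
    intro lam ζ g h i
    obtain ⟨ε, hε⟩ := h.left
    have h0 := h.normal 0
    have := (hε 0 i).2
    rw [← (hε 0 0).1, h0] at this
    simp only [opRight, Pi.one_apply, Pi.neg_apply, Nat.cast_zero, add_zero, zero_add,
      add_sub_cancel_right] at this
    linear_combination this
  refine HigherPentagram.windowBracket_eq_zero m _ _ (g 0) (g 1) _ _ (g' 0) (g' 1)
    (hrow h) (hcol h) (hrow h') (hcol h') ?_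
  have := h.telescope_eq h' hζ
  simp only [telescope, ← Finset.sum_sub_distrib, Int.cast_zero, add_zero, sub_zero, Nat.cast_zero,
    zero_add, add_sub_cancel_right, Pi.one_apply, Pi.neg_apply] at this
  have e : ∀ i : ZMod n, g 0 i * (g' 1 (i + 1) - g' 1 i) =
      1 * -1 * g 0 i * g' 1 i - -1 * 1 * g 0 i * g' 1 (i + 1) := fun i => by ring
  simp only [e]
  rw [← this, Finset.mul_sum]
  refine Finset.sum_congr rfl fun i _ => ?_
  rw [sub_add_cancel]
  ring

/-- The quasi-periodic shift as a unit. -/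
def shiftUnit (n : ℕ) [NeZero n] (ζ : F) (h0 : ζ ≠ 0) : (Matrix (ZMod n) (ZMod n) F)ˣ where
  val := shift n ζ
  inv := ζ⁻¹ • shift n ζ ^ (n - 1)
  val_inv := shift_mul_shift_pow ζ h0
  inv_val := mul_eq_one_comm.mp (shift_mul_shift_pow ζ h0)

theorem shiftUnit_zpow_mul_diagonal (ζ : F) (h0 : ζ ≠ 0) (d : ℤ) (a : ZMod n → F) :
    ((shiftUnit n ζ h0 ^ d : (Matrix (ZMod n) (ZMod n) F)ˣ) : Matrix (ZMod n) (ZMod n) F) *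
      diagonal a = diagonal (fun i => a (i - d)) *
        ((shiftUnit n ζ h0 ^ d : (Matrix (ZMod n) (ZMod n) F)ˣ) : Matrix (ZMod n) (ZMod n) F) := by
  obtain ⟨N, rfl | rfl⟩ := d.eq_nat_or_neg
  · rw [_root_.zpow_natCast, Units.val_pow_eq_pow_val, Int.cast_natCast]
    exact shift_pow_mul_diagonal ζ N a
  · have h := shift_pow_mul_diagonal ζ N (fun i : ZMod n => a (i + N))
    simp only [sub_add_cancel] at h
    rw [_root_.zpow_neg, _root_.zpow_natCast, Units.inv_mul_eq_iff_eq_mul, ← mul_assoc, Units.eq_mul_inv_iff_mul_eq,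
      Units.val_pow_eq_pow_val]
    simp only [Int.cast_neg, Int.cast_natCast, sub_neg_eq_add]
    exact h.symm

/-- The diagonals of Green's function of the difference operator. -/
def green (m : ℕ) (x y : ZMod n → F) (lam ζ : F) (h0 : ζ ≠ 0) (d : ℤ) (i : ZMod n) : F :=
  (((shiftUnit n ζ h0 ^ d : (Matrix (ZMod n) (ZMod n) F)ˣ) : Matrix (ZMod n) (ZMod n) F) *
    (diffMatrix m x y lam ζ)⁻¹) i i

/-- These are the diagonal entries of T^d K K⁻¹ = T^d = T^d K⁻¹ K. The diagonal of T^d is constant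
because T^d commutes with T, and it is 1 for d = 0. -/
theorem isGreen_green (m : ℕ) (x y : ZMod n → F) (lam ζ : F) (h0 : ζ ≠ 0)
    (hK : (diffMatrix m x y lam ζ).det ≠ 0) :
    IsGreen m x y lam ζ (green m x y lam ζ h0) := by
  set T := shiftUnit n ζ h0 with hT
  set K := diffMatrix m x y lam ζ with hKdef
  have hKu : IsUnit K.det := isUnit_iff_ne_zero.mpr hK
  set W : ℤ → Matrix (ZMod n) (ZMod n) F := fun d =>
    ((T ^ d : (Matrix (ZMod n) (ZMod n) F)ˣ) : Matrix (ZMod n) (ZMod n) F) with hW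
  have hT1 : shift n ζ = W 1 := by rw [hW]; simp [hT, shiftUnit]
  have hTm : ∀ l : ℕ, shift n ζ ^ l = W l := by
    intro l; rw [hW]; simp [hT, shiftUnit]
  have hadd : ∀ d e, W (d + e) = W d * W e := by
    intro d e; rw [hW]; simp only [_root_.zpow_add, Units.val_mul]
  have hdiag : ∀ (d : ℤ) (a : ZMod n → F),
      W d * diagonal a = diagonal (fun i => a (i - d)) * W d :=
    fun d a => shiftUnit_zpow_mul_diagonal ζ h0 d a
  have hg : ∀ d i, green m x y lam ζ h0 d i = (W d * K⁻¹) i i := fun d i => rfl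
  have hKW : K = 1 - W 1 - lam • ((diagonal x + W 1 * diagonal y) * W m) := by
    rw [hKdef, diffMatrix, hTm, hT1]
  have hleft : ∀ d i, opLeft 0 1 (-1) (green m x y lam ζ h0) d i -
      opLeft m (fun i => lam * x i) (fun i => lam * y (i - 1)) (green m x y lam ζ h0) d i =
      (W d) i i := by
    intro d i
    have e : W d = W d * K⁻¹ - W (d + 1) * K⁻¹ - lam • (diagonal (fun i => x (i - d)) *
        (W (d + m) * K⁻¹) + diagonal (fun i => y (i - 1 - d)) * (W (d + m + 1) * K⁻¹)) := by
      have e0 : W d * K = W d - W (d + 1) - lam • (diagonal (fun i => x (i - d)) * W (d + m) +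
          diagonal (fun i => y (i - 1 - d)) * W (d + m + 1)) := by
        have : (fun i : ZMod n => y (i - ((d + 1 : ℤ) : ZMod n))) = fun i => y (i - 1 - d) := by
          funext i; push_cast; congr 1; ring
        rw [hKW, show d + (m : ℤ) + 1 = d + 1 + m by ring, hadd (d + 1) m, hadd d m, mul_sub,
          mul_sub, mul_one, ← hadd, mul_smul_comm, ← mul_assoc (W d), mul_add, ← mul_assoc (W d),
          ← hadd, hdiag d, hdiag (d + 1), this]
        simp only [add_mul, mul_assoc]
      calc W d = W d * K * K⁻¹ := by rw [mul_assoc, Matrix.mul_nonsing_inv _ hKu, mul_one]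
        _ = _ := by
          rw [e0, sub_mul, sub_mul, smul_mul_assoc]
          simp only [add_mul, mul_assoc]
    conv_rhs => rw [e]
    simp only [Matrix.sub_apply, Matrix.smul_apply, Matrix.add_apply, Matrix.diagonal_mul, ← hg,
      opLeft, smul_eq_mul, Pi.one_apply, Pi.neg_apply, Nat.cast_zero, add_zero]
    rw [show i - (d : ZMod n) - 1 = i - 1 - d by ring]
    ring
  have hright : ∀ d i, opRight 0 1 (-1) (green m x y lam ζ h0) d i -
      opRight m (fun i => lam * x i) (fun i => lam * y (i - 1)) (green m x y lam ζ h0) d i =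
      (W d) i i := by
    intro d i
    have hs : ∀ (l : ℕ) (X : Matrix (ZMod n) (ZMod n) F) i,
        (X * W l) i i = (W l * X) (i + l) (i + l) := by
      intro l X i
      rw [← hTm]; exact mul_shift_pow_diag ζ l X i
    have hs1 : ∀ (X : Matrix (ZMod n) (ZMod n) F) i, (X * W 1) i i = (W 1 * X) (i + 1) (i + 1) := by
      intro X i
      have := hs 1 X i
      rwa [Nat.cast_one, Nat.cast_one] at this
    have e : W d = W d * K⁻¹ - W d * K⁻¹ * W 1 - lam • (W d * K⁻¹ * diagonal x * W m +
        W d * K⁻¹ * W 1 * diagonal y * W m) := by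
      calc W d = W d * K⁻¹ * K := by rw [mul_assoc, Matrix.nonsing_inv_mul _ hKu, mul_one]
        _ = _ := by
          generalize K⁻¹ = J
          rw [hKW, mul_sub, mul_sub, mul_one, mul_smul_comm, ← mul_assoc, mul_add, add_mul]
          simp only [mul_assoc]
    conv_rhs => rw [e]
    simp only [Matrix.sub_apply, Matrix.smul_apply, Matrix.add_apply]
    have f1 : (W d * K⁻¹ * W 1) i i = green m x y lam ζ h0 (d + 1) (i + 1) := by
      rw [hs1, ← mul_assoc, ← hadd, add_comm 1 d, hg]
    have f2 : (W d * K⁻¹ * diagonal x * W m) i i =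
        x (i + m) * green m x y lam ζ h0 (d + m) (i + m) := by
      rw [hs, ← mul_assoc, Matrix.mul_diagonal, ← mul_assoc, ← hadd, add_comm (m : ℤ) d, hg, mul_comm]
    have f3 : (W d * K⁻¹ * W 1 * diagonal y * W m) i i =
        y (i + m) * green m x y lam ζ h0 (d + m + 1) (i + m + 1) := by
      rw [hs, ← mul_assoc, Matrix.mul_diagonal, ← mul_assoc, hs1, ← mul_assoc, ← mul_assoc, ← hadd,
        ← hadd, hg, mul_comm, show 1 + (m : ℤ) + d = d + m + 1 by ring]
    rw [f1, f2, f3, ← hg]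
    simp only [opRight, smul_eq_mul, Pi.one_apply, Pi.neg_apply, Nat.cast_zero, add_zero,
      add_sub_cancel_right]
    ring
  refine ⟨⟨fun d => (W d) 0 0, fun d i => ?_⟩, fun d i => ?_, fun i => ?_⟩
  · have hconst : ∀ i, (W d) i i = (W d) 0 0 := by
      intro i
      refine eq_of_forall_add_one (fun i => (W d) i i) (fun i => ?_) i
      have h1 : W d = W (d - 1) * shift n ζ := by rw [hT1, ← hadd, sub_add_cancel]
      have h2 : W d = shift n ζ * W (d - 1) := by rw [hT1, ← hadd]; congr 1; ring
      calc (W d) (i + 1) (i + 1) = (shift n ζ * W (d - 1)) (i + 1) (i + 1) := by rw [← h2]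
        _ = (W (d - 1) * shift n ζ) i i := (mul_shift_diag ζ _ i).symm
        _ = (W d) i i := by rw [← h1]
    exact ⟨(hleft d i).trans (hconst i), (hright d i).trans (hconst i)⟩
  · rw [hg, hg, hadd, ← hTm, shift_pow_self]
    simp
  · rw [hleft, hW]; simp

end Green

/-! ### The integrals as coefficients of the determinant of the difference operator -/

section Spectral

variable {n : ℕ} [NeZero n]

theorem eq_zero_of_sum_range_mul_pow (B : ℕ) (c : ℕ → ℝ) (S : Set ℝ) (hS : S.Infinite)
    (h : ∀ z ∈ S, ∑ i ∈ Finset.range B, c i * z ^ i = 0) (i : ℕ) (hi : i < B) : c i = 0 := by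
  have hp : (∑ i ∈ Finset.range B, Polynomial.C (c i) * Polynomial.X ^ i : Polynomial ℝ) = 0 := by
    refine Polynomial.eq_zero_of_infinite_isRoot _ (hS.mono fun z hz => ?_)
    simpa [Polynomial.IsRoot, Polynomial.eval_finsetSum] using h z hz
  have := congrArg (fun p => Polynomial.coeff p i) hp
  simpa [Polynomial.finsetSum_coeff, Polynomial.coeff_X_pow, hi] using this

/-- The admissible set of z may depend on λ, so that zeros of the spectral determinant and other bad
values can be left out. -/
theorem eq_zero_of_sum_sum_mul_pow (B : ℕ) (c : ℕ → ℕ → ℝ) (S : ℝ → Set ℝ)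
    (hS : ∀ lam, (S lam).Infinite)
    (h : ∀ lam, ∀ z ∈ S lam,
      ∑ i ∈ Finset.range B, ∑ j ∈ Finset.range B, c i j * (z ^ i * lam ^ j) = 0)
    (i j : ℕ) (hi : i < B) (hj : j < B) : c i j = 0 := by
  refine eq_zero_of_sum_range_mul_pow B (c i) Set.univ Set.infinite_univ (fun lam _ => ?_) j hj
  refine eq_zero_of_sum_range_mul_pow B (fun i => ∑ j ∈ Finset.range B, c i j * lam ^ j) (S lam)
    (hS lam) (fun z hz => ?_) i hi
  rw [← h lam z hz]
  refine Finset.sum_congr rfl fun i _ => ?_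
  rw [Finset.sum_mul]
  exact Finset.sum_congr rfl fun j _ => by ring

/-- The polynomial `det (M(λ) - z)`. -/
def specPoly (n k : ℕ) : Polynomial (Polynomial (PolyXY n)) :=
  ((monodromy n k).map Polynomial.C -
    (Polynomial.X : Polynomial (Polynomial (PolyXY n))) • 1).det

theorem exists_bound_I (n k : ℕ) : ∃ B : ℕ, ∀ i j, B ≤ i ∨ B ≤ j → I n k i j = 0 := by
  refine ⟨max ((specPoly n k).natDegree + 1)
    ((Finset.range ((specPoly n k).natDegree + 1)).sup
      (fun i => ((specPoly n k).coeff i).natDegree + 1)), fun i j h => ?_⟩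
  change ((specPoly n k).coeff i).coeff j = 0
  by_cases hi : (specPoly n k).natDegree < i
  · rw [Polynomial.coeff_eq_zero_of_natDegree_lt hi, Polynomial.coeff_zero]
  · apply Polynomial.coeff_eq_zero_of_natDegree_lt
    have h1 := Finset.le_sup (f := fun i => ((specPoly n k).coeff i).natDegree + 1)
      (Finset.mem_range.mpr (show i < (specPoly n k).natDegree + 1 by omega))
    have h2 : ((specPoly n k).coeff i).natDegree + 1 ≤ _ := h1
    omega

/-- A common bound for the indices of the nonzero integrals. -/
def bound (n k : ℕ) : ℕ := (exists_bound_I n k).choose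

theorem I_eq_zero (n k i j : ℕ) (h : bound n k ≤ i ∨ bound n k ≤ j) : I n k i j = 0 :=
  (exists_bound_I n k).choose_spec i j h

theorem laxFactor_eq (k : ℕ) (i : ZMod n) :
    laxFactor k i = lax k (Polynomial.C (xVar i)) (Polynomial.C (yVar i)) Polynomial.X := by
  ext a b : 2
  simp only [laxFactor, lax, Matrix.of_apply, map_add]

theorem lax_map {R S : Type*} [CommRing R] [CommRing S] (f : R →+* S) (k : ℕ) (x y lam : R) :
    (lax k x y lam).map f = lax k (f x) (f y) (f lam) := by
  ext a b
  simp only [lax, Matrix.map_apply, Matrix.of_apply]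
  split_ifs <;> simp

theorem laxProd_map {R S : Type*} [CommRing R] [CommRing S] (f : R →+* S) (k : ℕ)
    (x y : ZMod n → R) (lam : R) (t : ℕ) :
    (laxProd k x y lam t).map f = laxProd k (fun i => f (x i)) (fun i => f (y i)) (f lam) t := by
  induction t with
  | zero => simp [laxProd]
  | succ t ih => rw [laxProd_succ, laxProd_succ, Matrix.map_mul, ih, lax_map]

theorem shift_map {R S : Type*} [CommRing R] [CommRing S] (f : R →+* S) (ζ : R) :
    (shift n ζ).map f = shift n (f ζ) := by
  ext i j
  simp only [shift, Matrix.map_apply, Matrix.of_apply]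
  split_ifs <;> simp

theorem diffMatrix_map {R S : Type*} [CommRing R] [CommRing S] (f : R →+* S) (m : ℕ)
    (x y : ZMod n → R) (lam ζ : R) :
    (diffMatrix m x y lam ζ).map f =
      diffMatrix m (fun i => f (x i)) (fun i => f (y i)) (f lam) (f ζ) := by
  have h : ∀ X : Matrix (ZMod n) (ZMod n) R, X.map f = f.mapMatrix X := fun X => rfl
  have hs : ∀ X : Matrix (ZMod n) (ZMod n) R, f.mapMatrix (lam • X) = f lam • f.mapMatrix X := by
    intro X; ext; simp
  have hd : ∀ a : ZMod n → R, f.mapMatrix (diagonal a) = diagonal fun i => f (a i) := by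
    intro a; rw [← h, Matrix.diagonal_map (map_zero f)]
  rw [h, diffMatrix, diffMatrix, map_sub, map_sub, hs, map_mul, map_add, map_mul, map_pow, map_one,
    hd, hd, ← h, shift_map]

/-- The value of `det (M(λ) - z)` at numerical `λ` and `z`, as a polynomial in `(x, y)`. -/
def specDet (n k : ℕ) [NeZero n] (lam z : ℝ) : PolyXY n :=
  (laxProd k (xVar (n := n)) yVar (MvPolynomial.C lam) n -
    (MvPolynomial.C z : PolyXY n) • (1 : Matrix (Fin k) (Fin k) (PolyXY n))).det

theorem specDet_eq_eval (k : ℕ) (lam z : ℝ) : specDet n k lam z =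
    ((specPoly n k).eval (Polynomial.C (MvPolynomial.C z))).eval (MvPolynomial.C lam) := by
  have hM : monodromy n k = laxProd k (fun i => Polynomial.C (xVar (n := n) i))
      (fun i => Polynomial.C (yVar i)) Polynomial.X n := by
    simp only [monodromy, laxProd, laxFactor_eq]
  let e : Polynomial (Polynomial (PolyXY n)) →+* PolyXY n :=
    (Polynomial.evalRingHom (MvPolynomial.C lam)).comp
      (Polynomial.evalRingHom (Polynomial.C (MvPolynomial.C z)))
  have hdet : e (specPoly n k) = (e.mapMatrix ((monodromy n k).map Polynomial.C -
      (Polynomial.X : Polynomial (Polynomial (PolyXY n))) • 1)).det := by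
    have h' := RingHom.map_det e ((monodromy n k).map Polynomial.C -
      (Polynomial.X : Polynomial (Polynomial (PolyXY n))) • 1)
    exact h'
  refine Eq.trans ?_ hdet.symm
  rw [specDet]
  congr 1
  have hsub := map_sub e.mapMatrix ((monodromy n k).map Polynomial.C)
    ((Polynomial.X : Polynomial (Polynomial (PolyXY n))) • 1)
  refine Eq.trans ?_ hsub.symm
  congr 1
  · have hcomp : (e ∘ (Polynomial.C : Polynomial (PolyXY n) → _)) =
        Polynomial.evalRingHom (MvPolynomial.C lam) := by
      funext p; simp [e]
    have h1 : e.mapMatrix ((monodromy n k).map Polynomial.C) =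
        (monodromy n k).map (e ∘ (Polynomial.C : Polynomial (PolyXY n) → _)) := rfl
    rw [h1, hcomp, hM, laxProd_map]
    simp
  · ext a b : 2
    by_cases hab : a = b <;> simp [e, hab]

theorem specDet_eq_sum (k : ℕ) (lam z : ℝ) : specDet n k lam z =
    ∑ i ∈ Finset.range (bound n k), ∑ j ∈ Finset.range (bound n k),
      (z ^ i * lam ^ j) • I n k i j := by
  have h1 : (specPoly n k).natDegree < bound n k + 1 := by
    rw [Nat.lt_succ_iff, Polynomial.natDegree_le_iff_coeff_eq_zero]
    intro i hi
    ext j : 1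
    exact I_eq_zero n k i j (Or.inl hi.le)
  have h2 : ∀ i, ((specPoly n k).coeff i).natDegree < bound n k + 1 := by
    intro i
    rw [Nat.lt_succ_iff, Polynomial.natDegree_le_iff_coeff_eq_zero]
    intro j hj
    exact I_eq_zero n k i j (Or.inr hj.le)
  have hI : ∀ i j, ((specPoly n k).coeff i).coeff j = I n k i j := fun i j => rfl
  rw [specDet_eq_eval, Polynomial.eval_eq_sum_range' h1, Polynomial.eval_finsetSum,
    Finset.sum_range_succ]
  have hz : (specPoly n k).coeff (bound n k) = 0 := by
    ext j : 1
    exact I_eq_zero n k _ j (Or.inl le_rfl)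
  rw [hz, zero_mul, Polynomial.eval_zero, add_zero]
  refine Finset.sum_congr rfl fun i _ => ?_
  rw [Polynomial.eval_mul, Polynomial.eval_eq_sum_range' (h2 i), Finset.sum_range_succ, hI,
    I_eq_zero n k i _ (Or.inr le_rfl), zero_mul, add_zero, Finset.sum_mul]
  refine Finset.sum_congr rfl fun j _ => ?_
  rw [hI, Polynomial.eval_pow, Polynomial.eval_C, MvPolynomial.smul_eq_C_mul, map_mul, map_pow,
    map_pow]
  ring

/-- Pulling -z out of M - z leaves 1 - z⁻¹ M, so the quasi-period is ζ = z⁻¹. -/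
theorem specDet_eq_diffMatrix (k : ℕ) (hk : 2 ≤ k) (hkn : k ≤ n) (lam z : ℝ) (hz : z ≠ 0) :
    specDet n k lam z = MvPolynomial.C ((-z) ^ k) *
      (diffMatrix (k - 1) (xVar (n := n)) yVar (MvPolynomial.C lam) (MvPolynomial.C z⁻¹)).det := by
  rw [← det_one_sub_laxProd k hk hkn, specDet, map_pow]
  have : laxProd k (xVar (n := n)) yVar (MvPolynomial.C lam) n -
      (MvPolynomial.C z : PolyXY n) • (1 : Matrix (Fin k) (Fin k) (PolyXY n)) =
      (MvPolynomial.C (-z) : PolyXY n) • (1 - (MvPolynomial.C z⁻¹ : PolyXY n) •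
        laxProd k (xVar (n := n)) yVar (MvPolynomial.C lam) n) := by
    rw [smul_sub, smul_smul, ← map_mul, neg_mul, mul_inv_cancel₀ hz, map_neg, map_neg, map_one]
    simp only [neg_smul, one_smul]
    abel
  rw [this, Matrix.det_smul, Fintype.card_fin]

/-- The real values of `x`. -/
def xs (pt : Var n → ℝ) (i : ZMod n) : ℝ := pt (Sum.inl i)

/-- The real values of `y`. -/
def ys (pt : Var n → ℝ) (i : ZMod n) : ℝ := pt (Sum.inr i)

theorem eval_specDet (k : ℕ) (hk : 2 ≤ k) (hkn : k ≤ n) (lam z : ℝ) (hz : z ≠ 0) (pt : Var n → ℝ) :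
    MvPolynomial.eval pt (specDet n k lam z) =
      (-z) ^ k * (diffMatrix (k - 1) (xs pt) (ys pt) lam z⁻¹).det := by
  rw [specDet_eq_diffMatrix k hk hkn lam z hz, map_mul, MvPolynomial.eval_C, RingHom.map_det,
    RingHom.mapMatrix_apply, diffMatrix_map]
  simp only [xVar, yVar, MvPolynomial.eval_X, MvPolynomial.eval_C]
  rfl

theorem eval_specDet_eq_sum (k : ℕ) (lam z : ℝ) (pt : Var n → ℝ) :
    MvPolynomial.eval pt (specDet n k lam z) =
    ∑ i ∈ Finset.range (bound n k), ∑ j ∈ Finset.range (bound n k),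
      MvPolynomial.eval pt (I n k i j) * (z ^ i * lam ^ j) := by
  rw [specDet_eq_sum, map_sum]
  refine Finset.sum_congr rfl fun i _ => ?_
  rw [map_sum]
  refine Finset.sum_congr rfl fun j _ => ?_
  rw [MvPolynomial.smul_eval, mul_comm]

/-- If the determinants at two points agree, up to a rescaling of `λ`, then so do the integrals. -/
theorem eval_I_eq_of_det_eq (k : ℕ) (hk : 2 ≤ k) (hkn : k ≤ n) (pt pt' : Var n → ℝ) (t : ℝ)
    (h : ∀ lam ζ : ℝ, ζ ≠ 0 → ζ ≠ 1 → (diffMatrix (k - 1) (xs pt') (ys pt') lam ζ).det =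
      (diffMatrix (k - 1) (xs pt) (ys pt) (t * lam) ζ).det) (i j : ℕ) :
    MvPolynomial.eval pt' (I n k i j) = t ^ j * MvPolynomial.eval pt (I n k i j) := by
  by_cases hij : i < bound n k ∧ j < bound n k
  · rw [← sub_eq_zero]
    refine eq_zero_of_sum_sum_mul_pow (bound n k) (fun i j => MvPolynomial.eval pt' (I n k i j) -
      t ^ j * MvPolynomial.eval pt (I n k i j)) (fun _ => {0, 1}ᶜ)
      (fun _ => (Set.toFinite _).infinite_compl) (fun lam z hz => ?_) i j hij.1 hij.2
    have hz0 : z ≠ 0 := fun h => hz (by simp [h])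
    have hz1 : z ≠ 1 := fun h => hz (by simp [h])
    have e1 := eval_specDet k hk hkn lam z hz0 pt'
    have e2 := eval_specDet k hk hkn (t * lam) z hz0 pt
    rw [h lam z⁻¹ (inv_ne_zero hz0) (fun h => hz1 (inv_eq_one.mp h)), ← e2, eval_specDet_eq_sum,
      eval_specDet_eq_sum, ← sub_eq_zero, ← Finset.sum_sub_distrib] at e1
    rw [← e1]
    refine Finset.sum_congr rfl fun i _ => ?_
    rw [← Finset.sum_sub_distrib]
    refine Finset.sum_congr rfl fun j _ => ?_
    ring
  · have : I n k i j = 0 := I_eq_zero n k i j (by omega)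
    simp [this]

/-- In the difference operator λ occurs only as a factor of x and y, so scaling the point is the
same as scaling λ. In the Lax matrices themselves this is not visible. -/
theorem eval_I_smul (k : ℕ) (hk : 2 ≤ k) (hkn : k ≤ n) (pt : Var n → ℝ) (t : ℝ) (i j : ℕ) :
    MvPolynomial.eval (t • pt) (I n k i j) = t ^ j * MvPolynomial.eval pt (I n k i j) := by
  refine eval_I_eq_of_det_eq k hk hkn pt (t • pt) t (fun lam ζ _ _ => ?_) i j
  congr 1
  have h1 : diagonal (xs (t • pt)) = t • diagonal (xs pt) := by
    rw [← Matrix.diagonal_smul]; rfl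
  have h2 : diagonal (ys (t • pt)) = t • diagonal (ys pt) := by
    rw [← Matrix.diagonal_smul]; rfl
  rw [diffMatrix, diffMatrix, h1, h2, mul_smul_comm, ← smul_add, smul_mul_assoc, smul_smul,
    mul_comm t]

theorem eval_smul_of_isHomogeneous {u : PolyXY n} {d : ℕ} (hu : u.IsHomogeneous d) (t : ℝ)
    (pt : Var n → ℝ) : MvPolynomial.eval (t • pt) u = t ^ d * MvPolynomial.eval pt u := by
  rw [MvPolynomial.eval_eq', MvPolynomial.eval_eq', Finset.mul_sum]
  refine Finset.sum_congr rfl fun e he => ?_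
  have h1 := hu (MvPolynomial.mem_support_iff.mp he)
  have h2 : Finsupp.weight 1 e = e.degree := (Finsupp.degree_eq_weight_one (R := ℕ)).symm ▸ rfl
  rw [h2, Finsupp.degree_eq_sum] at h1
  simp only [Pi.smul_apply, smul_eq_mul, mul_pow, Finset.prod_mul_distrib]
  rw [Finset.prod_pow_eq_pow_sum, h1]
  ring

theorem isHomogeneous_of_eval_smul (u : PolyXY n) (d : ℕ)
    (h : ∀ (t : ℝ) pt, MvPolynomial.eval (t • pt) u = t ^ d * MvPolynomial.eval pt u) :
    u.IsHomogeneous d := by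
  have hc : ∀ e, e ≠ d → MvPolynomial.homogeneousComponent e u = 0 := by
    intro e he
    apply MvPolynomial.funext
    intro pt
    rw [map_zero]
    set B := max (u.totalDegree + 1) (max (d + 1) (e + 1)) with hB
    have hsum : ∀ q, MvPolynomial.eval q u = ∑ i ∈ Finset.range B,
        MvPolynomial.eval q (MvPolynomial.homogeneousComponent i u) := by
      intro q
      conv_lhs => rw [← MvPolynomial.sum_homogeneousComponent u]
      rw [map_sum]
      refine Finset.sum_subset (fun i hi => ?_) (fun i _ hi => ?_)
      · rw [Finset.mem_range] at hi ⊢; omega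
      · rw [Finset.mem_range] at hi
        rw [MvPolynomial.homogeneousComponent_eq_zero _ _ (by omega), map_zero]
    have := eq_zero_of_sum_range_mul_pow B (fun i =>
      MvPolynomial.eval pt (MvPolynomial.homogeneousComponent i u) -
        if i = d then MvPolynomial.eval pt u else 0) Set.univ Set.infinite_univ (fun t _ => ?_) e
        (by omega)
    · simpa [he] using this
    · have h1 := h t pt
      rw [hsum (t • pt)] at h1
      simp only [sub_mul, Finset.sum_sub_distrib, ite_mul, zero_mul]
      rw [Finset.sum_ite_eq' (Finset.range B) d, if_pos (Finset.mem_range.mpr (by omega)),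
        sub_eq_zero, mul_comm _ (t ^ d), ← h1]
      refine Finset.sum_congr rfl fun i _ => ?_
      rw [eval_smul_of_isHomogeneous (MvPolynomial.homogeneousComponent_isHomogeneous i u),
        mul_comm]
  have hu : u = MvPolynomial.homogeneousComponent d u := by
    conv_lhs => rw [← MvPolynomial.sum_homogeneousComponent u]
    refine Finset.sum_eq_single d (fun e _ he => hc e he) (fun hd => ?_)
    rw [Finset.mem_range] at hd
    exact MvPolynomial.homogeneousComponent_eq_zero _ _ (by omega)
  rw [hu]
  exact MvPolynomial.homogeneousComponent_isHomogeneous d u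

theorem I_isHomogeneous (k : ℕ) (hk : 2 ≤ k) (hkn : k ≤ n) (i j : ℕ) :
    (I n k i j).IsHomogeneous j :=
  isHomogeneous_of_eval_smul _ _ fun t pt => eval_I_smul k hk hkn pt t i j

end Spectral

/-! ### Derivatives of polynomials and of the spectral determinant -/

section Deriv

theorem hasFDerivAt_eval {σ : Type*} [Fintype σ] (F : MvPolynomial σ ℝ) (s : σ → ℝ) :
    HasFDerivAt (fun s : σ → ℝ => MvPolynomial.eval s F)
      (∑ v, MvPolynomial.eval s (MvPolynomial.pderiv v F) •
        (ContinuousLinearMap.proj v : (σ → ℝ) →L[ℝ] ℝ)) s := by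
  classical
  induction F using MvPolynomial.induction_on with
  | C a =>
    simp only [MvPolynomial.eval_C, MvPolynomial.pderiv_C, map_zero, zero_smul,
      Finset.sum_const_zero]
    exact hasFDerivAt_const a s
  | add p q hp hq =>
    simp only [map_add, add_smul, Finset.sum_add_distrib]
    exact hp.add hq
  | mul_X p i hp =>
    simp only [map_mul, MvPolynomial.eval_X]
    have h := hp.mul (ContinuousLinearMap.proj i : (σ → ℝ) →L[ℝ] ℝ).hasFDerivAt
    refine h.congr_fderiv ?_
    ext w
    simp [MvPolynomial.pderiv_X, Pi.single_apply, add_mul, Finset.sum_add_distrib,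
      Finset.mul_sum, apply_ite, ite_mul]
    ring_nf

theorem hasDerivAt_eval_add_smul {σ : Type*} [Fintype σ] (F : MvPolynomial σ ℝ) (s w : σ → ℝ) :
    HasDerivAt (fun t : ℝ => MvPolynomial.eval (s + t • w) F)
      (∑ v, w v * MvPolynomial.eval s (MvPolynomial.pderiv v F)) 0 := by
  have h1 : HasDerivAt (fun t : ℝ => s + t • w) w 0 := by
    simpa using ((hasDerivAt_id (0 : ℝ)).smul_const w).const_add s
  have hF := hasFDerivAt_eval F (s + (0 : ℝ) • w)
  refine (hF.comp_hasDerivAt (0 : ℝ) h1).congr_deriv ?_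
  simp [mul_comm]

/-- Meant for `Matrix.det_one_add_smul`, whose remainder has the form of a polynomial times t². -/
theorem sum_mul_pderiv_eq_of_expansion {σ : Type*} [Fintype σ] (F : MvPolynomial σ ℝ)
    (s w : σ → ℝ) (c : ℝ) (p : Polynomial ℝ)
    (h : ∀ t : ℝ, MvPolynomial.eval (s + t • w) F =
      MvPolynomial.eval s F + c * t + p.eval t * t ^ 2) :
    ∑ v, w v * MvPolynomial.eval s (MvPolynomial.pderiv v F) = c := by
  have h2 := hasDerivAt_eval_add_smul F s w
  have h3 : HasDerivAt (fun t : ℝ => MvPolynomial.eval s F + c * t + p.eval t * t ^ 2) c 0 := by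
    have := (((hasDerivAt_id (0 : ℝ)).const_mul c).const_add (MvPolynomial.eval s F)).add
      ((p.hasDerivAt 0).mul ((hasDerivAt_id (0 : ℝ)).pow 2))
    refine this.congr_deriv ?_
    simp
  simp only [h] at h2
  exact h2.unique h3

variable {n : ℕ} [NeZero n]

/-- The derivative of the difference operator in the direction `w`, up to the factor `-λ`. -/
def diffVariation (m : ℕ) (w : Var n → ℝ) (ζ : ℝ) : Matrix (ZMod n) (ZMod n) ℝ :=
  (diagonal (xs w) + shift n ζ * diagonal (ys w)) * shift n ζ ^ m

theorem diffMatrix_add_smul (m : ℕ) (pt w : Var n → ℝ) (t lam ζ : ℝ) :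
    diffMatrix m (xs (pt + t • w)) (ys (pt + t • w)) lam ζ =
      diffMatrix m (xs pt) (ys pt) lam ζ - (t * lam) • diffVariation m w ζ := by
  have h1 : diagonal (xs (pt + t • w)) = diagonal (xs pt) + t • diagonal (xs w) := by
    rw [← Matrix.diagonal_smul, Matrix.diagonal_add]; rfl
  have h2 : diagonal (ys (pt + t • w)) = diagonal (ys pt) + t • diagonal (ys w) := by
    rw [← Matrix.diagonal_smul, Matrix.diagonal_add]; rfl
  rw [diffMatrix, diffMatrix, diffVariation, h1, h2, mul_add, mul_smul_comm, mul_comm t lam,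
    mul_smul, sub_sub (1 - shift n ζ), ← smul_add]
  congr 2
  simp only [add_mul, smul_mul_assoc, smul_add]
  abel

theorem trace_mul_diffVariation (m : ℕ) (w : Var n → ℝ) (ζ : ℝ)
    (G : Matrix (ZMod n) (ZMod n) ℝ) :
    (G * diffVariation m w ζ).trace = ∑ i, xs w i * (shift n ζ ^ m * G) i i +
      ∑ i, ys w i * (shift n ζ ^ (m + 1) * G) (i + 1) (i + 1) := by
  rw [diffVariation, add_mul, mul_add, Matrix.trace_add]
  congr 1
  · rw [Matrix.trace_mul_comm, mul_assoc, Matrix.trace]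
    simp [Matrix.diagonal_mul]
  · rw [Matrix.trace_mul_comm, mul_assoc, mul_assoc, Matrix.trace_mul_comm, mul_assoc, mul_assoc,
      Matrix.trace]
    simp only [Matrix.diag_apply, Matrix.diagonal_mul]
    refine Finset.sum_congr rfl fun i _ => ?_
    rw [← mul_assoc, mul_shift_diag, ← mul_assoc, ← pow_succ']

/-- Jacobi's formula, from K - tλV = K (1 - tλ K⁻¹ V). -/
theorem sum_mul_pderiv_specDet (k : ℕ) (hk : 2 ≤ k) (hkn : k ≤ n) (lam z : ℝ) (hz : z ≠ 0)
    (pt w : Var n → ℝ) (hK : (diffMatrix (k - 1) (xs pt) (ys pt) lam z⁻¹).det ≠ 0) :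
    ∑ v, w v * MvPolynomial.eval pt (MvPolynomial.pderiv v (specDet n k lam z)) =
      MvPolynomial.eval pt (specDet n k lam z) * -(lam *
        ((diffMatrix (k - 1) (xs pt) (ys pt) lam z⁻¹)⁻¹ *
          diffVariation (k - 1) w z⁻¹).trace) := by
  set K := diffMatrix (k - 1) (xs pt) (ys pt) lam z⁻¹ with hKdef
  have hKu : IsUnit K.det := isUnit_iff_ne_zero.mpr hK
  set N := (-lam) • (K⁻¹ * diffVariation (k - 1) w z⁻¹) with hN
  obtain ⟨p, hp⟩ : ∃ p : Polynomial ℝ, ∀ t : ℝ,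
      (1 + t • N).det = 1 + N.trace * t + p.eval t * t ^ 2 :=
    ⟨_, fun t => Matrix.det_one_add_smul t N⟩
  refine sum_mul_pderiv_eq_of_expansion _ pt w _
    (Polynomial.C (MvPolynomial.eval pt (specDet n k lam z)) * p) (fun t => ?_)
  have e : diffMatrix (k - 1) (xs (pt + t • w)) (ys (pt + t • w)) lam z⁻¹ = K * (1 + t • N) := by
    rw [diffMatrix_add_smul, ← hKdef, mul_add, mul_one, hN, mul_smul_comm, mul_smul_comm,
      ← mul_assoc, Matrix.mul_nonsing_inv _ hKu, one_mul, smul_smul, sub_eq_add_neg, ← neg_smul]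
    congr 2
    ring
  have ht : N.trace = -(lam * (K⁻¹ * diffVariation (k - 1) w z⁻¹).trace) := by
    rw [hN, Matrix.trace_smul, smul_eq_mul]; ring
  rw [eval_specDet k hk hkn lam z hz, eval_specDet k hk hkn lam z hz, e, Matrix.det_mul, hp,
    Polynomial.eval_mul, Polynomial.eval_C, ← hKdef, ht]
  ring

/-- The logarithmic derivative `v ∂u/∂v` at the point `pt`. -/
def logDeriv (pt : Var n → ℝ) (v : Var n) : PolyXY n →ₗ[ℝ] ℝ :=
  pt v • ((MvPolynomial.aeval pt).toLinearMap ∘ₗ (MvPolynomial.pderiv v).toLinearMap)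

theorem logDeriv_apply (pt : Var n → ℝ) (v : Var n) (u : PolyXY n) :
    logDeriv pt v u = pt v * MvPolynomial.eval pt (MvPolynomial.pderiv v u) := by
  simp [logDeriv, MvPolynomial.aeval_eq_eval]

theorem logDeriv_eq_sum (pt : Var n → ℝ) (v : Var n) (u : PolyXY n) :
    logDeriv pt v u = ∑ v', Pi.single (M := fun _ => ℝ) v (pt v) v' *
      MvPolynomial.eval pt (MvPolynomial.pderiv v' u) := by
  rw [logDeriv_apply, Finset.sum_eq_single v]
  · simp
  · intro v' _ h; simp [Pi.single_eq_of_ne h]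
  · simp

theorem logDeriv_specDet_inl (k : ℕ) (hk : 2 ≤ k) (hkn : k ≤ n) (lam z : ℝ) (hz : z ≠ 0)
    (pt : Var n → ℝ) (hK : (diffMatrix (k - 1) (xs pt) (ys pt) lam z⁻¹).det ≠ 0) (i : ZMod n) :
    logDeriv pt (Sum.inl i) (specDet n k lam z) = -MvPolynomial.eval pt (specDet n k lam z) *
      (lam * xs pt i * green (k - 1) (xs pt) (ys pt) lam z⁻¹ (inv_ne_zero hz) (k - 1 : ℕ) i) := by
  rw [logDeriv_eq_sum, sum_mul_pderiv_specDet k hk hkn lam z hz pt _ hK, trace_mul_diffVariation,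
    Finset.sum_eq_single i, Finset.sum_eq_zero]
  · simp only [xs, Pi.single_eq_same, green, shiftUnit, zpow_natCast, Units.val_pow_eq_pow_val]
    ring
  · intro j _; simp [ys]
  · intro j _ h; simp [xs, h]
  · simp

theorem logDeriv_specDet_inr (k : ℕ) (hk : 2 ≤ k) (hkn : k ≤ n) (lam z : ℝ) (hz : z ≠ 0)
    (pt : Var n → ℝ) (hK : (diffMatrix (k - 1) (xs pt) (ys pt) lam z⁻¹).det ≠ 0) (i : ZMod n) :
    logDeriv pt (Sum.inr i) (specDet n k lam z) = -MvPolynomial.eval pt (specDet n k lam z) *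
      (lam * ys pt i * green (k - 1) (xs pt) (ys pt) lam z⁻¹ (inv_ne_zero hz)
        ((k - 1 : ℕ) + 1) (i + 1)) := by
  rw [logDeriv_eq_sum, sum_mul_pderiv_specDet k hk hkn lam z hz pt _ hK, trace_mul_diffVariation,
    add_comm, Finset.sum_eq_single i, Finset.sum_eq_zero (s := Finset.univ) (f := fun i => xs _ i * _)]
  · rw [green, ← Nat.cast_succ]
    simp only [ys, Pi.single_eq_same, shiftUnit, zpow_natCast, Units.val_pow_eq_pow_val]
    ring
  · intro j _; simp [xs]
  · intro j _ h; simp [ys, h]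
  · simp

theorem windowBracket_add_left {F : Type*} [Field F] (m : ℕ) (α β α₁ β₁ α' β' : ZMod n → F) :
    windowBracket m (α + α₁) (β + β₁) α' β' =
      windowBracket m α β α' β' + windowBracket m α₁ β₁ α' β' := by
  simp only [windowBracket, ← Finset.sum_add_distrib, Pi.add_apply]
  refine Finset.sum_congr rfl fun l _ => Finset.sum_congr rfl fun j _ => ?_
  ring

theorem windowBracket_smul_left {F : Type*} [Field F] (m : ℕ) (c : F) (α β α' β' : ZMod n → F) :
    windowBracket m (c • α) (c • β) α' β' = c * windowBracket m α β α' β' := by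
  simp only [windowBracket, Finset.mul_sum, Pi.smul_apply, smul_eq_mul]
  refine Finset.sum_congr rfl fun l _ => Finset.sum_congr rfl fun j _ => ?_
  ring

theorem windowBracket_swap {F : Type*} [Field F] (m : ℕ) (α β α' β' : ZMod n → F) :
    windowBracket m α' β' α β = -windowBracket m α β α' β' := by
  simp only [windowBracket, ← Finset.sum_neg_distrib]
  refine Finset.sum_congr rfl fun l _ => Finset.sum_congr rfl fun j _ => ?_
  ring

/-- The bracket of logarithmic gradients as a bilinear map on functions on the set of labels. -/
def gradBracket (n m : ℕ) [NeZero n] : (Var n → ℝ) →ₗ[ℝ] (Var n → ℝ) →ₗ[ℝ] ℝ :=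
  LinearMap.mk₂ ℝ (fun a b => windowBracket m (xs a) (ys a) (xs b) (ys b))
    (fun a a' b => windowBracket_add_left m (xs a) (ys a) (xs a') (ys a') (xs b) (ys b))
    (fun c a b => windowBracket_smul_left m c (xs a) (ys a) (xs b) (ys b))
    (fun a b b' => by
      rw [← neg_inj, ← windowBracket_swap, neg_add, ← windowBracket_swap, ← windowBracket_swap]
      exact windowBracket_add_left m (xs b) (ys b) (xs b') (ys b') (xs a) (ys a))
    (fun c a b => by
      rw [← neg_inj, ← windowBracket_swap, ← smul_neg, ← windowBracket_swap]
      exact windowBracket_smul_left m c (xs b) (ys b) (xs a) (ys a))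

theorem gradBracket_apply (m : ℕ) (a b : Var n → ℝ) :
    gradBracket n m a b = windowBracket m (xs a) (ys a) (xs b) (ys b) := rfl

/-- The logarithmic gradient at `pt`. -/
def logGrad (pt : Var n → ℝ) : PolyXY n →ₗ[ℝ] (Var n → ℝ) := LinearMap.pi (logDeriv pt)

theorem logGrad_apply (pt : Var n → ℝ) (u : PolyXY n) (v : Var n) :
    logGrad pt u v = pt v * MvPolynomial.eval pt (MvPolynomial.pderiv v u) := logDeriv_apply pt v u

theorem logGrad_specDet (k : ℕ) (lam z : ℝ) (pt : Var n → ℝ) : logGrad pt (specDet n k lam z) =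
    ∑ i ∈ Finset.range (bound n k), ∑ j ∈ Finset.range (bound n k),
      (z ^ i * lam ^ j) • logGrad pt (I n k i j) := by
  rw [specDet_eq_sum, map_sum]
  refine Finset.sum_congr rfl fun i _ => ?_
  rw [map_sum]
  exact Finset.sum_congr rfl fun j _ => map_smul _ _ _

theorem finite_eval_specDet_eq_zero (k : ℕ) (pt : Var n → ℝ) (lam : ℝ) :
    {z : ℝ | MvPolynomial.eval pt (specDet n k lam z) = 0}.Finite := by
  set M := laxProd k (xs pt) (ys pt) lam n with hM
  have h : ∀ z, MvPolynomial.eval pt (specDet n k lam z) = (-1) ^ k * M.charpoly.eval z := by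
    intro z
    have hdet := Matrix.det_neg (Matrix.scalar (Fin k) z - M)
    rw [Fintype.card_fin] at hdet
    rw [specDet, RingHom.map_det, Matrix.eval_charpoly, ← hdet]
    congr 1
    rw [map_sub, RingHom.mapMatrix_apply, laxProd_map, neg_sub, hM]
    simp only [xVar, yVar, MvPolynomial.eval_X, MvPolynomial.eval_C]
    congr 1
    ext a b
    by_cases hab : a = b <;> simp [hab]
  refine (M.charpoly.rootSet_finite ℝ).subset fun z hz => ?_
  rw [Set.mem_ofPred_eq, h] at hz
  rw [Polynomial.mem_rootSet]
  refine ⟨M.charpoly_monic.ne_zero, ?_⟩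
  simpa using hz

/-- Both logarithmic gradients are scalar multiples of the vectors built from Green's functions, so
`IsGreen.windowBracket_eq_zero` applies. The condition z ≠ z' is the condition ζ ≠ ζ' there. -/
theorem gradBracket_specDet (k : ℕ) (hk : 2 ≤ k) (hkn : k ≤ n) (pt : Var n → ℝ)
    (lam z lam' z' : ℝ) (hz : z ≠ 0) (hz' : z' ≠ 0) (hzz : z ≠ z')
    (h : MvPolynomial.eval pt (specDet n k lam z) ≠ 0)
    (h' : MvPolynomial.eval pt (specDet n k lam' z') ≠ 0) :
    gradBracket n (k - 1) (logGrad pt (specDet n k lam z)) (logGrad pt (specDet n k lam' z')) = 0 := by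
  have hK : ∀ lam z : ℝ, z ≠ 0 → MvPolynomial.eval pt (specDet n k lam z) ≠ 0 →
      (diffMatrix (k - 1) (xs pt) (ys pt) lam z⁻¹).det ≠ 0 := by
    intro lam z hz h
    rw [eval_specDet k hk hkn lam z hz] at h
    exact right_ne_zero_of_mul h
  have hg : ∀ lam z : ℝ, ∀ hz : z ≠ 0, MvPolynomial.eval pt (specDet n k lam z) ≠ 0 →
      logGrad pt (specDet n k lam z) = -MvPolynomial.eval pt (specDet n k lam z) • Sum.elim
        (fun i => lam * xs pt i * green (k - 1) (xs pt) (ys pt) lam z⁻¹ (inv_ne_zero hz) (k - 1 : ℕ) i)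
        (fun i => lam * ys pt i * green (k - 1) (xs pt) (ys pt) lam z⁻¹ (inv_ne_zero hz)
          ((k - 1 : ℕ) + 1) (i + 1)) := by
    intro lam z hz h
    funext v
    rcases v with i | i
    · exact logDeriv_specDet_inl k hk hkn lam z hz pt (hK lam z hz h) i
    · exact logDeriv_specDet_inr k hk hkn lam z hz pt (hK lam z hz h) i
  rw [hg lam z hz h, hg lam' z' hz' h', map_smul, map_smul, LinearMap.smul_apply,
    gradBracket_apply]
  have := (isGreen_green (k - 1) (xs pt) (ys pt) lam z⁻¹ (inv_ne_zero hz)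
    (hK lam z hz h)).windowBracket_eq_zero (isGreen_green (k - 1) (xs pt) (ys pt) lam' z'⁻¹
      (inv_ne_zero hz') (hK lam' z' hz' h')) (fun e => hzz (inv_injective e))
  erw [this]
  simp

/-- The bracket of two spectral determinants is a polynomial in λ, z, λ', z', and its coefficients
are extracted one pair at a time. Only finitely many z are excluded for each λ, so the identity for
generic values is enough, at every point of the (x, y)-space. -/
theorem gradBracket_I (k : ℕ) (hk : 2 ≤ k) (hkn : k ≤ n) (pt : Var n → ℝ) (i j i' j' : ℕ) :
    gradBracket n (k - 1) (logGrad pt (I n k i j)) (logGrad pt (I n k i' j')) = 0 := by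
  by_cases hij : i < bound n k ∧ j < bound n k
  swap
  · rw [I_eq_zero n k i j (by omega), map_zero, map_zero, LinearMap.zero_apply]
  by_cases hij' : i' < bound n k ∧ j' < bound n k
  swap
  · rw [I_eq_zero n k i' j' (by omega), map_zero, map_zero]
  have hinf : ∀ (lam : ℝ) (A : Set ℝ), A.Finite →
      {z : ℝ | z ≠ 0 ∧ MvPolynomial.eval pt (specDet n k lam z) ≠ 0 ∧ z ∉ A}.Infinite := by
    intro lam A hA
    refine (((Set.finite_singleton (0 : ℝ)).union
      (finite_eval_specDet_eq_zero k pt lam)).union hA).infinite_compl.mono ?_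
    intro z hz
    simp only [Set.mem_compl_iff, Set.mem_union, Set.mem_singleton_iff, Set.mem_ofPred_eq,
      not_or] at hz
    exact ⟨hz.1.1, hz.1.2, hz.2⟩
  have step : ∀ lam z : ℝ, z ≠ 0 → MvPolynomial.eval pt (specDet n k lam z) ≠ 0 →
      gradBracket n (k - 1) (logGrad pt (specDet n k lam z)) (logGrad pt (I n k i' j')) = 0 := by
    intro lam z hz h
    refine eq_zero_of_sum_sum_mul_pow (bound n k)
      (fun i' j' => gradBracket n (k - 1) (logGrad pt (specDet n k lam z)) (logGrad pt (I n k i' j')))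
      (fun lam' => _) (fun lam' => hinf lam' {z} (Set.finite_singleton z))
      (fun lam' z' hz' => ?_) i' j' hij'.1 hij'.2
    rw [← gradBracket_specDet k hk hkn pt lam z lam' z' hz hz'.1 (fun e => hz'.2.2 e.symm) h hz'.2.1,
      logGrad_specDet k lam' z', map_sum]
    refine Finset.sum_congr rfl fun a _ => ?_
    rw [map_sum]
    refine Finset.sum_congr rfl fun b _ => ?_
    rw [map_smul, smul_eq_mul, mul_comm]
  refine eq_zero_of_sum_sum_mul_pow (bound n k)
      (fun i j => gradBracket n (k - 1) (logGrad pt (I n k i j)) (logGrad pt (I n k i' j')))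
      (fun lam => _) (fun lam => hinf lam ∅ Set.finite_empty)
      (fun lam z hz => ?_) i j hij.1 hij.2
  rw [← step lam z hz.1 hz.2.1, logGrad_specDet k lam z, map_sum, LinearMap.sum_apply]
  refine Finset.sum_congr rfl fun a _ => ?_
  rw [map_sum, LinearMap.sum_apply]
  refine Finset.sum_congr rfl fun b _ => ?_
  rw [map_smul, LinearMap.smul_apply, smul_eq_mul, mul_comm]

end Deriv

/-! ### Independence of the integrals -/

section Resolvent

/-- The traces are the Taylor coefficients of the resolvent trace at λ = 0. Using the adjugate keeps
the functions continuous everywhere. By the recursion f_a = det(1 - λZ) tr(Z^a X) + λ f_{a+1},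
vanishing of f_a near 0 gives the trace at λ = 0, and then f_{a+1} vanishes for small λ ≠ 0. -/
theorem trace_pow_mul_eq_zero {ι : Type*} [Fintype ι] [DecidableEq ι] (Z X : Matrix ι ι ℝ)
    (h : ∀ lam : ℝ, lam ≠ 0 → (1 - lam • Z).det ≠ 0 → ((1 - lam • Z)⁻¹ * X).trace = 0) (a : ℕ) :
    (Z ^ a * X).trace = 0 := by
  set f : ℕ → ℝ → ℝ := fun a lam => ((1 - lam • Z).adjugate * (Z ^ a * X)).trace with hf
  have hcont : Continuous fun lam : ℝ => 1 - lam • Z := by fun_prop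
  have hfc : ∀ a, Continuous (f a) := fun a =>
    (hcont.matrix_adjugate.matrix_mul continuous_const).matrix_trace
  have hstep : ∀ a lam, f a lam = (1 - lam • Z).det * (Z ^ a * X).trace + lam * f (a + 1) lam := by
    intro a lam
    have e : Z ^ a * X = (1 - lam • Z) * (Z ^ a * X) + lam • (Z ^ (a + 1) * X) := by
      rw [sub_mul, one_mul, smul_mul_assoc, ← mul_assoc Z, ← pow_succ', sub_add_cancel]
    simp only [hf]
    conv_lhs => rw [e]
    rw [mul_add, ← mul_assoc, Matrix.adjugate_mul, Matrix.trace_add, mul_smul_comm,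
      Matrix.trace_smul, smul_mul_assoc, one_mul, Matrix.trace_smul, smul_eq_mul, smul_eq_mul]
  have hzero : ∀ a, (∀ᶠ lam in 𝓝[≠] (0 : ℝ), f a lam = 0) → (Z ^ a * X).trace = 0 := by
    intro a ha
    have h1 : Tendsto (f a) (𝓝[≠] 0) (𝓝 (f a 0)) := (hfc a).continuousAt.continuousWithinAt
    have h2 : Tendsto (f a) (𝓝[≠] 0) (𝓝 0) := tendsto_const_nhds.congr' (ha.mono fun _ h => h.symm)
    have h3 := tendsto_nhds_unique h1 h2
    rw [hstep] at h3
    simpa using h3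
  refine hzero a ?_
  induction a with
  | zero =>
    have hd : Tendsto (fun lam : ℝ => (1 - lam • Z).det) (𝓝[≠] 0) (𝓝 (1 - (0 : ℝ) • Z).det) :=
      hcont.matrix_det.continuousAt.continuousWithinAt
    have hd1 : (1 - (0 : ℝ) • Z).det ≠ 0 := by simp
    filter_upwards [hd.eventually_ne hd1, self_mem_nhdsWithin] with lam hlam h0
    have := h lam h0 hlam
    rw [Matrix.inv_def, smul_mul_assoc, Matrix.trace_smul, smul_eq_mul] at this
    simp only [hf, pow_zero, one_mul]
    refine (mul_eq_zero.mp this).resolve_left ?_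
    rw [Ring.inverse_eq_inv']
    exact inv_ne_zero hlam
  | succ a ih =>
    filter_upwards [ih, self_mem_nhdsWithin] with lam hlam h0
    rw [hstep, hzero a ih, mul_zero, zero_add] at hlam
    exact (mul_eq_zero.mp hlam).resolve_left h0

variable {n : ℕ} [NeZero n]

theorem shift_pow_mul_pow {R : Type*} [CommRing R] (ζ : R) (m a : ℕ) (d : ZMod n → R) :
    shift n ζ ^ m * (diagonal d * shift n ζ ^ m) ^ a =
      diagonal (fun i => ∏ s ∈ Finset.range a, d (i - m * (s + 1))) * shift n ζ ^ (m * (a + 1)) := by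
  induction a with
  | zero => simp
  | succ a ih =>
    rw [pow_succ, ← mul_assoc, ih, mul_assoc, ← mul_assoc (shift n ζ ^ _), shift_pow_mul_diagonal,
      mul_assoc, ← pow_add, ← mul_assoc, Matrix.diagonal_mul_diagonal]
    congr 2
    funext i
    rw [Finset.prod_range_succ]
    push_cast
    rfl

theorem trace_pow_mul_mul {R : Type*} [CommRing R] (ζ : R) (m a : ℕ) (d e : ZMod n → R)
    (G : Matrix (ZMod n) (ZMod n) R) :
    ((diagonal d * shift n ζ ^ m) ^ a * (G * diagonal e * shift n ζ ^ m)).trace =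
      ∑ i : ZMod n, (∏ s ∈ Finset.range a, d (i - m * (s + 1))) * e i *
        (shift n ζ ^ (m * (a + 1)) * G) i i := by
  rw [← mul_assoc, Matrix.trace_mul_comm, ← mul_assoc, ← mul_assoc, shift_pow_mul_pow, mul_assoc,
    mul_assoc, Matrix.trace]
  refine Finset.sum_congr rfl fun i _ => ?_
  rw [Matrix.diag_apply, Matrix.diagonal_mul, ← mul_assoc, Matrix.mul_diagonal]
  ring

theorem shift_pow_diag {R : Type*} [CommRing R] (ζ : R) (b : ℕ) (h0 : 0 < b) (hb : b < n)
    (i : ZMod n) : (shift n ζ ^ b) i i = 0 := by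
  obtain ⟨t, rfl⟩ := (timeEquiv n).surjective i
  rw [shift_pow_timeEquiv ζ b hb.le, if_neg (by omega), if_neg (by omega)]
  simp

theorem inv_one_sub_shift (ζ : ℝ) (hζ : ζ ≠ 1) : (1 - shift n ζ)⁻¹ =
    (1 - ζ)⁻¹ • ∑ l ∈ Finset.range n, shift n ζ ^ l :=
  Matrix.inv_eq_right_inv (one_sub_shift_mul_sum ζ hζ)

theorem inv_one_sub_shift_diag (ζ : ℝ) (hζ : ζ ≠ 1) (i : ZMod n) :
    ((1 - shift n ζ)⁻¹) i i = (1 - ζ)⁻¹ := by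
  rw [inv_one_sub_shift ζ hζ, Matrix.smul_apply, Matrix.sum_apply, Finset.sum_eq_single 0]
  · simp
  · intro l hl h
    exact shift_pow_diag ζ l (Nat.pos_of_ne_zero h) (Finset.mem_range.mp hl) i
  · intro h; exact absurd (Finset.mem_range.mpr (NeZero.pos n)) h

/-- In the geometric series only l = n - b returns to the diagonal, contributing T^n = ζ. -/
theorem shift_pow_mul_inv_one_sub_shift_diag (ζ : ℝ) (hζ : ζ ≠ 1) (b : ℕ) (h0 : 0 < b) (hb : b < n)
    (i : ZMod n) : (shift n ζ ^ b * (1 - shift n ζ)⁻¹) i i = (1 - ζ)⁻¹ * ζ := by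
  rw [inv_one_sub_shift ζ hζ, mul_smul_comm, Matrix.smul_apply, Finset.mul_sum, Matrix.sum_apply,
    Finset.sum_eq_single (n - b)]
  · rw [← pow_add, Nat.add_sub_cancel' hb.le, shift_pow_self]
    simp
  · intro l hl h
    rw [Finset.mem_range] at hl
    rw [← pow_add]
    rcases Nat.lt_or_ge (b + l) n with h' | h'
    · exact shift_pow_diag ζ _ (by omega) h' i
    · obtain ⟨c, hc⟩ := Nat.exists_eq_add_of_le h'
      rw [hc, pow_add, shift_pow_self, smul_mul_assoc, one_mul, Matrix.smul_apply,
        shift_pow_diag ζ c (by omega) (by omega), smul_zero]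
  · intro h; exact absurd (Finset.mem_range.mpr (by omega)) h

/-- Separation of the powers of the two-term operator by the quasi-period. -/
theorem sum_eq_zero_of_trace_eq_zero (m a : ℕ) (d e v : ZMod n → ℝ)
    (h : ∀ ζ : ℝ, ζ ≠ 0 → ζ ≠ 1 → ((diagonal d * shift n ζ ^ m) ^ a *
      ((1 - shift n ζ)⁻¹ * diagonal e * shift n ζ ^ m - 1 * diagonal v * shift n ζ ^ m)).trace = 0) :
    ∑ i : ZMod n, (∏ s ∈ Finset.range a, d (i - m * (s + 1))) * e i = 0 ∧
      (n ∣ m * (a + 1) → ∑ i : ZMod n, (∏ s ∈ Finset.range a, d (i - m * (s + 1))) * v i = 0) := by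
  set q := m * (a + 1) / n
  set b := m * (a + 1) % n with hb
  have hM : m * (a + 1) = n * q + b := (Nat.div_add_mod _ _).symm
  have hbn : b < n := Nat.mod_lt _ (NeZero.pos n)
  have hp : ∀ (ζ : ℝ), ζ ≠ 0 → ζ ≠ 1 →
      ∑ i : ZMod n, (∏ s ∈ Finset.range a, d (i - m * (s + 1))) * e i *
        (shift n ζ ^ b * (1 - shift n ζ)⁻¹) i i =
      ∑ i : ZMod n, (∏ s ∈ Finset.range a, d (i - m * (s + 1))) * v i * (shift n ζ ^ b) i i := by
    intro ζ h0 h1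
    have := h ζ h0 h1
    rw [mul_sub, Matrix.trace_sub, trace_pow_mul_mul, trace_pow_mul_mul, hM, pow_add, pow_mul,
      shift_pow_self, smul_pow, one_pow, smul_mul_assoc, one_mul, smul_mul_assoc, mul_one,
      sub_eq_zero] at this
    simp only [Matrix.smul_apply, smul_eq_mul, mul_left_comm _ (ζ ^ q), ← Finset.mul_sum] at this
    exact mul_left_cancel₀ (pow_ne_zero q h0) this
  -- Write E and V for the sums with e and v. If T^{m(a+1)} is a scalar, the relation reads E / (1 -
  -- ζ) = V, and ζ = 2, 3 force E = V = 0. Otherwise T^b has zero diagonal, the term with v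
  -- disappears, and one value of ζ gives E = 0.
  rcases Nat.eq_zero_or_pos b with hb0 | hb0
  · simp only [hb0, pow_zero, one_mul, Matrix.one_apply_eq, mul_one] at hp
    have h2 := hp 2 (by norm_num) (by norm_num)
    have h3 := hp 3 (by norm_num) (by norm_num)
    simp only [inv_one_sub_shift_diag (n := n) 2 (by norm_num),
      inv_one_sub_shift_diag (n := n) 3 (by norm_num), ← Finset.sum_mul] at h2 h3
    norm_num at h2 h3
    exact ⟨by linarith, fun _ => by linarith⟩
  · refine ⟨?_, fun hdvd => absurd (Nat.mod_eq_zero_of_dvd hdvd) hb0.ne'⟩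
    have h2 := hp 2 (by norm_num) (by norm_num)
    simp only [shift_pow_mul_inv_one_sub_shift_diag (n := n) 2 (by norm_num) b hb0 hbn,
      shift_pow_diag (n := n) (2 : ℝ) b hb0 hbn, ← Finset.sum_mul, mul_zero,
      Finset.sum_const_zero] at h2
    norm_num at h2
    exact h2

/-- All power moments vanish, hence so do all polynomial ones; take a polynomial that vanishes at
every value of μ except c. -/
theorem sum_fiber_eq_zero {ι : Type*} [Fintype ι] (μ w : ι → ℝ)
    (h : ∀ q : ℕ, ∑ i, μ i ^ q * w i = 0) (c : ℝ) : ∑ i, (if μ i = c then w i else 0) = 0 := by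
  classical
  have hQ : ∀ Q : Polynomial ℝ, ∑ i, Q.eval (μ i) * w i = 0 := by
    intro Q
    simp only [Polynomial.eval_eq_sum_range, Finset.sum_mul]
    rw [Finset.sum_comm]
    refine Finset.sum_eq_zero fun q _ => ?_
    simp only [mul_assoc, ← Finset.mul_sum, h, mul_zero]
  set A := (Finset.univ.image μ).erase c
  set Q : Polynomial ℝ := ∏ t ∈ A, (Polynomial.X - Polynomial.C t)
  have hc : Q.eval c ≠ 0 := by
    rw [Polynomial.eval_prod, Finset.prod_ne_zero_iff]
    intro t ht
    simpa using sub_ne_zero.mpr (Finset.ne_of_mem_erase ht).symm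
  have := hQ Q
  refine mul_left_cancel₀ hc ?_
  rw [mul_zero]
  refine Eq.trans ?_ this
  rw [Finset.mul_sum]
  refine Finset.sum_congr rfl fun i _ => ?_
  by_cases hi : μ i = c
  · rw [if_pos hi, hi]
  · rw [if_neg hi, mul_zero, Polynomial.eval_prod, Finset.prod_eq_zero (i := μ i)]
    · simp
    · exact Finset.mem_erase.mpr ⟨hi, Finset.mem_image_of_mem _ (Finset.mem_univ i)⟩
    · simp

end Resolvent

/-! ### A point with y = -x at which the gradients of the integrals are counted. -/

section Special

variable {n : ℕ} [NeZero n]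

instance neZero_gcd (m : ℕ) : NeZero (n.gcd m) :=
  ⟨(Nat.gcd_pos_of_pos_left _ (NeZero.pos n)).ne'⟩

/-- The class of an index modulo `gcd(n, m)`. -/
def cls (m : ℕ) : ZMod n →+* ZMod (n.gcd m) := ZMod.castHom (Nat.gcd_dvd_left n m) _

/-- The standard representative of a class modulo `gcd(n, m)`. -/
def rep (m : ℕ) (c : ZMod (n.gcd m)) : ZMod n := (c.val : ZMod n)

theorem cls_rep (m : ℕ) (c : ZMod (n.gcd m)) : cls m (rep m c) = c := by
  rw [cls, rep, map_natCast, ZMod.natCast_zmod_val]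

theorem cls_natCast (m : ℕ) : cls m (m : ZMod n) = 0 := by
  rw [cls, map_natCast]
  exact (ZMod.natCast_eq_zero_iff _ _).mpr (Nat.gcd_dvd_right n m)

/-- Bézout: modulo n, gcd(n, m) is a multiple of m. So the orbits of steps of length m are exactly
the classes modulo gcd(n, m). -/
theorem exists_eq_mul_of_cls_eq_zero (m : ℕ) (t : ZMod n) (h : cls m t = 0) :
    ∃ s : ℕ, t = m * s := by
  have h1 : ((t.val : ℕ) : ZMod (n.gcd m)) = 0 := by
    rw [← h, ← map_natCast (cls (n := n) m), ZMod.natCast_zmod_val]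
  obtain ⟨q, hq⟩ := (ZMod.natCast_eq_zero_iff _ _).mp h1
  refine ⟨((n.gcdB m * q : ℤ) : ZMod n).val, ?_⟩
  rw [ZMod.natCast_zmod_val]
  have h2 := Nat.gcd_eq_gcd_ab n m
  have h3 : ((n.gcd m : ℕ) : ZMod n) = m * (n.gcdB m : ZMod n) := by
    have := congrArg (fun z : ℤ => (z : ZMod n)) h2
    simpa using this
  rw [← ZMod.natCast_zmod_val t, hq]
  push_cast
  rw [h3]
  ring

/-- The values of `x` at the special point. -/
def specialValue (m : ℕ) (i : ZMod n) : ℝ :=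
  if i = rep m (cls m i) then (cls m i).val + 2 else 1

theorem specialValue_pos (m : ℕ) (i : ZMod n) : 0 < specialValue m i := by
  rw [specialValue]; split_ifs <;> positivity

/-- The number of returns to a given index in `n` steps of length `m`. -/
def returns (n m : ℕ) : ℕ := ((Finset.range n).filter fun s => ((m * s : ℕ) : ZMod n) = 0).card

theorem returns_ne_zero (m : ℕ) : returns n m ≠ 0 := by
  rw [returns]
  exact Finset.card_ne_zero_of_mem (a := 0) (by simp [NeZero.pos n])

theorem cls_sub_mul (m : ℕ) (i s : ZMod n) : cls m (i - (m : ZMod n) * s) = cls m i := by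
  rw [map_sub, map_mul, cls_natCast, zero_mul, sub_zero]

/-- The product over n steps does not depend on the starting point in an orbit. From the
representative, only the returns to it contribute a factor other than 1. The values c + 2 make these
products differ from orbit to orbit (`period_injective`). -/
theorem prod_specialValue_period (m : ℕ) (i : ZMod n) :
    ∏ s ∈ Finset.range n, specialValue m (i - (m : ZMod n) * (s : ZMod n)) = ((cls m i).val + 2 : ℝ) ^ returns n m := by
  have hstep : ∀ i : ZMod n, ∏ s ∈ Finset.range n, specialValue m (i - (m : ZMod n) - (m : ZMod n) * (s : ZMod n)) =
      ∏ s ∈ Finset.range n, specialValue m (i - (m : ZMod n) * (s : ZMod n)) := by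
    intro i
    have h1 := Finset.prod_range_succ (fun s : ℕ => specialValue m (i - (m : ZMod n) * (s : ZMod n))) n
    rw [Finset.prod_range_succ'] at h1
    rw [CharP.cast_eq_zero (ZMod n) n, Nat.cast_zero] at h1
    rw [← mul_left_inj' (specialValue_pos m (i - (m : ZMod n) * 0)).ne', ← h1]
    congr 1
    refine Finset.prod_congr rfl fun s _ => ?_
    congr 1
    push_cast; ring
  have hsteps : ∀ (s : ℕ) (i : ZMod n), ∏ t ∈ Finset.range n, specialValue m (i - (m : ZMod n) * (s : ZMod n) - (m : ZMod n) * (t : ZMod n)) =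
      ∏ t ∈ Finset.range n, specialValue m (i - (m : ZMod n) * (t : ZMod n)) := by
    intro s
    induction s with
    | zero => intro i; simp
    | succ s ih =>
      intro i
      rw [← ih i, ← hstep (i - (m : ZMod n) * (s : ZMod n))]
      refine Finset.prod_congr rfl fun t _ => ?_
      congr 1
      push_cast; ring1
  obtain ⟨s, hs⟩ := exists_eq_mul_of_cls_eq_zero m (i - rep m (cls m i)) (by
    rw [map_sub, cls_rep, sub_self])
  rw [← hsteps s i, ← hs, sub_sub_cancel, returns, ← Finset.prod_const, Finset.prod_filter]
  refine Finset.prod_congr rfl fun t _ => ?_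
  simp only [specialValue, cls_sub_mul, cls_rep, sub_eq_self, Nat.cast_mul]

/-- The products of consecutive values in steps of length `m`. -/
def stepProd (m a : ℕ) (i : ZMod n) : ℝ :=
  ∏ s ∈ Finset.range a, specialValue m (i - (m : ZMod n) * ((s : ZMod n) + 1))

theorem stepProd_pos (m a : ℕ) (i : ZMod n) : 0 < stepProd m a i :=
  Finset.prod_pos fun _ _ => specialValue_pos m _

theorem stepProd_add_mul (m a q : ℕ) (i : ZMod n) : stepProd m (a + n * q) i =
    (((cls m i).val + 2 : ℝ) ^ returns n m) ^ q * stepProd m a i := by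
  induction q with
  | zero => simp
  | succ q ih =>
    rw [pow_succ, mul_right_comm, ← ih, ← cls_sub_mul m i (((a + n * q : ℕ) : ZMod n) + 1),
      ← prod_specialValue_period, stepProd, stepProd, Nat.mul_succ, ← add_assoc,
      Finset.prod_range_add]
    congr 1
    refine Finset.prod_congr rfl fun s _ => ?_
    congr 1
    push_cast; ring

theorem period_injective (m : ℕ) (c c' : ZMod (n.gcd m))
    (h : ((c.val : ℝ) + 2) ^ returns n m = ((c'.val : ℝ) + 2) ^ returns n m) : c = c' := by
  have := (pow_left_inj₀ (by positivity) (by positivity) (returns_ne_zero (n := n) m)).mp h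
  apply ZMod.val_injective
  exact_mod_cast add_right_cancel this

/-- Each further round of n steps multiplies the terms of a class by a factor proper to that class,
so letting q vary separates the classes. -/
theorem sum_class_eq_zero (m a : ℕ) (e : ZMod n → ℝ)
    (h : ∀ q, ∑ i, stepProd m (a + n * q) i * e i = 0) (c : ZMod (n.gcd m)) :
    ∑ i, (if cls m i = c then stepProd m a i * e i else 0) = 0 := by
  have := sum_fiber_eq_zero (fun i => ((cls m i).val + 2 : ℝ) ^ returns n m)
    (fun i => stepProd m a i * e i) (fun q => by
      rw [← h q]
      refine Finset.sum_congr rfl fun i _ => ?_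
      rw [stepProd_add_mul, mul_assoc]) ((c.val + 2 : ℝ) ^ returns n m)
  refine Eq.trans ?_ this
  refine Finset.sum_congr rfl fun i _ => ?_
  by_cases hi : cls m i = c
  · rw [if_pos hi, if_pos (by rw [hi])]
  · rw [if_neg hi, if_neg (fun h => hi (period_injective m _ _ h))]

/-- Within the class c the step products of lengths a and a + 1 differ only at the index lying a + 1
steps beyond the representative, where the additional factor is c + 2 instead of 1. The difference
of the two class sums isolates e at that index, and all indices arise in this way. -/
theorem eq_zero_of_sum_stepProd (m : ℕ) (e : ZMod n → ℝ)
    (h : ∀ a, ∑ i, stepProd m a i * e i = 0) : e = 0 := by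
  have key : ∀ (c : ZMod (n.gcd m)) (a : ℕ), e (rep m c + (m : ZMod n) * (a + 1)) = 0 := by
    intro c a
    have h1 := sum_class_eq_zero m a e (fun q => h _) c
    have h2 := sum_class_eq_zero m (a + 1) e (fun q => h _) c
    have h3 := sub_eq_zero.mpr (h2.trans h1.symm)
    rw [← Finset.sum_sub_distrib, Finset.sum_eq_single (rep m c + (m : ZMod n) * (a + 1))] at h3
    · have hc : cls m (rep m c + (m : ZMod n) * ((a : ZMod n) + 1)) = c := by
        rw [map_add, map_mul, cls_natCast, zero_mul, add_zero, cls_rep]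
      rw [if_pos hc, if_pos hc, stepProd, Finset.prod_range_succ, ← stepProd, add_sub_cancel_right,
        specialValue, cls_rep, if_pos rfl] at h3
      have h4 : stepProd m a (rep m c + (m : ZMod n) * ((a : ZMod n) + 1)) * ((c.val : ℝ) + 1) *
          e (rep m c + (m : ZMod n) * ((a : ZMod n) + 1)) = 0 := by linear_combination h3
      refine (mul_eq_zero.mp h4).resolve_left (mul_pos (stepProd_pos m a _) (by positivity)).ne'
    · intro i _ hi
      by_cases hc : cls m i = c
      · rw [if_pos hc, if_pos hc, stepProd, Finset.prod_range_succ, ← stepProd, specialValue,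
          cls_sub_mul, if_neg, mul_one, sub_self]
        rw [hc]
        exact fun h => hi (sub_eq_iff_eq_add.mp h)
      · rw [if_neg hc, if_neg hc, sub_zero]
    · intro h; exact absurd (Finset.mem_univ _) h
  funext i
  obtain ⟨s, hs⟩ := exists_eq_mul_of_cls_eq_zero m (i - (m : ZMod n) - rep m (cls m i)) (by
    rw [map_sub, cls_rep, map_sub, cls_natCast, sub_zero, sub_self])
  have := key (cls m i) s
  rw [mul_add, ← hs] at this
  rw [Pi.zero_apply, ← this]
  congr 1
  ring

/-- The special point of the `(x, y)`-space. -/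
def specialPoint (m : ℕ) : Var n → ℝ := Sum.elim (specialValue m) (fun i => -specialValue m i)

theorem diffMatrix_specialPoint (m : ℕ) (lam ζ : ℝ) :
    diffMatrix m (xs (specialPoint (n := n) m)) (ys (specialPoint m)) lam ζ =
      (1 - shift n ζ) * (1 - lam • (diagonal (specialValue m) * shift n ζ ^ m)) := by
  have h1 : xs (specialPoint (n := n) m) = specialValue m := rfl
  have h2 : diagonal (ys (specialPoint (n := n) m)) = -diagonal (specialValue m) := by
    rw [Matrix.diagonal_neg]; rfl
  rw [diffMatrix, h1, h2, mul_sub, mul_one, mul_smul_comm, ← mul_assoc, sub_mul (1 : Matrix _ _ ℝ),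
    one_mul, mul_neg, sub_eq_add_neg (diagonal (specialValue m))]

/-- The gradient at `pt`. -/
def grad (pt : Var n → ℝ) : PolyXY n →ₗ[ℝ] (Var n → ℝ) := LinearMap.pi fun v =>
  (MvPolynomial.aeval pt).toLinearMap ∘ₗ (MvPolynomial.pderiv v).toLinearMap

theorem grad_apply (pt : Var n → ℝ) (u : PolyXY n) (v : Var n) :
    grad pt u v = MvPolynomial.eval pt (MvPolynomial.pderiv v u) := by
  simp [grad, MvPolynomial.aeval_eq_eval]

theorem dotProduct_grad_specDet_eq_zero (k : ℕ) (pt w : Var n → ℝ)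
    (h : ∀ i j, w ⬝ᵥ grad pt (I n k i j) = 0) (lam z : ℝ) :
    w ⬝ᵥ grad pt (specDet n k lam z) = 0 := by
  rw [specDet_eq_sum, map_sum, dotProduct_sum]
  refine Finset.sum_eq_zero fun i _ => ?_
  rw [map_sum, dotProduct_sum]
  refine Finset.sum_eq_zero fun j _ => ?_
  rw [map_smul, dotProduct_smul, h, smul_zero]

/-- Here K = P N with P = 1 - T and N = 1 - λ X T^m, so a direction w that kills all integrals
satisfies tr(N⁻¹ P⁻¹ V) = 0, with V the variation along w. The identity P⁻¹ V = P⁻¹ (w_x + w_y) T^m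
- w_y T^m separates w_x + w_y from w_y. The first is seen by every power of X T^m, the second only
by those in which T^{m(a+1)} is a scalar. -/
theorem kernel_grad_specialPoint (k : ℕ) (hk : 2 ≤ k) (hkn : k ≤ n) (w : Var n → ℝ)
    (h : ∀ i j, w ⬝ᵥ grad (specialPoint (k - 1)) (I n k i j) = 0) :
    xs w + ys w = 0 ∧ ∀ c : ZMod (n.gcd (k - 1)),
      ∑ i, (if cls (k - 1) i = c then stepProd (k - 1) (n - 1) i * ys w i else 0) = 0 := by
  set m := k - 1
  have htr : ∀ ζ : ℝ, ζ ≠ 0 → ζ ≠ 1 → ∀ lam : ℝ, lam ≠ 0 →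
      (1 - lam • (diagonal (specialValue m) * shift n ζ ^ m)).det ≠ 0 →
      ((1 - lam • (diagonal (specialValue m) * shift n ζ ^ m))⁻¹ *
        ((1 - shift n ζ)⁻¹ * diagonal (xs w + ys w) * shift n ζ ^ m -
          1 * diagonal (ys w) * shift n ζ ^ m)).trace = 0 := by
    intro ζ h0 h1 lam hlam hdet
    set P := 1 - shift n ζ with hP
    set N := 1 - lam • (diagonal (specialValue m) * shift n ζ ^ m)
    have hPu : IsUnit P.det := isUnit_det_one_sub_shift ζ h1
    have hK : diffMatrix (k - 1) (xs (specialPoint (n := n) (k - 1))) (ys (specialPoint (k - 1)))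
        lam ζ⁻¹⁻¹ = P * N := by rw [inv_inv, diffMatrix_specialPoint]
    have hKdet : (P * N).det ≠ 0 := by
      rw [Matrix.det_mul]; exact mul_ne_zero hPu.ne_zero hdet
    have hF : MvPolynomial.eval (specialPoint m) (specDet n k lam ζ⁻¹) ≠ 0 := by
      rw [eval_specDet k hk hkn lam _ (inv_ne_zero h0), hK]
      exact mul_ne_zero (pow_ne_zero _ (neg_ne_zero.mpr (inv_ne_zero h0))) hKdet
    have h2 := sum_mul_pderiv_specDet k hk hkn lam ζ⁻¹ (inv_ne_zero h0) (specialPoint m) w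
      (by rw [hK]; exact hKdet)
    have h3 := dotProduct_grad_specDet_eq_zero k _ w h lam ζ⁻¹
    simp only [dotProduct, grad_apply] at h3
    rw [h3, eq_comm, mul_eq_zero, or_iff_right hF, neg_eq_zero, mul_eq_zero, or_iff_right hlam, hK,
      inv_inv, Matrix.mul_inv_rev, mul_assoc] at h2
    have h4 : P⁻¹ * diffVariation (k - 1) w ζ =
        P⁻¹ * diagonal (xs w + ys w) * shift n ζ ^ m - 1 * diagonal (ys w) * shift n ζ ^ m := by
      have : diffVariation (k - 1) w ζ =
          diagonal (xs w + ys w) * shift n ζ ^ m - P * diagonal (ys w) * shift n ζ ^ m := by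
        rw [diffVariation, hP, sub_mul (1 : Matrix _ _ ℝ), one_mul, ← sub_mul]
        congr 1
        rw [show diagonal (xs w + ys w) = diagonal (xs w) + diagonal (ys w) from
          (Matrix.diagonal_add _ _).symm]
        abel
      rw [this, mul_sub, ← mul_assoc, ← mul_assoc, ← mul_assoc, Matrix.nonsing_inv_mul _ hPu]
    rwa [h4] at h2
  have hsum : ∀ a, ∑ i, stepProd m a i * (xs w + ys w) i = 0 ∧
      (n ∣ m * (a + 1) → ∑ i, stepProd m a i * ys w i = 0) := fun a => sum_eq_zero_of_trace_eq_zero m a (specialValue m) (xs w + ys w)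
    (ys w) (fun ζ h0 h1 => trace_pow_mul_eq_zero _ _ (htr ζ h0 h1) a)
  refine ⟨eq_zero_of_sum_stepProd m _ fun a => (hsum a).1, fun c => ?_⟩
  -- With a = n - 1 + nq the exponent a + 1 is a multiple of n, so the divisibility condition holds.
  refine sum_class_eq_zero m (n - 1) (ys w) (fun q => (hsum (n - 1 + n * q)).2 ?_) c
  have : n - 1 + n * q + 1 = n * (q + 1) := by
    have := NeZero.pos n
    rw [Nat.mul_succ]; omega
  rw [this]
  exact (Dvd.intro _ rfl).mul_left _

/-- The common kernel of the gradients lies in the kernel of a surjection Φ onto a space of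
dimension n + gcd(n, m), so their rank is at least that number. -/
theorem le_finrank_span_grad_specialPoint (k : ℕ) (hk : 2 ≤ k) (hkn : k ≤ n) :
    n + n.gcd (k - 1) ≤ Module.finrank ℝ (Submodule.span ℝ
      (Set.range fun ij : ℕ × ℕ => grad (specialPoint (n := n) (k - 1)) (I n k ij.1 ij.2))) := by
  set m := k - 1 with hm
  set B := bound n k
  set A : Matrix (Fin B × Fin B) (Var n) ℝ :=
    Matrix.of fun ij => grad (specialPoint (n := n) m) (I n k ij.1 ij.2) with hA
  set Φ : (Var n → ℝ) →ₗ[ℝ] (ZMod n → ℝ) × (ZMod (n.gcd m) → ℝ) :=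
    LinearMap.prod
      (LinearMap.pi fun i => LinearMap.proj (R := ℝ) (φ := fun _ : Var n => ℝ) (Sum.inl i) +
        LinearMap.proj (R := ℝ) (φ := fun _ : Var n => ℝ) (Sum.inr i))
      (LinearMap.pi fun c => ∑ i : ZMod n, if cls m i = c then stepProd m (n - 1) i •
        LinearMap.proj (R := ℝ) (φ := fun _ : Var n => ℝ) (Sum.inr i) else 0) with hΦ
  have hΦ2 : ∀ w c, (Φ w).2 c =
      ∑ i, (if cls m i = c then stepProd m (n - 1) i * ys w i else 0) := by
    intro w c
    change (∑ i : ZMod n, if cls m i = c then stepProd m (n - 1) i •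
        LinearMap.proj (R := ℝ) (φ := fun _ : Var n => ℝ) (Sum.inr i) else 0) w = _
    rw [LinearMap.sum_apply]
    refine Finset.sum_congr rfl fun i _ => ?_
    split_ifs <;> simp [ys]
  have hΦ1 : ∀ w, (Φ w).1 = xs w + ys w := by
    intro w; funext i; simp [hΦ, xs, ys]
  have hker : LinearMap.ker A.mulVecLin ≤ LinearMap.ker Φ := by
    intro w hw
    have h0 : ∀ i j, w ⬝ᵥ grad (specialPoint (k - 1)) (I n k i j) = 0 := by
      intro i j
      by_cases hij : i < B ∧ j < B
      · have := congrFun (LinearMap.mem_ker.mp hw) (⟨i, hij.1⟩, ⟨j, hij.2⟩)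
        rw [dotProduct_comm]
        exact this
      · rw [I_eq_zero n k i j (by omega), map_zero, dotProduct_zero]
    obtain ⟨h1, h2⟩ := kernel_grad_specialPoint k hk hkn w h0
    rw [LinearMap.mem_ker]
    refine Prod.ext ((hΦ1 w).trans h1) ?_
    funext c
    rw [hΦ2]
    exact h2 c
  have hsurj : LinearMap.range Φ = ⊤ := by
    rw [LinearMap.range_eq_top]
    rintro ⟨e, b⟩
    set v : ZMod n → ℝ := fun i =>
      if i = rep m (cls m i) then b (cls m i) / stepProd m (n - 1) i else 0 with hv
    refine ⟨Sum.elim (e - v) v, Prod.ext ?_ ?_⟩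
    · rw [hΦ1]
      funext i
      simp [xs, ys]
    · funext c
      rw [hΦ2, Finset.sum_eq_single (rep m c)]
      · simp only [cls_rep, if_true, ys, Sum.elim_inr, hv]
        exact mul_div_cancel₀ _ (stepProd_pos m _ _).ne'
      · intro i _ hi
        by_cases hc : cls m i = c
        · rw [if_pos hc]
          simp only [ys, Sum.elim_inr, hv, hc, if_neg hi, mul_zero]
        · rw [if_neg hc]
      · intro h; exact absurd (Finset.mem_univ _) h
  have h1 := LinearMap.finrank_range_add_finrank_ker Φ
  have h2 := LinearMap.finrank_range_add_finrank_ker A.mulVecLin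
  rw [hsurj, finrank_top, Module.finrank_prod, Module.finrank_pi, Module.finrank_pi, ZMod.card,
    ZMod.card] at h1
  have h3 := Submodule.finrank_mono hker
  have h4 : A.rank ≤ Module.finrank ℝ (Submodule.span ℝ
      (Set.range fun ij : ℕ × ℕ => grad (specialPoint (n := n) m) (I n k ij.1 ij.2))) := by
    rw [Matrix.rank_eq_finrank_span_row]
    refine Submodule.finrank_mono (Submodule.span_mono ?_)
    rintro _ ⟨ij, rfl⟩
    exact ⟨(ij.1, ij.2), rfl⟩
  rw [Matrix.rank] at h4
  omega

theorem exists_I_one_ne_zero (k : ℕ) (hk : 2 ≤ k) (hkn : k ≤ n) : ∃ i, I n k i 1 ≠ 0 := by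
  by_contra! hI
  -- At x = 1, y = 0 and ζ = 2 (z = 1/2), with λ replaced by -λ, the operator is P (1 + λN), N = P⁻¹
  -- T^m. Its linear coefficient det P · tr N is nonzero, every diagonal entry of N being ζ / (1 -
  -- ζ) = -2.
  set pt : Var n → ℝ := Sum.elim 1 0 with hpt
  set P := 1 - shift n (2 : ℝ) with hP
  have hPu : IsUnit P.det := isUnit_det_one_sub_shift 2 (by norm_num)
  set N := P⁻¹ * shift n (2 : ℝ) ^ (k - 1) with hN
  obtain ⟨p, hp⟩ : ∃ p : Polynomial ℝ, ∀ t : ℝ,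
      (1 + t • N).det = 1 + N.trace * t + p.eval t * t ^ 2 :=
    ⟨_, fun t => Matrix.det_one_add_smul t N⟩
  have hK : ∀ lam : ℝ, diffMatrix (k - 1) (xs pt) (ys pt) (-lam) (2⁻¹)⁻¹ = P * (1 + lam • N) := by
    intro lam
    have h1 : diagonal (xs pt) = 1 := Matrix.diagonal_one
    have h2 : diagonal (ys pt) = 0 := Matrix.diagonal_zero
    rw [diffMatrix, inv_inv, h1, h2, mul_add, mul_one, hN, mul_smul_comm, ← mul_assoc,
      Matrix.mul_nonsing_inv _ hPu, one_mul, mul_zero, add_zero, one_mul, neg_smul, sub_neg_eq_add]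
  have htr : N.trace ≠ 0 := by
    rw [hN, Matrix.trace_mul_comm, Matrix.trace]
    simp only [Matrix.diag_apply, hP]
    simp only [shift_pow_mul_inv_one_sub_shift_diag (n := n) 2 (by norm_num) (k - 1) (by omega)
      (by omega)]
    simp only [Finset.sum_const, Finset.card_univ, ZMod.card, nsmul_eq_mul]
    have := NeZero.ne n
    norm_num [this]
  set a : ℕ → ℝ := fun j => ∑ i ∈ Finset.range (bound n k),
    MvPolynomial.eval pt (I n k i j) * (2⁻¹ ^ i * (-1) ^ j) with ha
  have hpoly : (∑ j ∈ Finset.range (bound n k), Polynomial.C (a j) * Polynomial.X ^ j :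
      Polynomial ℝ) = Polynomial.C ((-2⁻¹) ^ k * P.det) *
        (1 + Polynomial.C N.trace * Polynomial.X + p * Polynomial.X ^ 2) := by
    apply Polynomial.funext
    intro lam
    have h1 := eval_specDet k hk hkn (-lam) 2⁻¹ (by norm_num) pt
    rw [hK, Matrix.det_mul, hp, eval_specDet_eq_sum, Finset.sum_comm] at h1
    simp only [Polynomial.eval_finsetSum, Polynomial.eval_mul, Polynomial.eval_C,
      Polynomial.eval_pow, Polynomial.eval_X, Polynomial.eval_add, Polynomial.eval_one]
    rw [mul_assoc, ← h1]
    refine Finset.sum_congr rfl fun j _ => ?_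
    rw [ha, Finset.sum_mul]
    refine Finset.sum_congr rfl fun i _ => ?_
    rw [neg_pow lam]
    ring
  have h1 := congrArg (fun p => Polynomial.coeff p 1) hpoly
  have ha1 : a 1 = 0 := by simp [ha, hI]
  have hl : ((∑ j ∈ Finset.range (bound n k), Polynomial.C (a j) * Polynomial.X ^ j :
      Polynomial ℝ)).coeff 1 = 0 := by
    simp [Polynomial.finsetSum_coeff, Polynomial.coeff_X_pow, ha1]
  simp only [hl] at h1
  rw [Polynomial.coeff_C_mul, Polynomial.coeff_add, Polynomial.coeff_add, Polynomial.coeff_C_mul,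
    Polynomial.coeff_X_one, Polynomial.coeff_mul_X_pow', if_neg (by norm_num),
    Polynomial.coeff_one, if_neg (by norm_num), zero_add, mul_one, add_zero] at h1
  exact (mul_ne_zero (mul_ne_zero (pow_ne_zero _ (by norm_num)) hPu.ne_zero) htr) h1.symm

end Special

/-! ### The Poisson structure and the tangent space of the level set -/

section Poisson

variable {n : ℕ} [NeZero n]

theorem r_add_r' (k : ℕ) (hk : 2 ≤ k) : r k + r' k + 1 = k - 1 := by
  have h : r k = k / 2 - 1 := rfl
  have h' : r' k = k - 2 - r k := rfl
  omega

/-- The skew-adjacency matrix of the quiver. -/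
def quiverMatrix (n k : ℕ) : Matrix (Var n) (Var n) ℝ :=
  Matrix.of fun a b => (arrows n k a b : ℝ) - arrows n k b a

theorem quiverMatrix_mulVec_inl (k : ℕ) (w : Var n → ℝ) (i : ZMod n) :
    (quiverMatrix n k *ᵥ w) (Sum.inl i) = ys w (i + r' k + 1) + ys w (i - r k - 1) -
      ys w (i + r' k) - ys w (i - r k) := by
  simp only [quiverMatrix, Matrix.mulVec, dotProduct, Fintype.sum_sum_type, Matrix.of_apply, arrows,
    ys, Nat.cast_zero, zero_mul, Finset.sum_const_zero, zero_add, Nat.cast_add,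
    Nat.cast_ite, Nat.cast_one, sub_mul, add_mul, ite_mul, one_mul, Finset.sum_sub_distrib,
    Finset.sum_add_distrib, Finset.sum_ite_eq', Finset.mem_univ, if_true]
  ring

theorem quiverMatrix_mulVec_inr (k : ℕ) (w : Var n → ℝ) (j : ZMod n) :
    (quiverMatrix n k *ᵥ w) (Sum.inr j) = xs w (j - r' k) + xs w (j + r k) -
      xs w (j - r' k - 1) - xs w (j + r k + 1) := by
  have e1 : ∀ i : ZMod n, j = i + r' k + 1 ↔ i = j - r' k - 1 := fun i =>
    ⟨fun h => by rw [h]; ring, fun h => by rw [h]; ring⟩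
  have e2 : ∀ i : ZMod n, j = i - r k - 1 ↔ i = j + r k + 1 := fun i =>
    ⟨fun h => by rw [h]; ring, fun h => by rw [h]; ring⟩
  have e3 : ∀ i : ZMod n, j = i + r' k ↔ i = j - r' k := fun i =>
    ⟨fun h => by rw [h]; ring, fun h => by rw [h]; ring⟩
  have e4 : ∀ i : ZMod n, j = i - r k ↔ i = j + r k := fun i =>
    ⟨fun h => by rw [h]; ring, fun h => by rw [h]; ring⟩
  simp only [quiverMatrix, Matrix.mulVec, dotProduct, Fintype.sum_sum_type, Matrix.of_apply, arrows,
    xs, Nat.cast_zero, zero_mul, Finset.sum_const_zero, add_zero, Nat.cast_add,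
    Nat.cast_ite, Nat.cast_one, sub_mul, add_mul, ite_mul, one_mul, Finset.sum_sub_distrib,
    Finset.sum_add_distrib, e1, e2, e3, e4, Finset.sum_ite_eq', Finset.mem_univ, if_true]
  ring

/-- The transpose of the logarithmic differential of the projection `π`. -/
def pullGrad (k : ℕ) (a : Var n → ℝ) : Var n → ℝ :=
  Sum.elim (fun i => -a (Sum.inl i) + a (Sum.inr (i - r k - 1)))
    (fun i => a (Sum.inl i) - a (Sum.inr (i - r k)))

/-- On a pulled-back gradient the first window combination becomes p_j - p_{j+1} and the second
q_{j-r-1} - q_{j-r}. The inner sum over the window therefore telescopes to its two ends, which lie r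
+ r' + 1 apart and produce the arrows of the quiver. -/
theorem gradBracket_pullGrad (k : ℕ) (hk : 2 ≤ k) (a b : Var n → ℝ) :
    gradBracket n (k - 1) (pullGrad k a) (pullGrad k b) = -(a ⬝ᵥ quiverMatrix n k *ᵥ b) := by
  have htel : ∀ (Q : ZMod n → ℝ) (j : ZMod n), ∑ l ∈ Finset.range (k - 1),
      (Q (j + l + 1 - r k - 1) - Q (j + l + 1 - r k)) = Q (j - r k) - Q (j + r' k + 1) := by
    intro Q j
    have := Finset.sum_range_sub' (fun l : ℕ => Q (j + l - r k)) (k - 1)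
    simp only [Nat.cast_zero, add_zero] at this
    rw [show j + (r' k : ZMod n) + 1 = j + ((k - 1 : ℕ) : ZMod n) - r k by
      rw [← r_add_r' k hk]; push_cast; ring, ← this]
    refine Finset.sum_congr rfl fun l _ => ?_
    congr 2 <;> (push_cast; ring)
  have hw : ∀ a b : Var n → ℝ, ∑ l ∈ Finset.range (k - 1), ∑ j : ZMod n,
      (xs (pullGrad k a) (j + 1) + ys (pullGrad k a) j) *
        (xs (pullGrad k b) (j + l + 1) + ys (pullGrad k b) (j + l + 1)) =
      ∑ j, (xs a j - xs a (j + 1)) * (ys b (j - r k) - ys b (j + r' k + 1)) := by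
    intro a b
    rw [Finset.sum_comm]
    refine Finset.sum_congr rfl fun j _ => ?_
    rw [← htel (ys b) j, Finset.mul_sum]
    refine Finset.sum_congr rfl fun l _ => ?_
    simp only [xs, ys, pullGrad, Sum.elim_inl, Sum.elim_inr]
    rw [show j + 1 - (r k : ZMod n) - 1 = j - r k by ring]
    ring
  have hA : ∀ a b : Var n → ℝ,
      ∑ j, (xs a j - xs a (j + 1)) * (ys b (j - r k) - ys b (j + r' k + 1)) =
        -∑ j, xs a j * (quiverMatrix n k *ᵥ b) (Sum.inl j) := by
    intro a b
    have e : ∑ j, xs a (j + 1) * (ys b (j - r k) - ys b (j + r' k + 1)) =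
        ∑ j, xs a j * (ys b (j - r k - 1) - ys b (j + r' k)) := by
      rw [← sum_add_right (fun j : ZMod n => xs a j * (ys b (j - r k - 1) - ys b (j + r' k))) 1]
      refine Finset.sum_congr rfl fun j _ => ?_
      congr 3 <;> ring
    simp only [sub_mul, Finset.sum_sub_distrib, e, quiverMatrix_mulVec_inl]
    rw [← Finset.sum_sub_distrib, ← Finset.sum_neg_distrib]
    refine Finset.sum_congr rfl fun j _ => ?_
    ring
  have hB : ∑ j, ys a j * (quiverMatrix n k *ᵥ b) (Sum.inr j) =
      -∑ j, xs b j * (quiverMatrix n k *ᵥ a) (Sum.inl j) := by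
    have hs : ∀ c : ZMod n, ∑ j, ys a j * xs b (j + c) = ∑ j, xs b j * ys a (j - c) := by
      intro c
      rw [← sum_add_right (fun j : ZMod n => xs b j * ys a (j - c)) c]
      refine Finset.sum_congr rfl fun j _ => ?_
      rw [add_sub_cancel_right, mul_comm]
    simp only [quiverMatrix_mulVec_inl, quiverMatrix_mulVec_inr, mul_sub, mul_add,
      Finset.sum_sub_distrib, Finset.sum_add_distrib]
    have h1 := hs (-(r' k : ZMod n))
    have h2 := hs (r k : ZMod n)
    have h3 := hs (-(r' k : ZMod n) - 1)
    have h4 := hs ((r k : ZMod n) + 1)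
    simp only [sub_neg_eq_add, ← sub_eq_add_neg, add_sub, sub_sub_eq_add_sub, ← add_assoc,
      ← sub_sub] at h1 h2 h3 h4
    have h3' : ∑ j : ZMod n, xs b j * ys a (j + 1 + r' k) = ∑ j : ZMod n, xs b j * ys a (j + r' k + 1) := by
      refine Finset.sum_congr rfl fun j _ => ?_
      rw [add_right_comm]
    linear_combination h1 + h2 - h3 - h4 - h3'
  rw [gradBracket_apply, windowBracket]
  simp only [Finset.sum_sub_distrib]
  rw [hw, hw, hA, hA, dotProduct, Fintype.sum_sum_type]
  change _ = -(∑ j, xs a j * _ + ∑ j, ys a j * _)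
  rw [hB]
  ring

theorem poissonBracket_eq (k : ℕ) (hk : 2 ≤ k) (F G : SpacePQ n → ℝ) (s : SpacePQ n) :
    poissonBracket k F G s = -gradBracket n (k - 1)
      (pullGrad k fun v => s v * fderiv ℝ F s (Pi.single v 1))
      (pullGrad k fun v => s v * fderiv ℝ G s (Pi.single v 1)) := by
  rw [gradBracket_pullGrad k hk, neg_neg, poissonBracket]
  simp only [dotProduct, Matrix.mulVec, Finset.mul_sum]
  refine Finset.sum_congr rfl fun a _ => Finset.sum_congr rfl fun b _ => ?_
  simp only [poissonMatrix, quiverMatrix, Matrix.of_apply]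
  ring

/-- The equation says that Q(i + m) - Q(i) is constant in i. Adding it up over n steps returns to
the start, so the constant is zero. -/
theorem periodic_of_sum_eq (m ρ ρ' : ℕ) (hm : ρ + ρ' + 1 = m) (Q : ZMod n → ℝ)
    (h : ∀ i : ZMod n, Q (i + ρ' + 1) + Q (i - ρ - 1) - Q (i + ρ') - Q (i - ρ) = 0) (i : ZMod n) :
    Q (i + m) = Q i := by
  have hconst : ∀ i : ZMod n, Q (i + m) - Q i = Q m - Q 0 := by
    intro i
    rw [eq_of_forall_add_one (fun i : ZMod n => Q (i + (m : ZMod n)) - Q i) (fun i => ?_) i, zero_add]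
    have := h (i + ρ + 1)
    rw [show i + (ρ : ZMod n) + 1 + ρ' + 1 = i + 1 + m by rw [← hm]; push_cast; ring,
      show i + (ρ : ZMod n) + 1 + ρ' = i + m by rw [← hm]; push_cast; ring,
      show i + (ρ : ZMod n) + 1 - ρ - 1 = i by ring,
      show i + (ρ : ZMod n) + 1 - ρ = i + 1 by ring] at this
    linarith
  have hit : ∀ N : ℕ, Q (i + N * m) = Q i + N * (Q m - Q 0) := by
    intro N
    induction N with
    | zero => simp
    | succ N ih =>
      have := hconst (i + N * m)
      rw [show i + ((N + 1 : ℕ) : ZMod n) * m = i + N * m + m by push_cast; ring]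
      push_cast
      linarith
  have h1 := hit n
  rw [CharP.cast_eq_zero, zero_mul, add_zero] at h1
  have h2 : (n : ℝ) * (Q m - Q 0) = 0 := by linarith
  have h3 := (mul_eq_zero.mp h2).resolve_left (Nat.cast_ne_zero.mpr (NeZero.ne n))
  linarith [hconst i]

theorem eq_comp_cls (m : ℕ) (Q : ZMod n → ℝ) (h : ∀ i : ZMod n, Q (i + m) = Q i) (i : ZMod n) :
    Q (rep m (cls m i)) = Q i := by
  obtain ⟨s, hs⟩ := exists_eq_mul_of_cls_eq_zero m (i - rep m (cls m i)) (by
    rw [map_sub, cls_rep, sub_self])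
  have hit : ∀ (N : ℕ) (j : ZMod n), Q (j + m * N) = Q j := by
    intro N j
    induction N with
    | zero => simp
    | succ N ih => rw [Nat.cast_succ, mul_add, mul_one, ← add_assoc, h, ih]
  rw [← hit s, ← hs, add_sub_cancel]

/-- The p- and q-parts decouple, each being periodic under i ↦ i + (k - 1), that is, a function of
the class modulo gcd(n, k - 1). -/
theorem ker_quiverMatrix (k : ℕ) (hk : 2 ≤ k) :
    LinearMap.ker (quiverMatrix n k).mulVecLin = LinearMap.range
      (LinearMap.funLeft ℝ ℝ (Sum.map (cls (n := n) (k - 1)) (cls (n := n) (k - 1)))) := by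
  have hm := r_add_r' k hk
  have hrep : ∀ w : Var n → ℝ, w ∈ LinearMap.range
      (LinearMap.funLeft ℝ ℝ (Sum.map (cls (n := n) (k - 1)) (cls (n := n) (k - 1)))) ↔
      (∀ i : ZMod n, xs w (i + (k - 1 : ℕ)) = xs w i) ∧
        ∀ i : ZMod n, ys w (i + (k - 1 : ℕ)) = ys w i := by
    intro w
    constructor
    · rintro ⟨u, rfl⟩
      constructor <;> intro i <;>
        simp only [xs, ys, LinearMap.funLeft_apply, Sum.map_inl, Sum.map_inr, map_add, cls_natCast,
          add_zero]
    · rintro ⟨h1, h2⟩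
      refine ⟨fun v => w (Sum.map (rep (k - 1)) (rep (k - 1)) v), ?_⟩
      funext v
      rcases v with i | i
      · exact eq_comp_cls (k - 1) (xs w) h1 i
      · exact eq_comp_cls (k - 1) (ys w) h2 i
  ext w
  rw [hrep, LinearMap.mem_ker, Matrix.mulVecLin_apply]
  constructor
  · intro h
    refine ⟨periodic_of_sum_eq (k - 1) (r' k) (r k) (by omega) _ fun i => ?_,
      periodic_of_sum_eq (k - 1) (r k) (r' k) hm _ fun i => ?_⟩
    · have := congrFun h (Sum.inr i)
      rw [quiverMatrix_mulVec_inr, Pi.zero_apply] at this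
      linarith
    · have := congrFun h (Sum.inl i)
      rw [quiverMatrix_mulVec_inl, Pi.zero_apply] at this
      linarith
  · rintro ⟨h1, h2⟩
    funext v
    rcases v with i | i
    · rw [quiverMatrix_mulVec_inl, ← h2 (i - r k - 1), ← h2 (i - r k), ← hm,
        show i - (r k : ZMod n) - 1 + ((r k + r' k + 1 : ℕ) : ZMod n) = i + r' k by push_cast; ring,
        show i - (r k : ZMod n) + ((r k + r' k + 1 : ℕ) : ZMod n) = i + r' k + 1 by push_cast; ring,
        Pi.zero_apply]
      ring
    · rw [quiverMatrix_mulVec_inr, ← h1 (i - r' k - 1), ← h1 (i - r' k), ← hm,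
        show i - (r' k : ZMod n) - 1 + ((r k + r' k + 1 : ℕ) : ZMod n) = i + r k by push_cast; ring,
        show i - (r' k : ZMod n) + ((r k + r' k + 1 : ℕ) : ZMod n) = i + r k + 1 by push_cast; ring,
        Pi.zero_apply]
      ring

theorem rank_quiverMatrix (k : ℕ) (hk : 2 ≤ k) :
    (quiverMatrix n k).rank + 2 * n.gcd (k - 1) = 2 * n := by
  have h1 := LinearMap.finrank_range_add_finrank_ker (quiverMatrix n k).mulVecLin
  have hs : Function.Surjective (cls (n := n) (k - 1)) := fun c => ⟨rep _ c, cls_rep _ c⟩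
  rw [ker_quiverMatrix k hk, LinearMap.finrank_range_of_inj
    (LinearMap.funLeft_injective_of_surjective ℝ ℝ _ (Sum.map_surjective.mpr ⟨hs, hs⟩)),
    Module.finrank_pi, Module.finrank_pi, Fintype.card_sum, Fintype.card_sum, ZMod.card,
    ZMod.card] at h1
  rw [Matrix.rank]
  omega

theorem rank_poissonMatrix (k : ℕ) (hk : 2 ≤ k) (s : SpacePQ n) (hs : ∀ v, s v ≠ 0) :
    (poissonMatrix k s).rank + 2 * n.gcd (k - 1) = 2 * n := by
  have hd : IsUnit (diagonal s).det := by
    rw [Matrix.det_diagonal]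
    exact isUnit_iff_ne_zero.mpr (Finset.prod_ne_zero_iff.mpr fun v _ => hs v)
  have : poissonMatrix k s = diagonal s * quiverMatrix n k * diagonal s := by
    ext a b
    simp only [poissonMatrix, quiverMatrix, Matrix.mul_diagonal, Matrix.diagonal_mul,
      Matrix.of_apply]
    ring
  rw [this, Matrix.rank_mul_eq_left_of_isUnit_det _ _ hd,
    Matrix.rank_mul_eq_right_of_isUnit_det _ _ hd, rank_quiverMatrix k hk]

theorem differentiable_prodPQ : Differentiable ℝ (prodPQ (n := n)) := by
  unfold prodPQ
  fun_prop

theorem finrank_tangentSpace (s : SpacePQ n) (hs : s ∈ levelSet n) :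
    Module.finrank ℝ (tangentSpace s) + 1 = 2 * n := by
  have hne : (fderiv ℝ (prodPQ (n := n)) s).toLinearMap ≠ 0 := by
    intro h0
    -- By Euler's relation the derivative of the product in the radial direction is 2n at a point of
    -- S, so the differential is not zero.
    have h1 : HasDerivAt (fun t : ℝ => t • s) s 1 := by
      simpa using (hasDerivAt_id (1 : ℝ)).smul_const s
    have h2 := (differentiable_prodPQ ((1 : ℝ) • s)).hasFDerivAt.comp_hasDerivAt (1 : ℝ) h1
    have h3 : (prodPQ (n := n)) ∘ (fun t : ℝ => t • s) = fun t => t ^ (2 * n) := by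
      funext t
      have : prodPQ s = 1 := hs
      rw [prodPQ] at this
      simp only [Function.comp, prodPQ, Pi.smul_apply, smul_eq_mul]
      rw [show ∀ f g : ZMod n → ℝ, ∏ i, t * f i * (t * g i) = t ^ (2 * n) * ∏ i, f i * g i by
        intro f g
        have hc : ∏ _i : ZMod n, t ^ 2 = t ^ (2 * n) := by
          rw [Finset.prod_const, Finset.card_univ, ZMod.card, pow_mul]
        rw [← hc, ← Finset.prod_mul_distrib]
        exact Finset.prod_congr rfl fun i _ => by ring, this, mul_one]
    rw [h3, one_smul] at h2
    have h4 := h2.unique (hasDerivAt_pow (2 * n) (1 : ℝ))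
    have h5 : fderiv ℝ (prodPQ (n := n)) s s = 0 := LinearMap.congr_fun h0 s
    rw [h5, one_pow, mul_one] at h4
    exact NeZero.ne n (by exact_mod_cast (show (n : ℝ) = 0 by push_cast at h4; linarith))
  have := Module.Dual.finrank_ker_add_one_of_ne_zero hne
  rw [Module.finrank_pi, Fintype.card_sum, ZMod.card] at this
  rw [tangentSpace]
  omega

end Poisson

/-! ### The projection to the `(p, q)`-space and its polynomial section -/

section Projection

variable {n : ℕ} [NeZero n]

/-- The projection `π` over an arbitrary field. -/
def projF {F : Type*} [Field F] (k : ℕ) (pt : Var n → F) : Var n → F :=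
  Sum.elim (fun i => pt (Sum.inr i) / pt (Sum.inl i))
    (fun i => pt (Sum.inl (i + r k + 1)) / pt (Sum.inr (i + r k)))

theorem proj_eq (k : ℕ) :
    proj n k = projF k (fun v => algebraMap (PolyXY n) (FieldXY n) (MvPolynomial.X v)) := by
  funext v
  rcases v with i | i <;> rfl

/-- The coordinates `x` of the section of `π`. -/
def secX {R : Type*} [CommRing R] (k : ℕ) (s : Var n → R) (i : ZMod n) : R :=
  ∏ j ∈ Finset.range i.val, s (Sum.inr ((j : ZMod n) - r k)) * s (Sum.inl (j : ZMod n))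

/-- The polynomial section of `π` with `x_0 = 1`. -/
def sec {R : Type*} [CommRing R] (k : ℕ) (s : Var n → R) : Var n → R :=
  Sum.elim (secX k s) (fun i => s (Sum.inl i) * secX k s i)

theorem map_sec {R S : Type*} [CommRing R] [CommRing S] (f : R →+* S) (k : ℕ) (s : Var n → R)
    (v : Var n) : f (sec k s v) = sec k (fun v => f (s v)) v := by
  rcases v with i | i <;> simp [sec, secX, map_prod]

/-- On the image of π one has q_{j-r} p_j = x_{j+1} / x_j, so the products defining the section
telescope to x_i / x_0. -/
theorem sec_projF {F : Type*} [Field F] (k : ℕ) (pt : Var n → F) (h : ∀ v, pt v ≠ 0) :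
    sec k (projF k pt) = (pt (Sum.inl 0))⁻¹ • pt := by
  have hx : ∀ i, secX k (projF k pt) i = (pt (Sum.inl 0))⁻¹ * pt (Sum.inl i) := by
    have hN : ∀ N : ℕ, ∏ j ∈ Finset.range N, projF k pt (Sum.inr ((j : ZMod n) - r k)) *
        projF k pt (Sum.inl (j : ZMod n)) =
        (pt (Sum.inl 0))⁻¹ * pt (Sum.inl (N : ZMod n)) := by
      intro N
      induction N with
      | zero => simp [h]
      | succ N ih =>
        rw [Finset.prod_range_succ, ih]
        simp only [projF, Sum.elim_inl, Sum.elim_inr, sub_add_cancel, Nat.cast_succ]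
        have h1 := h (Sum.inl (N : ZMod n))
        have h2 := h (Sum.inr (N : ZMod n))
        have h3 := h (Sum.inl 0)
        field_simp
    intro i
    rw [secX, hN, ZMod.natCast_zmod_val]
  funext v
  rcases v with i | i
  · exact hx i
  · have h1 := h (Sum.inl i)
    simp only [sec, Sum.elim_inr, hx]
    simp only [projF, Sum.elim_inl, Pi.smul_apply, smul_eq_mul]
    field_simp

theorem prod_add_right {M : Type*} [CommMonoid M] (f : ZMod n → M) (c : ZMod n) :
    ∏ i, f (i + c) = ∏ i, f i :=
  Equiv.prod_comp (Equiv.addRight c) f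

theorem ne_zero_of_mem_levelSet {s : SpacePQ n} (hs : s ∈ levelSet n) (v : Var n) : s v ≠ 0 := by
  have h : ∏ i : ZMod n, s (Sum.inl i) * s (Sum.inr i) ≠ 0 := by
    have : prodPQ s = 1 := hs
    rw [prodPQ] at this
    rw [this]; exact one_ne_zero
  rw [Finset.prod_ne_zero_iff] at h
  rcases v with i | i
  · exact left_ne_zero_of_mul (h i (Finset.mem_univ i))
  · exact right_ne_zero_of_mul (h i (Finset.mem_univ i))

theorem prod_zmod {M : Type*} [CommMonoid M] (f : ZMod n → M) :
    ∏ i, f i = ∏ j ∈ Finset.range n, f (j : ZMod n) := by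
  rw [← Fin.prod_univ_eq_prod_range (fun j : ℕ => f (j : ZMod n)),
    ← prod_add_right f (-1), ← Equiv.prod_comp (timeEquiv n)]
  refine Finset.prod_congr rfl fun t _ => ?_
  rw [timeEquiv_apply, Nat.cast_succ, add_neg_cancel_right]

theorem secX_ne_zero (k : ℕ) {s : SpacePQ n} (hs : s ∈ levelSet n) (i : ZMod n) :
    secX k s i ≠ 0 :=
  Finset.prod_ne_zero_iff.mpr fun _ _ =>
    mul_ne_zero (ne_zero_of_mem_levelSet hs _) (ne_zero_of_mem_levelSet hs _)

theorem sec_ne_zero (k : ℕ) {s : SpacePQ n} (hs : s ∈ levelSet n) (v : Var n) : sec k s v ≠ 0 := by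
  rcases v with i | i
  · exact secX_ne_zero k hs i
  · exact mul_ne_zero (ne_zero_of_mem_levelSet hs _) (secX_ne_zero k hs i)

theorem secX_add_one (k : ℕ) {s : SpacePQ n} (hs : s ∈ levelSet n) (i : ZMod n) :
    secX k s (i + 1) = secX k s i * (s (Sum.inr (i - r k)) * s (Sum.inl i)) := by
  have hi : ((i.val : ℕ) : ZMod n) = i := ZMod.natCast_zmod_val i
  have h1 : secX k s i * (s (Sum.inr (i - r k)) * s (Sum.inl i)) =
      ∏ j ∈ Finset.range (i.val + 1), s (Sum.inr ((j : ZMod n) - r k)) * s (Sum.inl (j : ZMod n)) := by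
    rw [Finset.prod_range_succ, hi, secX]
  rw [h1]
  have hlt := ZMod.val_lt i
  rcases Nat.lt_or_ge (i.val + 1) n with h | h
  · rw [secX]
    have : (i + 1).val = i.val + 1 := by
      conv_lhs => rw [← hi]
      rw [← Nat.cast_succ, ZMod.val_natCast, Nat.mod_eq_of_lt h]
    rw [this]
  -- Only this wrap-around needs the equation of S: the product over a full period must return to
  -- x_0 = 1.
  · have hn : i.val + 1 = n := by omega
    have h0 : i + 1 = 0 := by
      conv_lhs => rw [← hi]
      rw [← Nat.cast_succ, Nat.succ_eq_add_one, hn, CharP.cast_eq_zero]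
    rw [hn, h0, secX, ZMod.val_zero, Finset.range_zero, Finset.prod_empty,
      ← prod_zmod (fun j : ZMod n => s (Sum.inr (j - r k)) * s (Sum.inl j)), Finset.prod_mul_distrib]
    have h2 := prod_add_right (fun j : ZMod n => s (Sum.inr j)) (-(r k : ZMod n))
    simp only [← sub_eq_add_neg] at h2
    have : prodPQ s = 1 := hs
    rw [h2, ← Finset.prod_mul_distrib, ← this, prodPQ]
    exact Finset.prod_congr rfl fun j _ => mul_comm _ _

theorem projF_sec (k : ℕ) {s : SpacePQ n} (hs : s ∈ levelSet n) : projF k (sec k s) = s := by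
  funext v
  rcases v with i | i
  · simp only [projF, sec, Sum.elim_inl, Sum.elim_inr]
    exact mul_div_cancel_right₀ _ (secX_ne_zero k hs i)
  · simp only [projF, sec, Sum.elim_inl, Sum.elim_inr]
    rw [secX_add_one k hs, add_sub_cancel_right]
    have h1 := secX_ne_zero k hs (i + r k)
    have h2 := ne_zero_of_mem_levelSet hs (Sum.inl (i + (r k : ZMod n)))
    field_simp

theorem projF_mem_levelSet (k : ℕ) {pt : Var n → ℝ} (h : ∀ v, pt v ≠ 0) :
    projF k pt ∈ levelSet n := by
  change prodPQ _ = 1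
  simp only [prodPQ, projF, Sum.elim_inl, Sum.elim_inr]
  have h1 := prod_add_right (fun i : ZMod n => pt (Sum.inl i)) (r k + 1)
  have h2 := prod_add_right (fun i : ZMod n => pt (Sum.inr i)) (r k)
  simp only [← add_assoc] at h1
  rw [Finset.prod_mul_distrib, Finset.prod_div_distrib, Finset.prod_div_distrib, h1, h2,
    div_mul_div_cancel₀, div_self]
  · exact Finset.prod_ne_zero_iff.mpr fun i _ => h _
  · exact Finset.prod_ne_zero_iff.mpr fun i _ => h _

theorem projF_smul (k : ℕ) (pt : Var n → ℝ) (t : ℝ) (ht : t ≠ 0) :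
    projF k (t • pt) = projF k pt := by
  funext v
  rcases v with i | i <;>
    simp only [projF, Sum.elim_inl, Sum.elim_inr, Pi.smul_apply, smul_eq_mul] <;>
    exact mul_div_mul_left _ _ ht

theorem continuous_sec (k : ℕ) : Continuous (sec (n := n) (R := ℝ) k) := by
  refine continuous_pi fun v => ?_
  rcases v with i | i <;> simp only [sec, secX, Sum.elim_inl, Sum.elim_inr] <;> fun_prop

theorem continuousAt_projF (k : ℕ) {pt : Var n → ℝ} (h : ∀ v, pt v ≠ 0) :
    ContinuousAt (projF k) pt := by
  refine continuousAt_pi.mpr fun v => ?_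
  rcases v with i | i <;> simp only [projF, Sum.elim_inl, Sum.elim_inr]
  · exact (continuous_apply _).continuousAt.div (continuous_apply _).continuousAt (h _)
  · exact (continuous_apply _).continuousAt.div (continuous_apply _).continuousAt (h _)

/-- A polynomial that vanishes on a box with infinite sides is zero. -/
theorem mem_closure_eval_ne_zero {σ : Type*} [Fintype σ] {P : MvPolynomial σ ℝ} (hP : P ≠ 0)
    (pt : σ → ℝ) : pt ∈ closure {pt | MvPolynomial.eval pt P ≠ 0} := by
  rw [Metric.mem_closure_iff]
  intro ε hε
  by_contra! h
  apply hP
  have : ∀ i, Infinite (Metric.ball (pt i) ε) := fun i => by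
    rw [Set.infinite_coe_iff]
    exact infinite_of_mem_nhds (pt i) (Metric.ball_mem_nhds _ hε)
  refine MvPolynomial.funext_set (fun i => Metric.ball (pt i) ε)
    (fun i => Set.infinite_coe_iff.mp (this i)) fun w hw => ?_
  rw [map_zero]
  by_contra hne
  have h1 := h w hne
  rw [dist_comm] at h1
  exact absurd ((dist_pi_lt_iff hε).mpr fun i => hw i (Set.mem_univ i)) (not_lt.mpr h1)

/-- The product of all coordinates. -/
def monomialAll (n : ℕ) [NeZero n] : PolyXY n := ∏ v : Var n, MvPolynomial.X v

theorem monomialAll_ne_zero : monomialAll n ≠ 0 :=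
  Finset.prod_ne_zero_iff.mpr fun v _ => MvPolynomial.X_ne_zero v

theorem eval_monomialAll_ne_zero (pt : Var n → ℝ) :
    MvPolynomial.eval pt (monomialAll n) ≠ 0 ↔ ∀ v, pt v ≠ 0 := by
  simp [monomialAll, map_prod, Finset.prod_ne_zero_iff]

/-- Generic points upstairs project to a dense part of S, because every point of S is the image of
its section point and π is continuous there. This transports density to S without studying S itself
as a variety. -/
theorem levelSet_subset_closure_projF (k : ℕ) {P : PolyXY n} (hP : P ≠ 0) :
    levelSet n ⊆ closure
      (projF k '' {pt : Var n → ℝ | (∀ v, pt v ≠ 0) ∧ MvPolynomial.eval pt P ≠ 0}) := by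
  intro s hs
  rw [← projF_sec k hs]
  refine mem_closure_image (continuousAt_projF k (sec_ne_zero k hs)) ?_
  refine closure_mono ?_ (mem_closure_eval_ne_zero (mul_ne_zero monomialAll_ne_zero hP) _)
  intro pt hpt
  rw [Set.mem_ofPred_eq, map_mul] at hpt
  exact ⟨(eval_monomialAll_ne_zero pt).mp (left_ne_zero_of_mul hpt), right_ne_zero_of_mul hpt⟩

/-- The pair U, B is chosen uniformly in the target field, so the same polynomials serve in the
function field and at every real point of the torus. -/
theorem exists_clear_denominators {σ : Type*} (num den : σ → PolyXY n) (G : MvPolynomial σ ℝ) :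
    ∃ U B : PolyXY n, ∀ (L : Type) [Field L] [Algebra ℝ L] (ψ : PolyXY n →ₐ[ℝ] L),
      (∀ v, ψ (den v) ≠ 0) →
        ψ B ≠ 0 ∧ ψ U = MvPolynomial.aeval (fun v => ψ (num v) / ψ (den v)) G * ψ B := by
  induction G using MvPolynomial.induction_on with
  | C a =>
    refine ⟨MvPolynomial.C a, 1, fun L _ _ ψ h => ⟨by simp, ?_⟩⟩
    rw [MvPolynomial.aeval_C, map_one, mul_one, ← MvPolynomial.algebraMap_eq, AlgHom.commutes]
  | add p q hp hq =>
    obtain ⟨U, B, h⟩ := hp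
    obtain ⟨U', B', h'⟩ := hq
    refine ⟨U * B' + U' * B, B * B', fun L _ _ ψ hψ => ?_⟩
    obtain ⟨h1, h2⟩ := h L ψ hψ
    obtain ⟨h1', h2'⟩ := h' L ψ hψ
    rw [map_mul, map_add, map_mul, map_mul, map_add, h2, h2']
    exact ⟨mul_ne_zero h1 h1', by ring⟩
  | mul_X p v hp =>
    obtain ⟨U, B, h⟩ := hp
    refine ⟨U * num v, B * den v, fun L _ _ ψ hψ => ?_⟩
    obtain ⟨h1, h2⟩ := h L ψ hψ
    rw [map_mul, map_mul, map_mul, h2, MvPolynomial.aeval_X]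
    refine ⟨mul_ne_zero h1 (hψ v), ?_⟩
    have := hψ v
    field_simp

/-- The function `g ∘ π` is the quotient `N / D` on the torus. -/
def Represents (k : ℕ) (g : RatFun n) (N D : PolyXY n) : Prop :=
  ∀ pt : Var n → ℝ, (∀ v, pt v ≠ 0) →
    MvPolynomial.eval pt N * MvPolynomial.eval (projF k pt) g.den =
      MvPolynomial.eval pt D * MvPolynomial.eval (projF k pt) g.num

theorem one_mem_levelSet : (1 : SpacePQ n) ∈ levelSet n := by
  change prodPQ _ = 1
  simp [prodPQ]

theorem represents_of_pullback (k : ℕ) (g : RatFun n) (N D : PolyXY n) (hD : D ≠ 0)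
    (h : algebraMap (PolyXY n) (FieldXY n) N / algebraMap (PolyXY n) (FieldXY n) D =
      g.pullback k) : Represents k g N D := by
  set num : Var n → PolyXY n := Sum.elim yVar (fun i => xVar (i + r k + 1)) with hnum
  set den : Var n → PolyXY n := Sum.elim xVar (fun i => yVar (i + r k)) with hden
  have hproj : ∀ (L : Type) [Field L] [Algebra ℝ L] (ψ : PolyXY n →ₐ[ℝ] L),
      (fun v => ψ (num v) / ψ (den v)) = projF k (fun v => ψ (MvPolynomial.X v)) := by
    intro L _ _ ψ
    funext v
    rcases v with i | i <;> rfl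
  obtain ⟨U, B, hU⟩ := exists_clear_denominators num den g.num
  obtain ⟨U', B', hU'⟩ := exists_clear_denominators num den g.den
  have hdenR : ∀ pt : Var n → ℝ, (∀ v, pt v ≠ 0) → ∀ v, MvPolynomial.aeval pt (den v) ≠ 0 := by
    intro pt hpt v
    rcases v with i | i <;> simp [hden, xVar, yVar, hpt]
  have hR : ∀ (pt : Var n → ℝ), (∀ v, pt v ≠ 0) →
      (MvPolynomial.eval pt B ≠ 0 ∧
        MvPolynomial.eval pt U = MvPolynomial.eval (projF k pt) g.num * MvPolynomial.eval pt B) ∧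
      (MvPolynomial.eval pt B' ≠ 0 ∧
        MvPolynomial.eval pt U' = MvPolynomial.eval (projF k pt) g.den * MvPolynomial.eval pt B') := by
    intro pt hpt
    have h1 := hU ℝ (MvPolynomial.aeval pt) (hdenR pt hpt)
    have h2 := hU' ℝ (MvPolynomial.aeval pt) (hdenR pt hpt)
    rw [hproj] at h1 h2
    simp only [MvPolynomial.aeval_X, MvPolynomial.aeval_eq_eval] at h1 h2
    exact ⟨h1, h2⟩
  have hinj : Function.Injective (algebraMap (PolyXY n) (FieldXY n)) :=
    IsFractionRing.injective _ _
  have hne : ∀ P : PolyXY n, P ≠ 0 → algebraMap (PolyXY n) (FieldXY n) P ≠ 0 := fun P hP => by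
    rwa [Ne, map_eq_zero_iff _ hinj]
  -- A regular point of g on S lifts through the section to a point where U' does not vanish; hence
  -- the denominator of the pull-back is nonzero and the division in `RatFun.pullback` is a genuine
  -- one.
  have hU'0 : U' ≠ 0 := by
    intro h0
    obtain ⟨s, hs, hsd⟩ : {s | s ∈ levelSet n ∧ MvPolynomial.eval s g.den ≠ 0}.Nonempty :=
      closure_nonempty_iff.mp ⟨1, g.dense_dom one_mem_levelSet⟩
    have := (hR (sec k s) (sec_ne_zero k hs)).2
    rw [projF_sec k hs, h0, map_zero] at this
    exact mul_ne_zero hsd this.1 this.2.symm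
  let ψ : PolyXY n →ₐ[ℝ] FieldXY n := IsScalarTower.toAlgHom ℝ (PolyXY n) (FieldXY n)
  have hψ : ∀ P, ψ P = algebraMap (PolyXY n) (FieldXY n) P := fun P => rfl
  have hdenF : ∀ v, ψ (den v) ≠ 0 := by
    intro v
    rcases v with i | i <;> exact hne _ (MvPolynomial.X_ne_zero _)
  have h1 := hU (FieldXY n) ψ hdenF
  have h2 := hU' (FieldXY n) ψ hdenF
  rw [hproj] at h1 h2
  simp only [hψ] at h1 h2
  rw [← proj_eq] at h1 h2
  rw [RatFun.pullback] at h
  have hden0 : MvPolynomial.aeval (proj n k) g.den ≠ 0 := by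
    intro h0
    rw [h0, zero_mul] at h2
    exact hne _ hU'0 h2.2
  have hpoly : N * U' * B = D * U * B' := by
    apply hinj
    rw [div_eq_div_iff (hne _ hD) hden0] at h
    simp only [map_mul, h1.2, h2.2]
    linear_combination (algebraMap (PolyXY n) (FieldXY n) B) *
      (algebraMap (PolyXY n) (FieldXY n) B') * h
  intro pt hpt
  obtain ⟨⟨h3, h4⟩, h5, h6⟩ := hR pt hpt
  have h7 := congrArg (MvPolynomial.eval pt) hpoly
  simp only [map_mul, h4, h6] at h7
  apply mul_right_cancel₀ (mul_ne_zero h3 h5)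
  linear_combination h7

theorem eval_aeval_sec (k : ℕ) (s : SpacePQ n) (U : PolyXY n) :
    MvPolynomial.eval s (MvPolynomial.aeval (sec k MvPolynomial.X) U) =
      MvPolynomial.eval (sec k s) U := by
  have h := DFunLike.congr_fun (MvPolynomial.comp_aeval (sec (n := n) k
    (MvPolynomial.X : Var n → PolyXY n)) (MvPolynomial.aeval (R := ℝ) s)) U
  rw [AlgHom.comp_apply] at h
  rw [← MvPolynomial.aeval_eq_eval, h]
  have : (fun v => MvPolynomial.aeval (R := ℝ) s (sec k (MvPolynomial.X : Var n → PolyXY n) v)) =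
      sec k s := by
    funext v
    have := map_sec (MvPolynomial.aeval (R := ℝ) s).toRingHom k
      (MvPolynomial.X : Var n → PolyXY n) v
    simpa using this
  rw [this]
  rfl

theorem eval_sec_projF (k d : ℕ) {V : PolyXY n} (hV : V.IsHomogeneous d) {pt : Var n → ℝ}
    (hpt : ∀ v, pt v ≠ 0) : MvPolynomial.eval (projF k pt)
      (MvPolynomial.aeval (sec k MvPolynomial.X) V) =
      ((pt (Sum.inl 0))⁻¹) ^ d * MvPolynomial.eval pt V := by
  rw [eval_aeval_sec, sec_projF k pt hpt, eval_smul_of_isHomogeneous hV]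

/-- The rational function on the level set defined by a quotient of homogeneous polynomials of the
same degree. -/
def descend (k d : ℕ) (U V : PolyXY n) (hV : V.IsHomogeneous d) (hV0 : V ≠ 0) : RatFun n where
  num := MvPolynomial.aeval (sec k MvPolynomial.X) U
  den := MvPolynomial.aeval (sec k MvPolynomial.X) V
  dense_dom := by
    intro s hs
    refine closure_mono ?_ (levelSet_subset_closure_projF k hV0 hs)
    rintro _ ⟨pt, ⟨hpt, hptV⟩, rfl⟩
    refine ⟨projF_mem_levelSet k hpt, ?_⟩
    rw [eval_sec_projF k d hV hpt]
    exact mul_ne_zero (pow_ne_zero _ (inv_ne_zero (hpt _))) hptV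

/-- Composed with π, the section is scaling by 1/x_0, so numerator and denominator both acquire the
factor x_0^{-d}. -/
theorem pullback_descend (k d : ℕ) (U V : PolyXY n) (hU : U.IsHomogeneous d)
    (hV : V.IsHomogeneous d) (hV0 : V ≠ 0) : (descend k d U V hV hV0).pullback k =
      algebraMap (PolyXY n) (FieldXY n) U / algebraMap (PolyXY n) (FieldXY n) V := by
  have hinj : Function.Injective (algebraMap (PolyXY n) (FieldXY n)) :=
    IsFractionRing.injective _ _
  set x₀ : FieldXY n := algebraMap (PolyXY n) (FieldXY n) (MvPolynomial.X (Sum.inl 0))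
  have hne : ∀ v : Var n, algebraMap (PolyXY n) (FieldXY n) (MvPolynomial.X v) ≠ 0 := fun v => by
    rw [Ne, map_eq_zero_iff _ hinj]; exact MvPolynomial.X_ne_zero v
  have key : ∀ W : PolyXY n, W.IsHomogeneous d →
      MvPolynomial.aeval (proj n k) (MvPolynomial.aeval (sec k (MvPolynomial.X : Var n → PolyXY n)) W) =
        x₀⁻¹ ^ d * algebraMap (PolyXY n) (FieldXY n) W := by
    intro W hW
    have h := DFunLike.congr_fun (MvPolynomial.comp_aeval (sec (n := n) k
      (MvPolynomial.X : Var n → PolyXY n)) (MvPolynomial.aeval (R := ℝ) (proj n k))) W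
    rw [AlgHom.comp_apply] at h
    rw [h]
    have : (fun v => MvPolynomial.aeval (R := ℝ) (proj n k)
        (sec k (MvPolynomial.X : Var n → PolyXY n) v)) =
        fun v => x₀⁻¹ * algebraMap (PolyXY n) (FieldXY n) (MvPolynomial.X v) := by
      funext v
      have h1 := map_sec (MvPolynomial.aeval (R := ℝ) (proj n k)).toRingHom k
        (MvPolynomial.X : Var n → PolyXY n) v
      have h2 := congrFun (sec_projF k
        (fun v => algebraMap (PolyXY n) (FieldXY n) (MvPolynomial.X v)) hne) v
      rw [← proj_eq] at h2
      simp only [AlgHom.toRingHom_eq_coe, RingHom.coe_coe, MvPolynomial.aeval_X] at h1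
      rw [h1, h2]
      rfl
    rw [this]
    conv_rhs => rw [W.as_sum]
    conv_lhs => rw [W.as_sum]
    rw [map_sum, map_sum, Finset.mul_sum]
    refine Finset.sum_congr rfl fun e he => ?_
    have h1 := hW (MvPolynomial.mem_support_iff.mp he)
    have h2 : Finsupp.weight 1 e = e.degree := (Finsupp.degree_eq_weight_one (R := ℕ)).symm ▸ rfl
    rw [h2, Finsupp.degree_eq_sum] at h1
    rw [MvPolynomial.aeval_monomial, Finsupp.prod_fintype _ _ (by simp)]
    simp only [mul_pow, Finset.prod_mul_distrib]
    rw [Finset.prod_pow_eq_pow_sum, h1, MvPolynomial.monomial_eq, map_mul,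
      Finsupp.prod_fintype _ _ (by simp), map_prod]
    simp only [map_pow]
    rw [← MvPolynomial.algebraMap_eq, ← IsScalarTower.algebraMap_apply]
    ring
  rw [RatFun.pullback]
  simp only [descend]
  rw [key U hU, key V hV, mul_div_mul_left]
  exact pow_ne_zero _ (inv_ne_zero (hne _))

end Projection

/-! ### The pentagram map and the descent of the integrals -/

section Descent

variable {n : ℕ} [NeZero n]

/-- The algebra of polynomials in the `I_{ij}`. -/
def algI (n k : ℕ) : Subalgebra ℝ (PolyXY n) :=
  Algebra.adjoin ℝ (Set.range fun ij : ℕ × ℕ => I n k ij.1 ij.2)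

theorem exists_div_of_isRationalInI (k : ℕ) {f : FieldXY n} (hf : IsRationalInI n k f) :
    ∃ N ∈ algI n k, ∃ D ∈ algI n k, D ≠ 0 ∧
      algebraMap (PolyXY n) (FieldXY n) N / algebraMap (PolyXY n) (FieldXY n) D = f := by
  obtain ⟨a, b, hab⟩ := (IntermediateField.mem_adjoin_range_iff ℝ _ _).mp hf
  have key : ∀ a : MvPolynomial (ℕ × ℕ) ℝ, MvPolynomial.aeval (fun ij : ℕ × ℕ =>
      algebraMap (PolyXY n) (FieldXY n) (I n k ij.1 ij.2)) a =
      algebraMap (PolyXY n) (FieldXY n)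
        (MvPolynomial.aeval (fun ij : ℕ × ℕ => I n k ij.1 ij.2) a) := fun a =>
    MvPolynomial.aeval_algebraMap_apply (FieldXY n) (fun ij : ℕ × ℕ => I n k ij.1 ij.2) a
  have hmem : ∀ a : MvPolynomial (ℕ × ℕ) ℝ,
      MvPolynomial.aeval (fun ij : ℕ × ℕ => I n k ij.1 ij.2) a ∈ algI n k := by
    intro a
    rw [algI, Algebra.adjoin_range_eq_range_aeval]
    exact ⟨a, rfl⟩
  rw [key, key] at hab
  -- A relation among the I_ij may annihilate the denominator; division by zero then gives f = 0,
  -- which is rewritten as 0 / 1.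
  by_cases hb : MvPolynomial.aeval (fun ij : ℕ × ℕ => I n k ij.1 ij.2) b = 0
  · refine ⟨0, zero_mem _, 1, one_mem _, one_ne_zero, ?_⟩
    rw [hab, hb, map_zero, zero_div, div_zero]
  · exact ⟨_, hmem a, _, hmem b, hb, hab.symm⟩

/-- The higher pentagram map in the `(x, y)`-coordinates. -/
def pent (k : ℕ) (pt : Var n → ℝ) : Var n → ℝ :=
  Sum.elim
    (fun i => xs pt (i - r' k - 1) * (xs pt (i + r k) + ys pt (i + r k)) /
      (xs pt (i - r' k - 1) + ys pt (i - r' k - 1)))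
    (fun i => ys pt (i - r' k) * (xs pt (i + r k + 1) + ys pt (i + r k + 1)) /
      (xs pt (i - r' k) + ys pt (i - r' k)))

/-- `pent` is the refactorization map for m = k - 1 followed by renumbering by r + 1, and both
preserve the determinant. -/
theorem eval_I_pent (k : ℕ) (hk : 2 ≤ k) (hkn : k ≤ n) (pt : Var n → ℝ)
    (h : ∀ i, xs pt i + ys pt i ≠ 0) (i j : ℕ) :
    MvPolynomial.eval (pent k pt) (I n k i j) = MvPolynomial.eval pt (I n k i j) := by
  rw [eval_I_eq_of_det_eq k hk hkn pt (pent k pt) 1 _ i j, one_pow, one_mul]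
  intro lam ζ h0 h1
  rw [one_mul]
  refine Eq.trans ?_ ((det_diffMatrix_comp_add (k - 1) (r k + 1) _ _ lam ζ h0).trans
    (det_diffMatrix_refactorization (k - 1) (xs pt) (ys pt) lam ζ h0 h1 h))
  have e1 : ∀ i : ZMod n, i + ((r k + 1 : ℕ) : ZMod n) - ((k - 1 : ℕ) : ZMod n) = i - r' k := by
    intro i
    rw [← r_add_r' k hk]; push_cast; ring
  have e2 : ∀ i : ZMod n, i + ((r k + 1 : ℕ) : ZMod n) = i + r k + 1 := by
    intro i; push_cast; ring
  congr 2
  · funext i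
    simp only [e1]
    simp only [e2, add_sub_cancel_right]
    rfl
  · funext i
    simp only [e1]
    simp only [e2]
    rfl

theorem eval_pent_of_mem_algI (k : ℕ) (hk : 2 ≤ k) (hkn : k ≤ n) (pt : Var n → ℝ)
    (h : ∀ i, xs pt i + ys pt i ≠ 0) {N : PolyXY n} (hN : N ∈ algI n k) :
    MvPolynomial.eval (pent k pt) N = MvPolynomial.eval pt N := by
  induction hN using Algebra.adjoin_induction with
  | mem x hx =>
    obtain ⟨ij, rfl⟩ := hx
    exact eval_I_pent k hk hkn pt h _ _
  | algebraMap a => simp [MvPolynomial.algebraMap_eq]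
  | add x y _ _ hx hy => rw [map_add, map_add, hx, hy]
  | mul x y _ _ hx hy => rw [map_mul, map_mul, hx, hy]

theorem r'_of_even (k : ℕ) (hk : 2 ≤ k) (h : Even k) : r' k = r k := by
  have h1 : r k = k / 2 - 1 := rfl
  have h2 : r' k = k - 2 - r k := rfl
  obtain ⟨a, rfl⟩ := h
  omega

theorem r'_of_odd (k : ℕ) (hk : 2 ≤ k) (h : ¬Even k) : r' k = r k + 1 := by
  have h1 : r k = k / 2 - 1 := rfl
  have h2 : r' k = k - 2 - r k := rfl
  obtain ⟨a, rfl⟩ := Nat.not_even_iff_odd.mp h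
  omega

/-- Written with r', the two parities share one formula, since r' = r for even k and r' = r + 1 for
odd k. -/
theorem Tbar_inl (k : ℕ) (hk : 2 ≤ k) (s : SpacePQ n) (i : ZMod n) : Tbar k s (Sum.inl i) =
    s (Sum.inr i) * ((1 + s (Sum.inl (i - r' k - 1))) * (1 + s (Sum.inl (i + r k + 1))) *
      s (Sum.inl (i - r' k)) * s (Sum.inl (i + r k))) /
      ((1 + s (Sum.inl (i - r' k))) * (1 + s (Sum.inl (i + r k)))) := by
  by_cases h : Even k
  · rw [r'_of_even k hk h, Tbar, if_pos h]
    rfl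
  · have e1 : i - ((r k + 1 : ℕ) : ZMod n) - 1 = i - r k - 2 := by push_cast; ring
    have e2 : i - ((r k + 1 : ℕ) : ZMod n) = i - r k - 1 := by push_cast; ring
    rw [r'_of_odd k hk h, e1, e2, Tbar, if_neg h]
    rfl

theorem Tbar_inr (k : ℕ) (hk : 2 ≤ k) (s : SpacePQ n) (i : ZMod n) :
    Tbar k s (Sum.inr i) = 1 / s (Sum.inl (i + r k - r' k)) := by
  by_cases h : Even k
  · rw [r'_of_even k hk h, Tbar, if_pos h, add_sub_cancel_right]
    rfl
  · have e1 : i + (r k : ZMod n) - ((r k + 1 : ℕ) : ZMod n) = i - 1 := by push_cast; ring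
    rw [r'_of_odd k hk h, e1, Tbar, if_neg h]
    rfl

theorem Tbar_projF (k : ℕ) (hk : 2 ≤ k) (pt : Var n → ℝ) (hpt : ∀ v, pt v ≠ 0)
    (h : ∀ i, xs pt i + ys pt i ≠ 0) : Tbar k (projF k pt) = projF k (pent k pt) := by
  have hp : ∀ i, 1 + pt (Sum.inr i) / pt (Sum.inl i) = (xs pt i + ys pt i) / xs pt i := by
    intro i
    have := hpt (Sum.inl i)
    simp only [xs, ys]
    field_simp
  have hx : ∀ i, xs pt i ≠ 0 := fun i => hpt _
  have hy : ∀ i, ys pt i ≠ 0 := fun i => hpt _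
  funext v
  rcases v with i | i
  · rw [Tbar_inl k hk]
    simp only [projF, Sum.elim_inl, Sum.elim_inr, hp]
    change xs pt _ / ys pt _ * (_ * (ys pt _ / xs pt _) * (ys pt _ / xs pt _)) / _ = _
    simp only [pent, Sum.elim_inl, Sum.elim_inr]
    have a1 := hx (i - r' k - 1)
    have a2 := hx (i - r' k)
    have a3 := hx (i + r k)
    have a4 := hx (i + r k + 1)
    have b1 := hy (i - r' k - 1)
    have b2 := hy (i - r' k)
    have b3 := hy (i + r k)
    have b4 := hy (i + r k + 1)
    have c1 := h (i - r' k - 1)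
    have c2 := h (i - r' k)
    have c3 := h (i + r k)
    have c4 := h (i + r k + 1)
    generalize xs pt (i - r' k - 1) + ys pt (i - r' k - 1) = h1 at *
    generalize xs pt (i - r' k) + ys pt (i - r' k) = h2 at *
    generalize xs pt (i + r k) + ys pt (i + r k) = h3 at *
    generalize xs pt (i + r k + 1) + ys pt (i + r k + 1) = h4 at *
    field_simp
  · rw [Tbar_inr k hk]
    simp only [projF, Sum.elim_inl, Sum.elim_inr, pent]
    rw [show i + (r k : ZMod n) + 1 - r' k - 1 = i + r k - r' k by ring,
      show i + (r k : ZMod n) + 1 + r k = i + r k + r k + 1 by ring]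
    change 1 / (ys pt _ / xs pt _) = _
    have a1 := hx (i + r k - r' k)
    have b1 := hy (i + r k - r' k)
    have c1 := h (i + r k - r' k)
    have c2 := h (i + r k + r k + 1)
    generalize xs pt (i + r k - r' k) + ys pt (i + r k - r' k) = h1 at *
    generalize xs pt (i + r k + r k + 1) + ys pt (i + r k + r k + 1) = h2 at *
    field_simp

theorem pent_ne_zero (k : ℕ) (pt : Var n → ℝ) (hpt : ∀ v, pt v ≠ 0)
    (h : ∀ i, xs pt i + ys pt i ≠ 0) (v : Var n) : pent k pt v ≠ 0 := by
  rcases v with i | i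
  · exact div_ne_zero (mul_ne_zero (hpt _) (h _)) (h _)
  · exact div_ne_zero (mul_ne_zero (hpt _) (h _)) (h _)

/-- The inverse of the map `T̄_k`. -/
def TbarInv (k : ℕ) (t : SpacePQ n) : SpacePQ n :=
  let p : ZMod n → ℝ := fun i => 1 / t (Sum.inr (i - r k + r' k))
  Sum.elim p (fun i => t (Sum.inl i) * ((1 + p (i - r' k)) * (1 + p (i + r k))) /
    ((1 + p (i - r' k - 1)) * (1 + p (i + r k + 1)) * p (i - r' k) * p (i + r k)))

theorem TbarInv_Tbar (k : ℕ) (hk : 2 ≤ k) (s : SpacePQ n) (hs : ∀ i, s (Sum.inl i) ≠ 0)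
    (h : ∀ i, 1 + s (Sum.inl i) ≠ 0) : TbarInv k (Tbar k s) = s := by
  have hp : ∀ i : ZMod n, 1 / Tbar k s (Sum.inr (i - r k + r' k)) = s (Sum.inl i) := by
    intro i
    rw [Tbar_inr k hk, one_div_one_div]
    congr 2; ring
  funext v
  rcases v with i | i
  · exact hp i
  · simp only [TbarInv, Sum.elim_inr, hp, Tbar_inl k hk]
    have a1 := hs (i - r' k)
    have a2 := hs (i + r k)
    have b1 := h (i - r' k)
    have b2 := h (i + r k)
    have b3 := h (i - r' k - 1)
    have b4 := h (i + r k + 1)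
    generalize 1 + s (Sum.inl (i - r' k)) = h1 at *
    generalize 1 + s (Sum.inl (i + r k)) = h2 at *
    generalize 1 + s (Sum.inl (i - r' k - 1)) = h3 at *
    generalize 1 + s (Sum.inl (i + r k + 1)) = h4 at *
    field_simp

theorem Tbar_TbarInv (k : ℕ) (hk : 2 ≤ k) (t : SpacePQ n) (ht : ∀ v, t v ≠ 0)
    (h : ∀ i, 1 + TbarInv k t (Sum.inl i) ≠ 0) : Tbar k (TbarInv k t) = t := by
  have hs : ∀ i, TbarInv k t (Sum.inl i) ≠ 0 := fun i => one_div_ne_zero (ht _)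
  funext v
  rcases v with i | i
  · have e : TbarInv k t (Sum.inr i) = t (Sum.inl i) * ((1 + TbarInv k t (Sum.inl (i - r' k))) *
        (1 + TbarInv k t (Sum.inl (i + r k)))) / ((1 + TbarInv k t (Sum.inl (i - r' k - 1))) *
        (1 + TbarInv k t (Sum.inl (i + r k + 1))) * TbarInv k t (Sum.inl (i - r' k)) *
        TbarInv k t (Sum.inl (i + r k))) := rfl
    rw [Tbar_inl k hk, e]
    have a1 := hs (i - r' k)
    have a2 := hs (i + r k)
    have b1 := h (i - r' k)
    have b2 := h (i + r k)
    have b3 := h (i - r' k - 1)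
    have b4 := h (i + r k + 1)
    generalize 1 + TbarInv k t (Sum.inl (i - r' k)) = h1 at *
    generalize 1 + TbarInv k t (Sum.inl (i + r k)) = h2 at *
    generalize 1 + TbarInv k t (Sum.inl (i - r' k - 1)) = h3 at *
    generalize 1 + TbarInv k t (Sum.inl (i + r k + 1)) = h4 at *
    field_simp
  · rw [Tbar_inr k hk]
    simp only [TbarInv, Sum.elim_inl]
    rw [one_div_one_div]
    congr 2; ring

theorem prodPQ_Tbar (k : ℕ) (hk : 2 ≤ k) (s : SpacePQ n) (hs : ∀ i, s (Sum.inl i) ≠ 0)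
    (h : ∀ i, 1 + s (Sum.inl i) ≠ 0) : prodPQ (Tbar k s) = prodPQ s := by
  simp only [prodPQ, Tbar_inl k hk, Tbar_inr k hk]
  have h1 : ∀ (f : ZMod n → ℝ) (c d : ZMod n), ∏ i, f (i + c - d) = ∏ i, f i := by
    intro f c d
    simp only [add_sub_assoc]
    exact prod_add_right f _
  have h2 : ∀ (f : ZMod n → ℝ) (c : ZMod n), ∏ i, f (i - c) = ∏ i, f i := by
    intro f c
    simp only [sub_eq_add_neg]
    exact prod_add_right f _
  have h3 : ∀ (f : ZMod n → ℝ) (c d : ZMod n), ∏ i, f (i + c + d) = ∏ i, f i := by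
    intro f c d
    simp only [add_assoc]
    exact prod_add_right f _
  have h4 : ∀ (f : ZMod n → ℝ) (c d : ZMod n), ∏ i, f (i - c - d) = ∏ i, f i := by
    intro f c d
    simp only [sub_sub]
    exact h2 f _
  simp only [Finset.prod_mul_distrib, Finset.prod_div_distrib, Finset.prod_const_one]
  rw [h1 (fun i => s (Sum.inl i)), h2 (fun i => s (Sum.inl i)),
    prod_add_right (fun i : ZMod n => s (Sum.inl i)), h4 (fun i => 1 + s (Sum.inl i)),
    h3 (fun i => 1 + s (Sum.inl i)), h2 (fun i => 1 + s (Sum.inl i)),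
    prod_add_right (fun i : ZMod n => 1 + s (Sum.inl i))]
  have a1 : ∏ i : ZMod n, s (Sum.inl i) ≠ 0 := Finset.prod_ne_zero_iff.mpr fun i _ => hs i
  have a2 : ∏ i : ZMod n, (1 + s (Sum.inl i)) ≠ 0 := Finset.prod_ne_zero_iff.mpr fun i _ => h i
  field_simp

theorem continuousAt_Tbar (k : ℕ) (hk : 2 ≤ k) (s : SpacePQ n) (hs : ∀ i, s (Sum.inl i) ≠ 0)
    (h : ∀ i, 1 + s (Sum.inl i) ≠ 0) : ContinuousAt (Tbar k) s := by
  refine continuousAt_pi.mpr fun v => ?_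
  rcases v with i | i
  · simp only [Tbar_inl k hk]
    exact ContinuousAt.div (by fun_prop) (by fun_prop) (mul_ne_zero (h _) (h _))
  · simp only [Tbar_inr k hk]
    exact ContinuousAt.div continuousAt_const (continuous_apply _).continuousAt (hs _)

theorem continuousAt_TbarInv (k : ℕ) (t : SpacePQ n) (ht : ∀ v, t v ≠ 0)
    (h : ∀ i, 1 + TbarInv k t (Sum.inl i) ≠ 0) : ContinuousAt (TbarInv k) t := by
  have hp : ∀ i : ZMod n, ContinuousAt (fun t : SpacePQ n => 1 / t (Sum.inr i)) t := fun i =>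
    ContinuousAt.div continuousAt_const (continuous_apply _).continuousAt (ht _)
  have hp1 : ∀ i : ZMod n, ContinuousAt (fun t : SpacePQ n => 1 + 1 / t (Sum.inr i)) t := fun i =>
    continuousAt_const.add (hp i)
  refine continuousAt_pi.mpr fun v => ?_
  rcases v with i | i
  · exact hp _
  · simp only [TbarInv, Sum.elim_inr]
    refine ContinuousAt.div (ContinuousAt.mul (continuous_apply _).continuousAt ((hp1 _).mul (hp1 _)))
      ((((hp1 _).mul (hp1 _)).mul (hp _)).mul (hp _)) ?_
    exact mul_ne_zero (mul_ne_zero (mul_ne_zero (h _) (h _)) (one_div_ne_zero (ht _)))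
      (one_div_ne_zero (ht _))

/-- The product of the polynomials `x_i + y_i`. -/
def prodSum (n : ℕ) [NeZero n] : PolyXY n := ∏ i : ZMod n, (xVar i + yVar i)

theorem eval_prodSum_ne_zero (pt : Var n → ℝ) :
    MvPolynomial.eval pt (prodSum n) ≠ 0 ↔ ∀ i, xs pt i + ys pt i ≠ 0 := by
  simp [prodSum, map_prod, Finset.prod_ne_zero_iff, xVar, yVar, xs, ys]

theorem prodSum_ne_zero : prodSum n ≠ 0 := by
  intro h
  have : MvPolynomial.eval (1 : Var n → ℝ) (prodSum n) ≠ 0 := by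
    rw [eval_prodSum_ne_zero]
    intro i
    simp only [xs, ys, Pi.one_apply]
    norm_num
  exact this (by rw [h, map_zero])

theorem dense_TbarDomain : levelSet n ⊆ closure (TbarDomain n) := by
  refine (levelSet_subset_closure_projF 2 prodSum_ne_zero).trans (closure_mono ?_)
  rintro _ ⟨pt, ⟨hpt, h⟩, rfl⟩
  refine ⟨projF_mem_levelSet _ hpt, fun i => ?_⟩
  have h1 := (eval_prodSum_ne_zero pt).mp h i
  have h2 := hpt (Sum.inl i)
  simp only [projF, Sum.elim_inl]
  rw [one_add_div h2]
  exact div_ne_zero h1 h2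

theorem isOpen_regular (P : MvPolynomial (Var n) ℝ) :
    IsOpen {s : SpacePQ n | MvPolynomial.eval s P ≠ 0} :=
  isOpen_ne_fun (MvPolynomial.continuous_eval P) continuous_const

/-- Upstairs g ∘ π is N / D with N and D fixed by `pent`, so the identity holds on a dense set and
extends by continuity after clearing denominators. Density of the domain uses that T̄_k has a
continuous local inverse preserving S. -/
theorem isIntegral_of_represents (k : ℕ) (hk : 2 ≤ k) (hkn : k ≤ n) (g : RatFun n)
    {N D : PolyXY n} (hN : N ∈ algI n k) (hD : D ∈ algI n k) (hD0 : D ≠ 0)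
    (h : Represents k g N D) : IsIntegral k g := by
  constructor
  · intro s hs
    rw [mem_closure_iff]
    intro o ho hso
    obtain ⟨s₁, hs₁o, hs₁, hs₁p⟩ := mem_closure_iff.mp (dense_TbarDomain hs) o ho hso
    have hop : IsOpen {s : SpacePQ n | ∀ i : ZMod n, 1 + s (Sum.inl i) ≠ 0} := by
      simp only [Set.ofPred_forall]
      exact isOpen_iInter_of_finite fun i => isOpen_ne_fun (by fun_prop) continuous_const
    obtain ⟨s₂, ⟨hs₂o, hs₂p⟩, hs₂, hs₂d⟩ :=
      mem_closure_iff.mp (g.dense_dom hs₁) _ (ho.inter hop) ⟨hs₁o, hs₁p⟩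
    have hs₂0 : ∀ i, s₂ (Sum.inl i) ≠ 0 := fun i => ne_zero_of_mem_levelSet hs₂ _
    have ht₂ : Tbar k s₂ ∈ levelSet n := (prodPQ_Tbar k hk s₂ hs₂0 hs₂p).trans hs₂
    have hinv := TbarInv_Tbar k hk s₂ hs₂0 hs₂p
    have hcont : ContinuousAt (TbarInv k) (Tbar k s₂) :=
      continuousAt_TbarInv k _ (ne_zero_of_mem_levelSet ht₂) (by rw [hinv]; exact hs₂p)
    have hnhds : TbarInv k ⁻¹' ((o ∩ {s : SpacePQ n | ∀ i : ZMod n, 1 + s (Sum.inl i) ≠ 0}) ∩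
        {s | MvPolynomial.eval s g.den ≠ 0}) ∈ 𝓝 (Tbar k s₂) := by
      refine hcont.preimage_mem_nhds ?_
      rw [hinv]
      exact ((ho.inter hop).inter (isOpen_regular g.den)).mem_nhds ⟨⟨hs₂o, hs₂p⟩, hs₂d⟩
    -- The image of s₂ is moved slightly within S to a regular point of g, and its preimage stays in
    -- the given neighbourhood and in the regular set.
    obtain ⟨t₃, ⟨⟨ho₃, hp₃⟩, hd₃⟩, ht₃, hreg₃⟩ :=
      mem_closure_iff_nhds.mp (g.dense_dom ht₂) _ hnhds
    have hback := Tbar_TbarInv k hk t₃ (ne_zero_of_mem_levelSet ht₃) hp₃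
    refine ⟨TbarInv k t₃, ho₃, ⟨?_, hp₃⟩, hd₃, ?_⟩
    · change prodPQ _ = 1
      rw [← prodPQ_Tbar k hk _ (fun i => one_div_ne_zero (ne_zero_of_mem_levelSet ht₃ _)) hp₃, hback]
      exact ht₃
    · rw [hback]; exact hreg₃
  · rintro s ⟨hs, hsp⟩ hreg hreg'
    have hs0 : ∀ v, s v ≠ 0 := ne_zero_of_mem_levelSet hs
    set pt₀ := sec k s with hpt₀
    have hproj : projF k pt₀ = s := projF_sec k hs
    set W : (Var n → ℝ) → ℝ := fun pt =>
      MvPolynomial.eval (Tbar k (projF k pt)) g.num * MvPolynomial.eval (projF k pt) g.den -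
        MvPolynomial.eval (projF k pt) g.num * MvPolynomial.eval (Tbar k (projF k pt)) g.den with hW
    have hWc : ContinuousAt W pt₀ := by
      have c1 : ContinuousAt (projF k) pt₀ := continuousAt_projF k (sec_ne_zero k hs)
      have c2 : ContinuousAt (fun pt => Tbar k (projF k pt)) pt₀ :=
        ContinuousAt.comp (g := Tbar k) (by
          rw [hproj]; exact continuousAt_Tbar k hk s (fun i => hs0 _) hsp) c1
      have c3 : ∀ P : MvPolynomial (Var n) ℝ,
          ContinuousAt (fun pt => MvPolynomial.eval (projF k pt) P) pt₀ := fun P =>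
        (MvPolynomial.continuous_eval P).continuousAt.comp c1
      have c4 : ∀ P : MvPolynomial (Var n) ℝ,
          ContinuousAt (fun pt => MvPolynomial.eval (Tbar k (projF k pt)) P) pt₀ := fun P =>
        (MvPolynomial.continuous_eval P).continuousAt.comp c2
      exact ((c4 _).mul (c3 _)).sub ((c3 _).mul (c4 _))
    have hW0 : W pt₀ = 0 := by
      have hcl := mem_closure_image hWc (mem_closure_eval_ne_zero
        (mul_ne_zero (mul_ne_zero monomialAll_ne_zero prodSum_ne_zero) hD0) pt₀)
      have hsub : W '' {pt | MvPolynomial.eval pt (monomialAll n * prodSum n * D) ≠ 0} ⊆ {0} := by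
        rintro _ ⟨pt, hpt, rfl⟩
        simp only [Set.mem_ofPred_eq, map_mul] at hpt
        have h1 := (eval_monomialAll_ne_zero pt).mp (left_ne_zero_of_mul (left_ne_zero_of_mul hpt))
        have h2 := (eval_prodSum_ne_zero pt).mp (right_ne_zero_of_mul (left_ne_zero_of_mul hpt))
        have h3 := right_ne_zero_of_mul hpt
        have e1 := h pt h1
        have e2 := h (pent k pt) (pent_ne_zero k pt h1 h2)
        rw [eval_pent_of_mem_algI k hk hkn pt h2 hN, eval_pent_of_mem_algI k hk hkn pt h2 hD,
          ← Tbar_projF k hk pt h1 h2] at e2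
        refine mul_left_cancel₀ h3 ?_
        simp only [hW, mul_zero]
        linear_combination MvPolynomial.eval (Tbar k (projF k pt)) g.den * e1 -
          MvPolynomial.eval (projF k pt) g.den * e2
      simpa using closure_mono hsub hcl
    simp only [hW, hproj] at hW0
    rw [RatFun.value, RatFun.value, div_eq_div_iff hreg' hreg]
    linear_combination hW0

theorem exists_pullback_eq (k : ℕ) {f : FieldXY n} (hf : IsHomogeneousDegreeZero f) :
    ∃ g : RatFun n, f = g.pullback k := by
  obtain ⟨d, u, v, hu, hv, hv0, rfl⟩ := hf
  exact ⟨descend k d u v hv hv0, (pullback_descend k d u v hu hv hv0).symm⟩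

theorem exists_represents (k : ℕ) {f : FieldXY n} (hf : IsRationalInI n k f) (g : RatFun n)
    (hg : f = g.pullback k) :
    ∃ N ∈ algI n k, ∃ D ∈ algI n k, D ≠ 0 ∧ Represents k g N D := by
  obtain ⟨N, hN, D, hD, hD0, h⟩ := exists_div_of_isRationalInI k hf
  exact ⟨N, hN, D, hD, hD0, represents_of_pullback k g N D hD0 (h.trans hg)⟩

end Descent

/-! ### Differentials of the descended functions -/

section Differentials

variable {n : ℕ} [NeZero n]

theorem differentiableAt_value (g : RatFun n) {s : SpacePQ n} (h : g.RegularAt s) :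
    DifferentiableAt ℝ g.value s := by
  have h1 := (hasFDerivAt_eval g.num s).differentiableAt
  have h2 := (hasFDerivAt_eval g.den s).differentiableAt
  have h3 := h1.mul (h2.inv h)
  rwa [← div_eq_mul_inv] at h3

/-- The numerator of the partial derivative of a rational function. -/
def derivNum (g : RatFun n) (v : Var n) : MvPolynomial (Var n) ℝ :=
  MvPolynomial.pderiv v g.num * g.den - g.num * MvPolynomial.pderiv v g.den

theorem sum_single_mul (v : Var n) (f : Var n → ℝ) :
    ∑ u, Pi.single (M := fun _ => ℝ) v 1 u * f u = f v := by
  rw [Finset.sum_eq_single v]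
  · simp
  · intro u _ h; simp [Pi.single_eq_of_ne h]
  · simp

theorem fderiv_value_single (g : RatFun n) {s : SpacePQ n} (h : g.RegularAt s) (v : Var n) :
    fderiv ℝ g.value s (Pi.single v 1) =
      MvPolynomial.eval s (derivNum g v) / MvPolynomial.eval s g.den ^ 2 := by
  have h0 : s + (0 : ℝ) • Pi.single (M := fun _ => ℝ) v 1 = s := by simp
  have h1 : HasDerivAt (fun t : ℝ => s + t • Pi.single (M := fun _ => ℝ) v 1) (Pi.single v 1) 0 := by
    simpa using ((hasDerivAt_id (0 : ℝ)).smul_const (Pi.single (M := fun _ => ℝ) v 1)).const_add s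
  have h2 : HasDerivAt (fun t : ℝ => g.value (s + t • Pi.single (M := fun _ => ℝ) v 1))
      (fderiv ℝ g.value s (Pi.single v 1)) 0 := by
    have hd : HasFDerivAt g.value (fderiv ℝ g.value s)
        (s + (0 : ℝ) • Pi.single (M := fun _ => ℝ) v 1) := by
      rw [h0]; exact (differentiableAt_value g h).hasFDerivAt
    exact hd.comp_hasDerivAt (0 : ℝ) h1
  have h3 := (hasDerivAt_eval_add_smul g.num s (Pi.single v 1)).div
    (hasDerivAt_eval_add_smul g.den s (Pi.single v 1)) (by rw [h0]; exact h)
  rw [sum_single_mul, sum_single_mul, h0] at h3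
  rw [h2.unique h3, derivNum, map_sub, map_mul, map_mul]

/-- The logarithmic derivative of the projection `π` in a logarithmic direction. -/
def dlog (k : ℕ) (ω : Var n → ℝ) : Var n → ℝ :=
  Sum.elim (fun i => ω (Sum.inr i) - ω (Sum.inl i))
    (fun i => ω (Sum.inl (i + r k + 1)) - ω (Sum.inr (i + r k)))

theorem dotProduct_dlog (k : ℕ) (a ω : Var n → ℝ) : a ⬝ᵥ dlog k ω = pullGrad k a ⬝ᵥ ω := by
  have h1 : ∑ i, a (Sum.inr i) * ω (Sum.inl (i + r k + 1)) =
      ∑ i, a (Sum.inr (i - r k - 1)) * ω (Sum.inl i) := by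
    rw [← sum_add_right (fun i : ZMod n => a (Sum.inr (i - r k - 1)) * ω (Sum.inl i)) (r k + 1)]
    refine Finset.sum_congr rfl fun i _ => ?_
    rw [show i + ((r k : ZMod n) + 1) - r k - 1 = i by ring, add_assoc]
  have h2 : ∑ i, a (Sum.inr i) * ω (Sum.inr (i + r k)) =
      ∑ i, a (Sum.inr (i - r k)) * ω (Sum.inr i) := by
    rw [← sum_add_right (fun i : ZMod n => a (Sum.inr (i - r k)) * ω (Sum.inr i)) (r k)]
    refine Finset.sum_congr rfl fun i _ => ?_
    rw [add_sub_cancel_right]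
  simp only [dotProduct, Fintype.sum_sum_type, dlog, pullGrad, Sum.elim_inl, Sum.elim_inr, mul_sub,
    add_mul, sub_mul, neg_mul, Finset.sum_sub_distrib, Finset.sum_add_distrib,
    Finset.sum_neg_distrib, h1, h2]
  ring

theorem fderiv_dlog (k : ℕ) (F : SpacePQ n → ℝ) (s : SpacePQ n) (ω : Var n → ℝ) :
    fderiv ℝ F s (fun u => s u * dlog k ω u) =
      pullGrad k (fun v => s v * fderiv ℝ F s (Pi.single v 1)) ⬝ᵥ ω := by
  rw [← dotProduct_dlog, dotProduct]
  have := LinearMap.pi_apply_eq_sum_univ (fderiv ℝ F s).toLinearMap (fun u => s u * dlog k ω u)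
  simp only [ContinuousLinearMap.coe_coe, smul_eq_mul] at this
  rw [this]
  refine Finset.sum_congr rfl fun v _ => ?_
  have e : (fun j : Var n => if v = j then (1 : ℝ) else 0) = Pi.single v 1 := by
    funext j
    simp [Pi.single_apply, eq_comm]
  rw [e]
  ring

theorem hasDerivAt_projF (k : ℕ) {pt : Var n → ℝ} (hpt : ∀ v, pt v ≠ 0) (ω : Var n → ℝ) :
    HasDerivAt (fun t : ℝ => projF k (pt + t • (fun v => ω v * pt v)))
      (fun u => projF k pt u * dlog k ω u) 0 := by
  have hc : ∀ v, HasDerivAt (fun t : ℝ => pt v + t * (ω v * pt v)) (ω v * pt v) 0 := by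
    intro v
    simpa using ((hasDerivAt_id (0 : ℝ)).mul_const (ω v * pt v)).const_add (pt v)
  have hq : ∀ v w, HasDerivAt (fun t : ℝ => (pt v + t * (ω v * pt v)) / (pt w + t * (ω w * pt w)))
      (pt v / pt w * (ω v - ω w)) 0 := by
    intro v w
    have h := (hc v).div (hc w) (by simpa using hpt w)
    refine h.congr_deriv ?_
    have := hpt w
    simp only [zero_mul, add_zero]
    field_simp
  rw [hasDerivAt_pi]
  intro u
  rcases u with i | i
  · exact hq (Sum.inr i) (Sum.inl i)
  · exact hq (Sum.inl (i + r k + 1)) (Sum.inr (i + r k))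

/-- The product of all p_i q_i is constantly 1 along the image of a curve under π. -/
theorem dlog_mem_tangentSpace (k : ℕ) {pt : Var n → ℝ} (hpt : ∀ v, pt v ≠ 0) (ω : Var n → ℝ) :
    (fun u => projF k pt u * dlog k ω u) ∈ tangentSpace (projF k pt) := by
  have h0 : pt + (0 : ℝ) • (fun v => ω v * pt v) = pt := by simp
  have hF : HasFDerivAt (prodPQ (n := n)) (fderiv ℝ prodPQ (projF k pt))
      (projF k (pt + (0 : ℝ) • (fun v => ω v * pt v))) := by
    rw [h0]; exact (differentiable_prodPQ _).hasFDerivAt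
  have h1 := hF.comp_hasDerivAt (0 : ℝ) (hasDerivAt_projF k hpt ω)
  have hev : ∀ᶠ t : ℝ in 𝓝 0, ∀ v, (pt + t • (fun v => ω v * pt v)) v ≠ 0 := by
    rw [eventually_all]
    intro v
    have : ContinuousAt (fun t : ℝ => pt v + t * (ω v * pt v)) 0 := by fun_prop
    exact this.eventually_ne (by simpa using hpt v)
  have h2 : HasDerivAt (fun _ : ℝ => (1 : ℝ)) (fderiv ℝ prodPQ (projF k pt)
      (fun u => projF k pt u * dlog k ω u)) 0 :=
    h1.congr_of_eventuallyEq (hev.mono fun t ht => (projF_mem_levelSet k ht).symm)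
  exact h2.unique (hasDerivAt_const 0 1)

theorem logGrad_dotProduct (pt : Var n → ℝ) (N : PolyXY n) (ω : Var n → ℝ) :
    logGrad pt N ⬝ᵥ ω =
      ∑ v, ω v * pt v * MvPolynomial.eval pt (MvPolynomial.pderiv v N) := by
  refine Finset.sum_congr rfl fun v _ => ?_
  rw [logGrad_apply]
  ring

/-- The logarithmic gradient of a rational function on the level set. -/
def logDiff (g : RatFun n) (s : SpacePQ n) : Var n → ℝ :=
  fun v => s v * fderiv ℝ g.value s (Pi.single v 1)

/-- The relation D · (g ∘ π) = N is differentiated along every logarithmic direction ω. -/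
theorem eval_smul_pullGrad (k : ℕ) (g : RatFun n) (N D : PolyXY n) (h : Represents k g N D)
    {pt : Var n → ℝ} (hpt : ∀ v, pt v ≠ 0) (hreg : g.RegularAt (projF k pt)) :
    MvPolynomial.eval pt D • pullGrad k (logDiff g (projF k pt)) =
      logGrad pt N - g.value (projF k pt) • logGrad pt D := by
  have key : ∀ ω : Var n → ℝ, MvPolynomial.eval pt D *
      (pullGrad k (logDiff g (projF k pt)) ⬝ᵥ ω) =
      logGrad pt N ⬝ᵥ ω - g.value (projF k pt) * (logGrad pt D ⬝ᵥ ω) := by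
    intro ω
    set w : Var n → ℝ := fun v => ω v * pt v with hw
    have h0 : pt + (0 : ℝ) • w = pt := by simp
    have hev1 : ∀ᶠ t : ℝ in 𝓝 0, ∀ v, (pt + t • w) v ≠ 0 := by
      rw [eventually_all]
      intro v
      have : ContinuousAt (fun t : ℝ => pt v + t * w v) 0 := by fun_prop
      exact this.eventually_ne (by simpa using hpt v)
    have hproj := hasDerivAt_projF k hpt ω
    have hev2 : ∀ᶠ t : ℝ in 𝓝 0, MvPolynomial.eval (projF k (pt + t • w)) g.den ≠ 0 := by
      have : ContinuousAt (fun t : ℝ => MvPolynomial.eval (projF k (pt + t • w)) g.den) 0 :=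
        (MvPolynomial.continuous_eval g.den).continuousAt.comp hproj.continuousAt
      refine this.eventually_ne ?_
      rw [h0]; exact hreg
    have hval : HasDerivAt (fun t : ℝ => g.value (projF k (pt + t • w)))
        (pullGrad k (logDiff g (projF k pt)) ⬝ᵥ ω) 0 := by
      have hF : HasFDerivAt g.value (fderiv ℝ g.value (projF k pt))
          (projF k (pt + (0 : ℝ) • w)) := by
        rw [h0]; exact (differentiableAt_value g hreg).hasFDerivAt
      have := hF.comp_hasDerivAt (0 : ℝ) hproj
      rw [fderiv_dlog] at this
      exact this
    have hD := hasDerivAt_eval_add_smul D pt w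
    have hN := hasDerivAt_eval_add_smul N pt w
    have hprod := hD.mul hval
    have hN' := hN.congr_of_eventuallyEq
      (f₁ := (fun t : ℝ => MvPolynomial.eval (pt + t • w) D) *
        fun t : ℝ => g.value (projF k (pt + t • w))) (by
      filter_upwards [hev1, hev2] with t h1 h2
      have := h _ h1
      rw [Pi.mul_apply, RatFun.value, ← mul_div_assoc, ← this, mul_div_cancel_right₀ _ h2])
    have := hprod.unique hN'
    rw [logGrad_dotProduct, logGrad_dotProduct, ← this, h0]
    ring
  funext v
  have := key (Pi.single v 1)
  simp only [dotProduct_single_one] at this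
  exact this

theorem logGrad_mul (pt : Var n → ℝ) (a b : PolyXY n) : logGrad pt (a * b) =
    MvPolynomial.eval pt a • logGrad pt b + MvPolynomial.eval pt b • logGrad pt a := by
  funext v
  simp only [logGrad_apply, Pi.add_apply, Pi.smul_apply, smul_eq_mul, Derivation.leibniz, map_add,
    map_mul]
  ring

theorem logGrad_mem_span (k : ℕ) (pt : Var n → ℝ) {N : PolyXY n} (hN : N ∈ algI n k) :
    logGrad pt N ∈ Submodule.span ℝ
      (Set.range fun ij : ℕ × ℕ => logGrad pt (I n k ij.1 ij.2)) := by
  induction hN using Algebra.adjoin_induction with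
  | mem x hx =>
    obtain ⟨ij, rfl⟩ := hx
    exact Submodule.subset_span ⟨ij, rfl⟩
  | algebraMap a =>
    have : logGrad pt (algebraMap ℝ (PolyXY n) a) = 0 := by
      funext v
      rw [logGrad_apply, MvPolynomial.algebraMap_eq, MvPolynomial.pderiv_C, map_zero, mul_zero]
      rfl
    rw [this]
    exact zero_mem _
  | add x y _ _ hx hy => rw [map_add]; exact add_mem hx hy
  | mul x y _ _ hx hy =>
    rw [logGrad_mul]
    exact add_mem (Submodule.smul_mem _ _ hy) (Submodule.smul_mem _ _ hx)

theorem gradBracket_eq_zero_of_mem_span (k : ℕ) (hk : 2 ≤ k) (hkn : k ≤ n) (pt : Var n → ℝ)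
    {a b : Var n → ℝ}
    (ha : a ∈ Submodule.span ℝ (Set.range fun ij : ℕ × ℕ => logGrad pt (I n k ij.1 ij.2)))
    (hb : b ∈ Submodule.span ℝ (Set.range fun ij : ℕ × ℕ => logGrad pt (I n k ij.1 ij.2))) :
    gradBracket n (k - 1) a b = 0 := by
  induction ha using Submodule.span_induction with
  | mem x hx =>
    obtain ⟨ij, rfl⟩ := hx
    induction hb using Submodule.span_induction with
    | mem y hy =>
      obtain ⟨ij', rfl⟩ := hy
      exact gradBracket_I k hk hkn pt _ _ _ _
    | zero => rw [map_zero]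
    | add y z _ _ hy hz => rw [map_add, hy, hz, add_zero]
    | smul c y _ hy => rw [map_smul, hy, smul_zero]
  | zero => rw [map_zero, LinearMap.zero_apply]
  | add x z _ _ hx hz => rw [map_add, LinearMap.add_apply, hx, hz, add_zero]
  | smul c x _ hx => rw [map_smul, LinearMap.smul_apply, hx, smul_zero]

/-- Where the upstairs denominators do not vanish, pulled-back logarithmic gradients lie in the span
of those of the I_ij, on which the bracket is zero. The bracket with denominators cleared, B, is
continuous, so it vanishes at all remaining points where both functions are regular. -/
theorem isInvolutive_reducedFamily (k : ℕ) (hk : 2 ≤ k) (hkn : k ≤ n) :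
    IsInvolutive k (reducedFamily n k) := by
  rintro g ⟨f, hf, -, hfg⟩ g' ⟨f', hf', -, hfg'⟩ s hs hreg hreg'
  obtain ⟨N, hN, D, hD, hD0, hrep⟩ := exists_represents k hf g hfg
  obtain ⟨N', hN', D', hD', hD0', hrep'⟩ := exists_represents k hf' g' hfg'
  set B : SpacePQ n → ℝ := fun s => ∑ a : Var n, ∑ b : Var n, poissonMatrix k s a b *
    MvPolynomial.eval s (derivNum g a) * MvPolynomial.eval s (derivNum g' b) with hB
  have hBc : Continuous B := by
    refine continuous_finsetSum _ fun a _ => continuous_finsetSum _ fun b _ => ?_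
    refine Continuous.mul (Continuous.mul ?_ (MvPolynomial.continuous_eval _))
      (MvPolynomial.continuous_eval _)
    simp only [poissonMatrix, Matrix.of_apply]
    exact (continuous_const.mul (continuous_apply a)).mul (continuous_apply b)
  have hPB : ∀ s, g.RegularAt s → g'.RegularAt s → B s = poissonBracket k g.value g'.value s *
      (MvPolynomial.eval s g.den ^ 2 * MvPolynomial.eval s g'.den ^ 2) := by
    intro s h h'
    rw [poissonBracket, Finset.sum_mul]
    refine Finset.sum_congr rfl fun a _ => ?_
    rw [Finset.sum_mul]
    refine Finset.sum_congr rfl fun b _ => ?_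
    rw [fderiv_value_single g h, fderiv_value_single g' h']
    have h1 : MvPolynomial.eval s g.den ≠ 0 := h
    have h2 : MvPolynomial.eval s g'.den ≠ 0 := h'
    field_simp
  have hzero : ∀ pt : Var n → ℝ, (∀ v, pt v ≠ 0) → MvPolynomial.eval pt D ≠ 0 →
      MvPolynomial.eval pt D' ≠ 0 → g.RegularAt (projF k pt) → g'.RegularAt (projF k pt) →
      poissonBracket k g.value g'.value (projF k pt) = 0 := by
    have hmem : ∀ (g : RatFun n) (N D : PolyXY n), N ∈ algI n k → D ∈ algI n k →
        Represents k g N D → ∀ pt : Var n → ℝ, (∀ v, pt v ≠ 0) → MvPolynomial.eval pt D ≠ 0 →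
        g.RegularAt (projF k pt) → pullGrad k (logDiff g (projF k pt)) ∈ Submodule.span ℝ
          (Set.range fun ij : ℕ × ℕ => logGrad pt (I n k ij.1 ij.2)) := by
      intro g N D hN hD hrep pt hpt hDpt hreg
      rw [← inv_smul_smul₀ hDpt (pullGrad k (logDiff g (projF k pt))),
        eval_smul_pullGrad k g N D hrep hpt hreg]
      exact Submodule.smul_mem _ _ (sub_mem (logGrad_mem_span k pt hN)
        (Submodule.smul_mem _ _ (logGrad_mem_span k pt hD)))
    intro pt hpt h1 h2 h3 h4
    rw [poissonBracket_eq k hk, neg_eq_zero]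
    exact gradBracket_eq_zero_of_mem_span k hk hkn pt (hmem g N D hN hD hrep pt hpt h1 h3)
      (hmem g' N' D' hN' hD' hrep' pt hpt h2 h4)
  have hcl := ((isOpen_regular g.den).inter (isOpen_regular g'.den)).inter_closure
    ⟨⟨hreg, hreg'⟩, levelSet_subset_closure_projF k (mul_ne_zero hD0 hD0') hs⟩
  have hBs := mem_closure_image hBc.continuousAt hcl
  have hB0 : B s = 0 := by
    have hsub : B '' ({s | MvPolynomial.eval s g.den ≠ 0} ∩ {s | MvPolynomial.eval s g'.den ≠ 0} ∩
        projF k '' {pt | (∀ v, pt v ≠ 0) ∧ MvPolynomial.eval pt (D * D') ≠ 0}) ⊆ {0} := by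
      rintro _ ⟨_, ⟨⟨h1, h2⟩, pt, ⟨hpt, hptD⟩, rfl⟩, rfl⟩
      rw [map_mul] at hptD
      rw [Set.mem_singleton_iff, hPB _ h1 h2, hzero pt hpt (left_ne_zero_of_mul hptD)
        (right_ne_zero_of_mul hptD) h1 h2, zero_mul]
    simpa using closure_mono hsub hBs
  rw [hPB s hreg hreg'] at hB0
  exact (mul_eq_zero.mp hB0).resolve_right (mul_ne_zero (pow_ne_zero 2 hreg) (pow_ne_zero 2 hreg'))

end Differentials

/-! ### Completeness -/

section Completeness

variable {n : ℕ} [NeZero n]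

/-- The Gram determinant of a family of polynomial vectors. -/
def gramDet {N : ℕ} (C : Matrix (Fin N) (Var n) (PolyXY n)) : PolyXY n := (C * Cᵀ).det

/-- Over ℝ the Gram matrix of independent rows is nonsingular. Independence thus becomes the
nonvanishing of one polynomial, and holding at one point it holds generically. -/
theorem eval_gramDet_ne_zero_iff {N : ℕ} (C : Matrix (Fin N) (Var n) (PolyXY n)) (pt : Var n → ℝ) :
    MvPolynomial.eval pt (gramDet C) ≠ 0 ↔
      LinearIndependent ℝ (fun a v => MvPolynomial.eval pt (C a v)) := by
  set A : Matrix (Fin N) (Var n) ℝ := C.map (MvPolynomial.eval pt) with hA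
  have h1 : MvPolynomial.eval pt (gramDet C) = (A * Aᵀ).det := by
    rw [gramDet, RingHom.map_det, RingHom.mapMatrix_apply, Matrix.map_mul, Matrix.transpose_map]
  have h2 : LinearIndependent ℝ (fun a v => MvPolynomial.eval pt (C a v)) ↔
      Function.Injective A.vecMul := Matrix.vecMul_injective_iff.symm
  rw [h1, h2]
  constructor
  · intro hdet
    refine (injective_iff_map_eq_zero (Matrix.vecMulLinear A)).mpr fun v hv => ?_
    by_contra hne
    refine hdet (Matrix.exists_vecMul_eq_zero_iff.mp ⟨v, hne, ?_⟩)
    have hv' : v ᵥ* A = 0 := hv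
    rw [← Matrix.vecMul_vecMul, hv', Matrix.zero_vecMul]
  · intro hinj hdet
    obtain ⟨v, hne, hv⟩ := Matrix.exists_vecMul_eq_zero_iff.mpr hdet
    have h3 : (v ᵥ* A) ⬝ᵥ (v ᵥ* A) = 0 := by
      rw [← Matrix.vecMul_vecMul] at hv
      have := congrArg (fun u => u ⬝ᵥ v) hv
      simp only [zero_dotProduct] at this
      rwa [Matrix.vecMul_transpose, dotProduct_comm, Matrix.dotProduct_mulVec] at this
    rw [dotProduct_self_eq_zero] at h3
    exact hne (hinj (h3.trans (Matrix.zero_vecMul A).symm))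

theorem exists_linearIndependent_comp {ι V : Type*} [AddCommGroup V] [Module ℝ V]
    [FiniteDimensional ℝ V] (f : ι → V) (N : ℕ)
    (h : N ≤ Module.finrank ℝ (Submodule.span ℝ (Set.range f))) :
    ∃ e : Fin N → ι, LinearIndependent ℝ (f ∘ e) := by
  obtain ⟨b, hb, -, hli⟩ := Submodule.exists_fun_fin_finrank_span_eq ℝ (Set.range f)
  choose e he using hb
  refine ⟨fun a => e (Fin.castLE h a), ?_⟩
  have : f ∘ (fun a => e (Fin.castLE h a)) = b ∘ Fin.castLE h := by
    funext a; exact he _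
  rw [this]
  exact hli.comp _ (Fin.castLE_injective h)

/-- The gradient of `I_{ij} / h ^ j`, multiplied by `h ^ (j + 1)`. -/
def quotGrad (k : ℕ) (h : PolyXY n) (ij : ℕ × ℕ) (v : Var n) : PolyXY n :=
  h * MvPolynomial.pderiv v (I n k ij.1 ij.2) -
    MvPolynomial.C (ij.2 : ℝ) * I n k ij.1 ij.2 * MvPolynomial.pderiv v h

/-- Where h ≠ 0, the gradients of the I_ij lie in the span of the quotient gradients together with
grad h, so at most one dimension is lost. Since h may vanish at the special point, independence is
first moved to a generic one. -/
theorem exists_independent_quotGrad (k : ℕ) (hk : 2 ≤ k) (hkn : k ≤ n) (h : PolyXY n) (hh : h ≠ 0) :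
    ∃ e : Fin (n + n.gcd (k - 1) - 1) → ℕ × ℕ,
      gramDet (Matrix.of fun a v => quotGrad k h (e a) v) ≠ 0 := by
  obtain ⟨e₁, he₁⟩ := exists_linearIndependent_comp
    (fun ij : ℕ × ℕ => grad (specialPoint (n := n) (k - 1)) (I n k ij.1 ij.2)) _
    (le_finrank_span_grad_specialPoint k hk hkn)
  set G : PolyXY n := gramDet (Matrix.of fun a v =>
    MvPolynomial.pderiv v (I n k (e₁ a).1 (e₁ a).2)) with hG
  have hG0 : G ≠ 0 := by
    intro h0
    have hu : (fun ij : ℕ × ℕ => grad (specialPoint (n := n) (k - 1)) (I n k ij.1 ij.2)) ∘ e₁ =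
        fun a v => MvPolynomial.eval (specialPoint (k - 1))
          (MvPolynomial.pderiv v (I n k (e₁ a).1 (e₁ a).2)) := by
      funext a v
      exact grad_apply _ _ _
    rw [hu] at he₁
    have := (eval_gramDet_ne_zero_iff (Matrix.of fun a v =>
      MvPolynomial.pderiv v (I n k (e₁ a).1 (e₁ a).2)) (specialPoint (n := n) (k - 1))).mpr he₁
    rw [← hG, h0, map_zero] at this
    exact this rfl
  obtain ⟨pt, hpt⟩ : {pt | MvPolynomial.eval pt (h * G) ≠ 0}.Nonempty :=
    closure_nonempty_iff.mp ⟨0, mem_closure_eval_ne_zero (mul_ne_zero hh hG0) 0⟩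
  rw [Set.mem_ofPred_eq, map_mul] at hpt
  have hhpt := left_ne_zero_of_mul hpt
  have hu := (eval_gramDet_ne_zero_iff _ _).mp (right_ne_zero_of_mul hpt)
  set u : Fin (n + n.gcd (k - 1)) → Var n → ℝ := fun a v =>
    MvPolynomial.eval pt (MvPolynomial.pderiv v (I n k (e₁ a).1 (e₁ a).2)) with hudef
  replace hu : LinearIndependent ℝ u := hu
  set κ : Fin (n + n.gcd (k - 1)) → Var n → ℝ := fun a v =>
    MvPolynomial.eval pt (quotGrad k h (e₁ a) v) with hκ
  set η : Var n → ℝ := fun v => MvPolynomial.eval pt (MvPolynomial.pderiv v h)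
  have hspan : Submodule.span ℝ (Set.range u) ≤
      Submodule.span ℝ (Set.range κ) ⊔ Submodule.span ℝ {η} := by
    rw [Submodule.span_le]
    rintro _ ⟨a, rfl⟩
    have e : u a = (MvPolynomial.eval pt h)⁻¹ • κ a + ((MvPolynomial.eval pt h)⁻¹ *
        ((e₁ a).2 * MvPolynomial.eval pt (I n k (e₁ a).1 (e₁ a).2))) • η := by
      funext v
      simp only [hudef, hκ, η, quotGrad, Pi.add_apply, Pi.smul_apply, smul_eq_mul, map_sub, map_mul,
        MvPolynomial.eval_C]
      field_simp
      ring
    rw [e]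
    exact add_mem (Submodule.mem_sup_left (Submodule.smul_mem _ _
      (Submodule.subset_span ⟨a, rfl⟩))) (Submodule.mem_sup_right (Submodule.smul_mem _ _
        (Submodule.mem_span_singleton_self η)))
  have hfin : n + n.gcd (k - 1) - 1 ≤ Module.finrank ℝ (Submodule.span ℝ (Set.range κ)) := by
    have h1 : Module.finrank ℝ (Submodule.span ℝ (Set.range u)) = n + n.gcd (k - 1) := by
      rw [finrank_span_eq_card hu, Fintype.card_fin]
    have h2 := Submodule.finrank_mono hspan
    have h3 := Submodule.finrank_add_le_finrank_add_finrank
      (Submodule.span ℝ (Set.range κ)) (Submodule.span ℝ {η})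
    have h4 : Module.finrank ℝ (Submodule.span ℝ {η}) ≤ 1 := by
      have := finrank_span_le_card (R := ℝ) ({η} : Set (Var n → ℝ))
      simpa using this
    omega
  obtain ⟨e₂, he₂⟩ := exists_linearIndependent_comp κ _ hfin
  refine ⟨fun a => e₁ (e₂ a), fun h0 => ?_⟩
  have := (eval_gramDet_ne_zero_iff (Matrix.of fun a v => quotGrad k h (e₁ (e₂ a)) v) pt).mpr he₂
  rw [h0, map_zero] at this
  exact this rfl

theorem eval_pow_mul_pullGrad (k : ℕ) (g : RatFun n) (h : PolyXY n) (ij : ℕ × ℕ)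
    (hrep : Represents k g (I n k ij.1 ij.2) (h ^ ij.2)) {pt : Var n → ℝ} (hpt : ∀ v, pt v ≠ 0)
    (hreg : g.RegularAt (projF k pt)) (v : Var n) :
    MvPolynomial.eval pt h ^ (ij.2 + 1) * pullGrad k (logDiff g (projF k pt)) v =
      pt v * MvPolynomial.eval pt (quotGrad k h ij v) := by
  have h1 := congrFun (eval_smul_pullGrad k g _ _ hrep hpt hreg) v
  have h2 := hrep pt hpt
  have hreg0 : MvPolynomial.eval (projF k pt) g.den ≠ 0 := hreg
  have hval : g.value (projF k pt) * MvPolynomial.eval pt h ^ ij.2 =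
      MvPolynomial.eval pt (I n k ij.1 ij.2) := by
    rw [map_pow] at h2
    rw [RatFun.value, div_mul_eq_mul_div, div_eq_iff hreg0, h2, mul_comm]
  simp only [Pi.sub_apply, Pi.smul_apply, smul_eq_mul, logGrad_apply, map_pow,
    Derivation.leibniz_pow, nsmul_eq_mul, map_mul, map_natCast] at h1
  -- For degree 0 the truncated exponent j - 1 is wrong, but the factor j is zero.
  have h3 : (ij.2 : ℝ) * (MvPolynomial.eval pt h ^ (ij.2 - 1) * MvPolynomial.eval pt h) =
      ij.2 * MvPolynomial.eval pt h ^ ij.2 := by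
    rcases Nat.eq_zero_or_pos ij.2 with h0 | h0
    · rw [h0]; simp
    · rw [← pow_succ, Nat.sub_add_cancel h0]
  simp only [quotGrad, map_sub, map_mul, MvPolynomial.eval_C]
  rw [pow_succ, ← hval]
  linear_combination MvPolynomial.eval pt h * h1 -
    g.value (projF k pt) * pt v * MvPolynomial.eval pt (MvPolynomial.pderiv v h) * h3

theorem isComplete_reducedFamily (k : ℕ) (hk : 2 ≤ k) (hkn : k ≤ n) :
    IsComplete k (reducedFamily n k) := by
  obtain ⟨i₀, hi₀⟩ := exists_I_one_ne_zero (n := n) k hk hkn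
  set h : PolyXY n := I n k i₀ 1
  have hh1 : h.IsHomogeneous 1 := I_isHomogeneous k hk hkn i₀ 1
  have hhj : ∀ j, (h ^ j).IsHomogeneous j := fun j => by simpa using hh1.pow j
  obtain ⟨e, he⟩ := exists_independent_quotGrad k hk hkn h hi₀
  set W : PolyXY n := gramDet (Matrix.of fun a v => quotGrad k h (e a) v) with hW
  set g : Fin (n + n.gcd (k - 1) - 1) → RatFun n := fun a =>
    descend k (e a).2 (I n k (e a).1 (e a).2) (h ^ (e a).2) (hhj _) (pow_ne_zero _ hi₀) with hg
  have hpull : ∀ a, algebraMap (PolyXY n) (FieldXY n) (I n k (e a).1 (e a).2) /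
      algebraMap (PolyXY n) (FieldXY n) (h ^ (e a).2) = (g a).pullback k := fun a =>
    (pullback_descend k _ _ _ (I_isHomogeneous k hk hkn _ _) (hhj _) (pow_ne_zero _ hi₀)).symm
  have hrep : ∀ a, Represents k (g a) (I n k (e a).1 (e a).2) (h ^ (e a).2) := fun a =>
    represents_of_pullback k (g a) _ _ (pow_ne_zero _ hi₀) (hpull a)
  refine ⟨n + n.gcd (k - 1) - 1, g,
    -- The section is normalized by x_0 = 1. Taking the union over all scalings t reaches every
    -- torus point above s without using how W scales.
    ⋃ t : {t : ℝ // t ≠ 0}, {s | MvPolynomial.eval ((t : ℝ) • sec k s) (W * h) ≠ 0},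
    fun a => ?_, ?_, ?_, ?_⟩
  · refine ⟨algebraMap (PolyXY n) (FieldXY n) (I n k (e a).1 (e a).2) /
      algebraMap (PolyXY n) (FieldXY n) (h ^ (e a).2), ?_, ⟨(e a).2, _, _, I_isHomogeneous k hk hkn _ _, hhj _, pow_ne_zero _ hi₀, rfl⟩,
      hpull a⟩
    rw [map_pow]
    have hmem : ∀ ij : ℕ × ℕ, algebraMap (PolyXY n) (FieldXY n) (I n k ij.1 ij.2) ∈
        IntermediateField.adjoin ℝ (Set.range fun ij : ℕ × ℕ =>
          algebraMap (PolyXY n) (FieldXY n) (I n k ij.1 ij.2)) := fun ij =>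
      IntermediateField.subset_adjoin ℝ _ ⟨ij, rfl⟩
    exact div_mem (hmem (e a)) (pow_mem (hmem (i₀, 1)) _)
  · refine isOpen_iUnion fun t => isOpen_ne_fun ?_ continuous_const
    exact (MvPolynomial.continuous_eval _).comp ((continuous_sec k).const_smul (t : ℝ))
  · refine (levelSet_subset_closure_projF k (mul_ne_zero he hi₀)).trans (closure_mono ?_)
    rintro _ ⟨pt, ⟨hpt, hptW⟩, rfl⟩
    refine ⟨projF_mem_levelSet k hpt, Set.mem_iUnion.mpr ⟨⟨pt (Sum.inl 0), hpt _⟩, ?_⟩⟩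
    rw [Set.mem_ofPred_eq, sec_projF k pt hpt, smul_inv_smul₀ (hpt _)]
    exact hptW
  · rintro s ⟨hs, hsU⟩
    obtain ⟨⟨t, ht⟩, hts⟩ := Set.mem_iUnion.mp hsU
    simp only [Set.mem_ofPred_eq, map_mul] at hts
    set pt : Var n → ℝ := t • sec k s with hptdef
    have hpt : ∀ v, pt v ≠ 0 := fun v => mul_ne_zero ht (sec_ne_zero k hs v)
    have hproj : projF k pt = s := by rw [hptdef, projF_smul k _ t ht, projF_sec k hs]
    have hWpt := left_ne_zero_of_mul hts
    have hhpt := right_ne_zero_of_mul hts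
    have hreg : ∀ a, (g a).RegularAt s := by
      intro a
      rw [RatFun.RegularAt, hg]
      simp only [descend]
      rw [eval_aeval_sec, map_pow]
      rw [hptdef, eval_smul_of_isHomogeneous hh1] at hhpt
      exact pow_ne_zero _ (right_ne_zero_of_mul hhpt)
    refine ⟨hreg, ?_, ?_⟩
    · rw [Fintype.linearIndependent_iff]
      intro c hc
      have hκ := (eval_gramDet_ne_zero_iff _ _).mp hWpt
      rw [Fintype.linearIndependent_iff] at hκ
      have hkey := fun a v => eval_pow_mul_pullGrad k (g a) h (e a) (hrep a) hpt
        (by rw [hproj]; exact hreg a) v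
      rw [hproj] at hkey
      -- The relation among the differentials is tested on the tangent vectors that are images under
      -- dπ of the logarithmic coordinate directions; this recovers the gradients upstairs.
      have hsum : ∀ v, ∑ a, c a * pullGrad k (logDiff (g a) s) v = 0 := by
        intro v
        have htan := dlog_mem_tangentSpace k hpt (Pi.single v 1)
        rw [hproj] at htan
        have h1 := LinearMap.congr_fun hc ⟨_, htan⟩
        rw [LinearMap.sum_apply, LinearMap.zero_apply] at h1
        refine Eq.trans ?_ h1
        refine Finset.sum_congr rfl fun a _ => ?_
        have h2 := fderiv_dlog k (g a).value s (Pi.single v 1)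
        rw [dotProduct_single_one] at h2
        rw [LinearMap.smul_apply, LinearMap.domRestrict_apply, smul_eq_mul]
        exact congrArg (c a * ·) h2.symm
      have hc0 := hκ (fun a => c a * (MvPolynomial.eval pt h ^ ((e a).2 + 1))⁻¹) (by
        funext v
        rw [Finset.sum_apply, Pi.zero_apply]
        refine mul_left_cancel₀ (hpt v) ?_
        rw [mul_zero, Finset.mul_sum, ← hsum v]
        refine Finset.sum_congr rfl fun a _ => ?_
        have h3 := hkey a v
        have h4 : MvPolynomial.eval pt h ^ ((e a).2 + 1) ≠ 0 := pow_ne_zero _ hhpt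
        simp only [Pi.smul_apply, smul_eq_mul, Matrix.of_apply]
        rw [mul_left_comm, ← h3, mul_assoc, inv_mul_cancel_left₀ h4])
      intro a
      exact (mul_eq_zero.mp (hc0 a)).resolve_right (inv_ne_zero (pow_ne_zero _ hhpt))
    -- With c = gcd(n, k - 1) the count is 2(n + c - 1) + (2n - 2c) = 2(2n - 1).
    · have h1 := rank_poissonMatrix k hk s (ne_zero_of_mem_levelSet hs)
      have h2 := finrank_tangentSpace s hs
      have h3 := NeZero.pos n
      omega

end Completeness
end HigherPentagram
end

theorem corollary4p1 (n k : ℕ) [NeZero n] (hk : 2 ≤ k) (hkn : k ≤ n) :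
    (∀ f : HigherPentagram.FieldXY n,
      HigherPentagram.IsRationalInI n k f → HigherPentagram.IsHomogeneousDegreeZero f →
        (∃ g : HigherPentagram.RatFun n, f = g.pullback k) ∧
        (∀ g : HigherPentagram.RatFun n, f = g.pullback k → HigherPentagram.IsIntegral k g)) ∧
    HigherPentagram.IsInvolutive k (HigherPentagram.reducedFamily n k) ∧
    HigherPentagram.IsComplete k (HigherPentagram.reducedFamily n k) := by
  refine ⟨fun f hf hf0 => ⟨HigherPentagram.exists_pullback_eq k hf0, fun g hg => ?_⟩,
    HigherPentagram.isInvolutive_reducedFamily k hk hkn,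
    HigherPentagram.isComplete_reducedFamily k hk hkn⟩
  obtain ⟨N, hN, D, hD, hD0, h⟩ := HigherPentagram.exists_represents k hf g hg
  exact HigherPentagram.isIntegral_of_represents k hk hkn g hN hD hD0 h
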